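/- Let $(\Sigma,g_{can})$ be a compact connected Riemann surface with a compatible Riemannian metric of constant curvature $K$, with complex structure $j$ and area form $\omega$. Let $p:P\to\Sigma$ be a principal circle bundle with a connection form $\theta$ (normalized to be $1$ on the generator of the circle action of period $2\pi$) such that $d\theta=c\,p^*\omega$ for a constant $c\in\mathbb R$. Let $f,g$ be smooth positive functions on $(a,b)$, $a<b$, and equip $U=(a,b)\times P$ with the metric $$g_{f,g}=dt^2+f(t)^2\theta^2+g(t)^2p^*g_{can},$$ with Levi-Civita connection $\nabla$. Let $H=\partial_t$, let $\theta^\sharp$ be the vector field dual to $\theta$ with respect to $\theta^2+p^*g_{can}$, and let $J,\bar J$ be the almost complex structures with $JH=\frac1f\theta^\sharp$, $\bar JH=-\frac1f\theta^\sharp$ and $JX^h=\bar JX^h=(jX)^h$ for horizontal lifts $X^h$ (that is, $dt(X^h)=\theta(X^h)=0$) of vectors $X$ on $\Sigma$. Let $\mathcal D$ be the distribution spanned by $\theta^\sharp$ and $H$. Then $\mathcal D$ is a totally geodesic foliation. Both $J$ and $\bar J$ are Hermitian (orthogonal and integrable), and $\mathcal D$ is contained in the nullity of each: $\nabla_vJ=\nabla_v\bar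 J=0$ for $v\in\mathcal D$. The distribution $\mathcal D^\perp$ is umbilical with mean curvature normal $\xi=-\nabla\ln g$, i.e. the component in $\mathcal D$ of $\nabla_XX$ is $g_{f,g}(X,X)\,\xi$ for all sections $X$ of $\mathcal D^\perp$. Suppose moreover that the Ricci endomorphism $S$ satisfies $S=\lambda\,\mathrm{Id}$ on $\mathcal D$ and $S=\mu\,\mathrm{Id}$ on $\mathcal D^\perp$ for functions $\lambda,\mu$ on $U$, and that $g$ is not constant. Then the following conditions are equivalent: (a) there is $E\in\mathbb R$ with $\lambda-\mu=Eg^2$; (b) there are $C,D\in\mathbb R$ with $\mu=Cg^2+D$; (c) $\lambda-2\mu$ is constant. If in addition $g_{f,g}$ is not flat, they are also equivalent to (d) $(U,g_{f,g})$ is a bi-Hermitian Gray surface, that is: it is irreducible, its Ricci tensor $\rho$ and scalar curvature $\tau$ satisfy $\mathfrak C_{XYZ}\nabla_X\rho(Y,Z)=\frac13\mathfrak C_{XYZ}\,(X\tau)\,g_{f,g}(Y,Z)$ (cyclic sums), and it admits two Hermitian complex structures of opposite orientations commuting with the Ricci tensor. -/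

import Mathlib

open Bundle Set
open scoped Manifold ContDiff Topology

namespace GraySurface

/-! ## Riemannian geometry on a smooth manifold -/

section General

variable {E : Type*} [NormedAddCommGroup E] [NormedSpace ℝ E] [FiniteDimensional ℝ E]
  {H : Type*} [TopologicalSpace H] {I : ModelWithCorners ℝ E H}
  {M : Type*} [TopologicalSpace M] [ChartedSpace H M] [IsManifold I ∞ M]

/-- The vector field `X` is smooth on the set `U`. -/
def SmoothField (X : Π x : M, TangentSpace I x) (U : Set M) : Prop :=
  ContMDiffOn I I.tangent ∞ (fun x ↦ (⟨x, X x⟩ : TangentBundle I M)) U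

/-- The vector field `X` is differentiable at `x`. -/
def DiffFieldAt (X : Π x : M, TangentSpace I x) (x : M) : Prop :=
  MDifferentiableAt I I.tangent (fun y ↦ (⟨y, X y⟩ : TangentBundle I M)) x

/-- The differential of a real function at a point. -/
noncomputable def dfun (u : M → ℝ) (x : M) : TangentSpace I x →L[ℝ] ℝ :=
  mfderiv I 𝓘(ℝ, ℝ) u x

/-- `conn` is the Levi-Civita connection of the metric `G`: it is torsion free and metric.
Here `conn Y x v` is `∇_v Y` at `x`. -/
structure IsLeviCivita (G : Π x : M, TangentSpace I x →L[ℝ] TangentSpace I x →L[ℝ] ℝ)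
    (conn : CovariantDerivative I E (TangentSpace I : M → Type _)) : Prop where
  torsion_free : ∀ (X Y : Π x : M, TangentSpace I x) (x : M),
    DiffFieldAt X x → DiffFieldAt Y x →
      conn Y x (X x) - conn X x (Y x) = VectorField.mlieBracket I X Y x
  metric : ∀ (X Y : Π x : M, TangentSpace I x) (x : M),
    DiffFieldAt X x → DiffFieldAt Y x → ∀ v : TangentSpace I x,
      dfun (I := I) (fun y ↦ G y (X y) (Y y)) x v = G x (conn X x v) (Y x) + G x (X x) (conn Y x v)

/-- The curvature `R(u, v) w = ∇_u ∇_v w - ∇_v ∇_u w - ∇_[u, v] w`, computed with arbitrary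
smooth extensions of the three tangent vectors. -/
noncomputable def curvature (conn : CovariantDerivative I E (TangentSpace I : M → Type _))
    (x : M) (u v w : TangentSpace I x) : TangentSpace I x :=
  let X : Π y : M, TangentSpace I y := FiberBundle.extend E u
  let Y : Π y : M, TangentSpace I y := FiberBundle.extend E v
  let Z : Π y : M, TangentSpace I y := FiberBundle.extend E w
  conn (fun y ↦ conn Z y (Y y)) x u - conn (fun y ↦ conn Z y (X y)) x v
    - conn Z x (VectorField.mlieBracket I X Y x)

/-- The connection is flat: its curvature vanishes identically. -/
def IsFlat (conn : CovariantDerivative I E (TangentSpace I : M → Type _)) : Prop :=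
  ∀ (x : M) (u v w : TangentSpace I x), curvature conn x u v w = 0

/-- `G` has constant sectional curvature `K`. -/
def HasConstantCurvature (G : Π x : M, TangentSpace I x →L[ℝ] TangentSpace I x →L[ℝ] ℝ)
    (K : ℝ) : Prop :=
  ∃ conn : CovariantDerivative I E (TangentSpace I : M → Type _), IsLeviCivita G conn ∧
    ∀ (x : M) (u v w : TangentSpace I x),
      curvature conn x u v w = K • (G x v w • u - G x u w • v)

/-- A basis of the tangent space at `x` (used for traces, which do not depend on it). -/
noncomputable def tbasis (I : ModelWithCorners ℝ E H) (x : M) :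
    Module.Basis (Fin (Module.finrank ℝ E)) ℝ (TangentSpace I x) :=
  (Module.finBasis ℝ E : Module.Basis (Fin (Module.finrank ℝ E)) ℝ E)

/-- The coordinate forms of `tbasis`. -/
noncomputable def tcoord (I : ModelWithCorners ℝ E H) (x : M) (i : Fin (Module.finrank ℝ E)) :
    TangentSpace I x →L[ℝ] ℝ :=
  (LinearMap.toContinuousLinearMap ((Module.finBasis ℝ E).coord i) : E →L[ℝ] ℝ)

/-- The Ricci tensor `ρ(v, w)`, the trace of `u ↦ R(u, v) w`. -/
noncomputable def ricci (conn : CovariantDerivative I E (TangentSpace I : M → Type _))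
    (x : M) (v w : TangentSpace I x) : ℝ :=
  ∑ i, tcoord I x i (curvature conn x (tbasis I x i) v w)

/-- The Ricci endomorphism `S`, characterized by `G (S v) w = ρ(v, w)`.  The vectors
`(G x).inverse (tcoord I x i)` form the basis reciprocal to `tbasis I x` with respect to `G`. -/
noncomputable def ricciEnd (G : Π x : M, TangentSpace I x →L[ℝ] TangentSpace I x →L[ℝ] ℝ)
    (conn : CovariantDerivative I E (TangentSpace I : M → Type _))
    (x : M) (v : TangentSpace I x) : TangentSpace I x :=
  ∑ i, ricci conn x v (tbasis I x i) • (G x).inverse (tcoord I x i)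

/-- The scalar curvature, the trace of the Ricci endomorphism. -/
noncomputable def scalarCurvature
    (G : Π x : M, TangentSpace I x →L[ℝ] TangentSpace I x →L[ℝ] ℝ)
    (conn : CovariantDerivative I E (TangentSpace I : M → Type _)) (x : M) : ℝ :=
  ∑ i, tcoord I x i (ricciEnd G conn x (tbasis I x i))

/-- The gradient of the function `u`: `G (grad u) v = du v`. -/
noncomputable def gradient (G : Π x : M, TangentSpace I x →L[ℝ] TangentSpace I x →L[ℝ] ℝ)
    (u : M → ℝ) (x : M) : TangentSpace I x :=
  (G x).inverse (dfun u x)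

/-- `Δ` is a smooth distribution of rank `k`: it is locally spanned by `k` smooth pointwise
linearly independent vector fields. -/
def IsDistribution (k : ℕ) (Δ : Π x : M, Submodule ℝ (TangentSpace I x)) : Prop :=
  ∀ x₀ : M, ∃ U : Set M, IsOpen U ∧ x₀ ∈ U ∧ ∃ X : Fin k → Π x : M, TangentSpace I x,
    (∀ i, SmoothField (X i) U) ∧ ∀ x ∈ U, LinearIndependent ℝ (fun i ↦ X i x) ∧
      Δ x = Submodule.span ℝ (range fun i ↦ X i x)

/-- The vector field `X` is a smooth section of `Δ` over the set `U`. -/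
def IsSectionOn (Δ : Π x : M, Submodule ℝ (TangentSpace I x)) (X : Π x : M, TangentSpace I x)
    (U : Set M) : Prop :=
  SmoothField X U ∧ ∀ x ∈ U, X x ∈ Δ x

/-- The orthogonal complement of a distribution. -/
def orthDistribution (G : Π x : M, TangentSpace I x →L[ℝ] TangentSpace I x →L[ℝ] ℝ)
    (Δ : Π x : M, Submodule ℝ (TangentSpace I x)) (x : M) : Submodule ℝ (TangentSpace I x) where
  carrier := {w | ∀ v ∈ Δ x, G x v w = 0}
  add_mem' := by
    intro w w' hw hw' v hv
    rw [map_add, hw v hv, hw' v hv, add_zero]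
  zero_mem' := by
    intro v _
    rw [map_zero]
  smul_mem' := by
    intro r w hw v hv
    rw [map_smul, hw v hv, smul_zero]

/-- The distribution `Δ` of rank `k` is involutive and its leaves are totally geodesic. -/
structure IsTotallyGeodesicFoliation
    (conn : CovariantDerivative I E (TangentSpace I : M → Type _)) (k : ℕ)
    (Δ : Π x : M, Submodule ℝ (TangentSpace I x)) : Prop where
  distribution : IsDistribution k Δ
  involutive : ∀ (U : Set M) (X Y : Π x : M, TangentSpace I x), IsOpen U →
    IsSectionOn Δ X U → IsSectionOn Δ Y U → ∀ x ∈ U, VectorField.mlieBracket I X Y x ∈ Δ x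
  totally_geodesic : ∀ (U : Set M) (X : Π x : M, TangentSpace I x), IsOpen U →
    IsSectionOn Δ X U → ∀ x ∈ U, conn X x (X x) ∈ Δ x

/-- The distribution `Δ` of rank `k` is umbilical with mean curvature normal `ξ`: `ξ` is orthogonal
to `Δ`, and the component of `∇_X X` orthogonal to `Δ` is `G(X, X) ξ` for sections `X` of `Δ`. -/
structure IsUmbilical (G : Π x : M, TangentSpace I x →L[ℝ] TangentSpace I x →L[ℝ] ℝ)
    (conn : CovariantDerivative I E (TangentSpace I : M → Type _)) (k : ℕ)
    (Δ : Π x : M, Submodule ℝ (TangentSpace I x)) (ξ : Π x : M, TangentSpace I x) : Prop where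
  distribution : IsDistribution k Δ
  normal : ∀ x, ξ x ∈ orthDistribution G Δ x
  umbilical : ∀ (U : Set M) (X : Π x : M, TangentSpace I x), IsOpen U → IsSectionOn Δ X U →
    ∀ x ∈ U, conn X x (X x) - G x (X x) (X x) • ξ x ∈ Δ x

/-- The Riemannian manifold is irreducible: the only parallel distributions are `0` and `TM`
(on a connected manifold: the holonomy representation is irreducible). -/
def IsIrreducible (conn : CovariantDerivative I E (TangentSpace I : M → Type _)) : Prop :=
  ∀ (k : ℕ) (Δ : Π x : M, Submodule ℝ (TangentSpace I x)), IsDistribution k Δ →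
    (∀ (U : Set M) (X : Π x : M, TangentSpace I x), IsOpen U → IsSectionOn Δ X U →
      ∀ x ∈ U, ∀ v : TangentSpace I x, conn X x v ∈ Δ x) →
    k = 0 ∨ k = Module.finrank ℝ E

/-- `J` is an orthogonal integrable complex structure (integrability is the vanishing of the
Nijenhuis tensor). -/
structure IsHermitianStructure (G : Π x : M, TangentSpace I x →L[ℝ] TangentSpace I x →L[ℝ] ℝ)
    (J : Π x : M, TangentSpace I x →L[ℝ] TangentSpace I x) : Prop where
  smooth : ∀ (U : Set M) (X : Π x : M, TangentSpace I x), IsOpen U → SmoothField X U →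
    SmoothField (fun x ↦ J x (X x)) U
  square : ∀ (x : M) (v : TangentSpace I x), J x (J x v) = -v
  orthogonal : ∀ (x : M) (v w : TangentSpace I x), G x (J x v) (J x w) = G x v w
  integrable : ∀ (U : Set M) (X Y : Π x : M, TangentSpace I x), IsOpen U →
    SmoothField X U → SmoothField Y U → ∀ x ∈ U,
      VectorField.mlieBracket I (fun y ↦ J y (X y)) (fun y ↦ J y (Y y)) x
        - J x (VectorField.mlieBracket I (fun y ↦ J y (X y)) Y x)
        - J x (VectorField.mlieBracket I X (fun y ↦ J y (Y y)) x)
        - VectorField.mlieBracket I X Y x = 0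

/-- The nullity of `J` at `x`: the tangent vectors `v` with `∇_v J = 0`. -/
def nullity (conn : CovariantDerivative I E (TangentSpace I : M → Type _))
    (J : Π x : M, TangentSpace I x →L[ℝ] TangentSpace I x) (x : M) : Set (TangentSpace I x) :=
  {v | ∀ (U : Set M) (Y : Π x : M, TangentSpace I x), IsOpen U → x ∈ U → SmoothField Y U →
    conn (fun y ↦ J y (Y y)) x v = J x (conn Y x v)}

/-- On a 4-manifold: the orientations given by the bases `v, J v, w, J w` and
`v', J' v', w', J' w'` are opposite to each other. -/
def OppositeOrientations (J J' : Π x : M, TangentSpace I x →L[ℝ] TangentSpace I x) : Prop :=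
  ∀ (x : M) (Φ : (TangentSpace I x) [⋀^Fin 4]→ₗ[ℝ] ℝ) (v w v' w' : TangentSpace I x),
    Φ ![v, J x v, w, J x w] * Φ ![v', J' x v', w', J' x w'] ≤ 0

/-- `(∇_X ρ)(Y, Z)` at `x`, for the Ricci tensor `ρ`. -/
noncomputable def nablaRicci (conn : CovariantDerivative I E (TangentSpace I : M → Type _))
    (X Y Z : Π x : M, TangentSpace I x) (x : M) : ℝ :=
  dfun (I := I) (fun y ↦ ricci conn y (Y y) (Z y)) x (X x)
    - ricci conn x (conn Y x (X x)) (Z x) - ricci conn x (Y x) (conn Z x (X x))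

/-- The Gray condition defining the class `𝒜𝒞^⊥`: the cyclic sum of `(∇_X ρ)(Y, Z)` equals
`2 / (dim M + 2)` times the cyclic sum of `(X τ) G(Y, Z)`. -/
def IsACPerp (G : Π x : M, TangentSpace I x →L[ℝ] TangentSpace I x →L[ℝ] ℝ)
    (conn : CovariantDerivative I E (TangentSpace I : M → Type _)) : Prop :=
  ∀ (U : Set M) (X Y Z : Π x : M, TangentSpace I x), IsOpen U →
    SmoothField X U → SmoothField Y U → SmoothField Z U → ∀ x ∈ U,
      nablaRicci conn X Y Z x + nablaRicci conn Y Z X x + nablaRicci conn Z X Y x =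
        2 / ((Module.finrank ℝ E : ℝ) + 2) *
          (dfun (scalarCurvature G conn) x (X x) * G x (Y x) (Z x)
            + dfun (scalarCurvature G conn) x (Y x) * G x (Z x) (X x)
            + dfun (scalarCurvature G conn) x (Z x) * G x (X x) (Y x))

/-- A bi-Hermitian Gray surface: an irreducible `𝒜𝒞^⊥` 4-manifold admitting two Hermitian complex
structures of opposite orientation which commute with the Ricci tensor. -/
structure IsBiHermitianGray (G : Π x : M, TangentSpace I x →L[ℝ] TangentSpace I x →L[ℝ] ℝ)
    (conn : CovariantDerivative I E (TangentSpace I : M → Type _)) : Prop where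
  dim : Module.finrank ℝ E = 4
  irreducible : IsIrreducible conn
  acPerp : IsACPerp G conn
  structures : ∃ J J' : Π x : M, TangentSpace I x →L[ℝ] TangentSpace I x,
    IsHermitianStructure G J ∧ IsHermitianStructure G J' ∧ OppositeOrientations J J' ∧
    (∀ x v, ricciEnd G conn x (J x v) = J x (ricciEnd G conn x v)) ∧
    (∀ x v, ricciEnd G conn x (J' x v) = J' x (ricciEnd G conn x v))

end General

/-! ## Circle bundles with connection over a Riemannian surface -/

section CircleBundle

variable {B : Type*} [TopologicalSpace B] [ChartedSpace (EuclideanSpace ℝ (Fin 2)) B]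
  [IsManifold (𝓡 2) ∞ B]
  {P : Type*} [TopologicalSpace P] [ChartedSpace (EuclideanSpace ℝ (Fin 3)) P]
  [IsManifold (𝓡 3) ∞ P]

/-- `p : P → B` is a smooth principal circle bundle. -/
structure IsCircleBundle [MulAction Circle P] (p : P → B) : Prop where
  smooth_action : ContMDiffSMul (𝓡 1) (𝓡 3) ∞ Circle P
  smooth : ContMDiff (𝓡 3) (𝓡 2) ∞ p
  surjective : Function.Surjective p
  submersion : ∀ q : P, Function.Surjective (mfderiv (𝓡 3) (𝓡 2) p q)
  free : ∀ (z : Circle) (q : P), z • q = q → z = 1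
  fibres : ∀ q q' : P, p q = p q' ↔ ∃ z : Circle, z • q = q'

/-- `θ` is a connection form of the circle bundle `P`: a smooth invariant 1-form with value `1` on
the generator of the action `s ↦ exp (i s)`. -/
structure IsConnectionForm [MulAction Circle P] (θ : Π q : P, TangentSpace (𝓡 3) q →L[ℝ] ℝ) :
    Prop where
  smooth : ∀ (U : Set P) (X : Π q : P, TangentSpace (𝓡 3) q), IsOpen U → SmoothField X U →
    ContMDiffOn (𝓡 3) 𝓘(ℝ, ℝ) ∞ (fun q ↦ θ q (X q)) U
  invariant : ∀ (z : Circle) (q : P) (v : TangentSpace (𝓡 3) q),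
    θ (z • q) (mfderiv (𝓡 3) (𝓡 3) (fun q' : P ↦ z • q') q v) = θ q v
  generator : ∀ q : P, θ (Circle.exp 0 • q)
    (mfderiv 𝓘(ℝ, ℝ) (𝓡 3) (fun s : ℝ ↦ Circle.exp s • q) 0 (1 : ℝ)) = 1

/-- `dθ = c p^* ω`, where `ω(u, v) = h(j u, v)` is the area form of the metric `h` on `B`, for the
orientation given by the complex structure `j`. -/
def HasCurvatureForm (h : Π y : B, TangentSpace (𝓡 2) y →L[ℝ] TangentSpace (𝓡 2) y →L[ℝ] ℝ)
    (j : Π y : B, TangentSpace (𝓡 2) y →L[ℝ] TangentSpace (𝓡 2) y)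
    (p : P → B) (θ : Π q : P, TangentSpace (𝓡 3) q →L[ℝ] ℝ) (c : ℝ) : Prop :=
  ∀ (U : Set P) (X Y : Π q : P, TangentSpace (𝓡 3) q), IsOpen U →
    SmoothField X U → SmoothField Y U → ∀ q ∈ U,
      dfun (fun q' ↦ θ q' (Y q')) q (X q) - dfun (fun q' ↦ θ q' (X q')) q (Y q)
          - θ q (VectorField.mlieBracket (𝓡 3) X Y q)
        = c * h (p q) (j (p q) (mfderiv (𝓡 3) (𝓡 2) p q (X q))) (mfderiv (𝓡 3) (𝓡 2) p q (Y q))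

/-! ## The warped metric on `(a, b) × P` -/

/-- The manifold `(a, b) × P`. -/
abbrev Cyl (a b : ℝ) (P : Type*) : Type _ :=
  (⟨Ioo a b, isOpen_Ioo⟩ : TopologicalSpace.Opens ℝ) × P

/-- The model with corners of `(a, b) × P`. -/
noncomputable abbrev cylModel : ModelWithCorners ℝ (ℝ × EuclideanSpace ℝ (Fin 3))
    (ModelProd ℝ (EuclideanSpace ℝ (Fin 3))) :=
  (𝓘(ℝ, ℝ)).prod (𝓡 3)

variable {a b : ℝ}

/-- The coordinate `t` on `(a, b) × P`. -/
def tCoord (x : Cyl a b P) : ℝ := (x.1 : ℝ)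

/-- The 1-form `dt` on `(a, b) × P`. -/
noncomputable def dt (x : Cyl a b P) : TangentSpace cylModel x →L[ℝ] ℝ :=
  dfun tCoord x

/-- The pull-back of `θ` to `(a, b) × P`. -/
noncomputable def thetaForm (θ : Π q : P, TangentSpace (𝓡 3) q →L[ℝ] ℝ) (x : Cyl a b P) :
    TangentSpace cylModel x →L[ℝ] ℝ :=
  (θ x.2).comp (mfderiv cylModel (𝓡 3) (Prod.snd : Cyl a b P → P) x)

/-- The differential of the projection `(a, b) × P → B`. -/
noncomputable def dproj (p : P → B) (x : Cyl a b P) :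
    TangentSpace cylModel x →L[ℝ] TangentSpace (𝓡 2) (p x.2) :=
  mfderiv cylModel (𝓡 2) (fun x' : Cyl a b P ↦ p x'.2) x

/-- The warped metric `dt² + f(t)² θ² + g(t)² p^* h`. -/
noncomputable def warpedMetric
    (h : Π y : B, TangentSpace (𝓡 2) y →L[ℝ] TangentSpace (𝓡 2) y →L[ℝ] ℝ)
    (p : P → B) (θ : Π q : P, TangentSpace (𝓡 3) q →L[ℝ] ℝ) (f g : ℝ → ℝ) (x : Cyl a b P) :
    TangentSpace cylModel x →L[ℝ] TangentSpace cylModel x →L[ℝ] ℝ :=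
  (dt x).smulRight (dt x) + f (tCoord x) ^ 2 • (thetaForm θ x).smulRight (thetaForm θ x)
    + g (tCoord x) ^ 2 • (ContinuousLinearMap.precomp ℝ (dproj p x)).comp ((h (p x.2)).comp (dproj p x))

/-- The isomorphism `v ↦ (dt v, r θ v, dp v)` (for `r ≠ 0`). -/
noncomputable def coframe (p : P → B) (θ : Π q : P, TangentSpace (𝓡 3) q →L[ℝ] ℝ) (r : ℝ)
    (x : Cyl a b P) :
    TangentSpace cylModel x →L[ℝ] ℝ × ℝ × TangentSpace (𝓡 2) (p x.2) :=
  (dt x).prod ((r • thetaForm θ x).prod (dproj p x))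

/-- The vector field `∂_t`, with `dt = 1`, `θ = 0`, `dp = 0`. -/
noncomputable def partialT (p : P → B) (θ : Π q : P, TangentSpace (𝓡 3) q →L[ℝ] ℝ)
    (x : Cyl a b P) : TangentSpace cylModel x :=
  (coframe p θ 1 x).inverse (1, 0, 0)

/-- The vector field `θ^♯` dual to `θ` with respect to `θ² + p^* h`: `dt = 0`, `θ = 1`, `dp = 0`. -/
noncomputable def thetaSharp (p : P → B) (θ : Π q : P, TangentSpace (𝓡 3) q →L[ℝ] ℝ)
    (x : Cyl a b P) : TangentSpace cylModel x :=
  (coframe p θ 1 x).inverse (0, 1, 0)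

/-- The distribution spanned by `θ^♯` and `∂_t`. -/
noncomputable def vertDistribution (p : P → B) (θ : Π q : P, TangentSpace (𝓡 3) q →L[ℝ] ℝ)
    (x : Cyl a b P) : Submodule ℝ (TangentSpace cylModel x) :=
  Submodule.span ℝ {thetaSharp p θ x, partialT p θ x}

/-- The linear map `(s, u, w) ↦ (- ε u, ε s, j w)`. -/
noncomputable def modelJ {y : B} (jy : TangentSpace (𝓡 2) y →L[ℝ] TangentSpace (𝓡 2) y)
    (ε : ℝ) : ℝ × ℝ × TangentSpace (𝓡 2) y →L[ℝ] ℝ × ℝ × TangentSpace (𝓡 2) y :=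
  ((-ε) • (ContinuousLinearMap.fst ℝ ℝ (TangentSpace (𝓡 2) y)).comp
      (ContinuousLinearMap.snd ℝ ℝ (ℝ × TangentSpace (𝓡 2) y))).prod
    ((ε • ContinuousLinearMap.fst ℝ ℝ (ℝ × TangentSpace (𝓡 2) y)).prod
      (jy.comp ((ContinuousLinearMap.snd ℝ ℝ (TangentSpace (𝓡 2) y)).comp
        (ContinuousLinearMap.snd ℝ ℝ (ℝ × TangentSpace (𝓡 2) y)))))

/-- The almost complex structure `J_ε` with `J_ε ∂_t = ε f⁻¹ θ^♯`, `J_ε θ^♯ = - ε f ∂_t`, and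
`J_ε X^h = (j X)^h` on horizontal lifts.  `ε = 1` and `ε = -1` give the two structures. -/
noncomputable def warpedJ (j : Π y : B, TangentSpace (𝓡 2) y →L[ℝ] TangentSpace (𝓡 2) y)
    (p : P → B) (θ : Π q : P, TangentSpace (𝓡 3) q →L[ℝ] ℝ) (f : ℝ → ℝ) (ε : ℝ)
    (x : Cyl a b P) : TangentSpace cylModel x →L[ℝ] TangentSpace cylModel x :=
  (coframe p θ (f (tCoord x)) x).inverse.comp
    ((modelJ (j (p x.2)) ε).comp (coframe p θ (f (tCoord x)) x))

end CircleBundle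

end GraySurface

open GraySurface

/-! The whole theorem is a computation in a local orthonormal frame: `e 0` is ∂_t, `e 1` is θ^♯ / f,
and `e 2`, `e 3` are the horizontal lifts, divided by g, of an orthonormal frame w, j w of the
surface (`exists_adapted_frame`). Write p = f'/f, q = g'/g and s = c f / (2 g²). Then [e0, e1] = -p
e1, [e0, e2] = -q e2, [e0, e3] = -q e3, the field e1 commutes with e2 and e3, and [e2, e3] is -2 s
e1 plus terms from the surface. The Koszul formula turns these brackets into the connection
coefficients `warpedSymbol`, from which the claims about the foliation, its umbilical complement, J
and its conjugate can be read off.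

The curvature components depend on t alone, through φ = f''/f, η = g''/g, δ = p q - s², γ = K/g² - 3
s² - q² and m = s (p - q). The Ricci tensor is diagonal with entries -φ - 2η, -φ - 2δ, and twice -η
- δ + γ; the assumption on the Ricci endomorphism therefore amounts to η = δ. Under it the Bianchi
identity becomes the single equation μ' = 2 (λ - μ) g'/g (`hasDerivAt_horRicci`).

This equation carries the equivalences (`tfae_ricci`). Condition (a) makes μ - E g² constant;
condition (c), with constant r, makes (r + μ)/g² constant; condition (b) gives g' (λ - μ - C g²) =
0. In the last case one divides by g': the relation η = δ makes g'/f monotone, so a nonconstant g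
has at most one critical point, and continuity covers it.

For (d), the Gray identity on (∂_t, ∂_t, ∂_t) says λ' = 2 μ', which is (c); conversely λ' = 2 μ' and
the Bianchi equation give the identity on all arguments. Both complex structures commute with the
Ricci endomorphism, which is scalar on each of the two planes they preserve. Irreducibility comes
from the curvature operators: if δ or m is nonzero at some t, they leave no proper subspace
invariant (`eq_bot_or_eq_top_of_invariant`); if both vanish identically, the metric is flat
(`curvature_functions_eq_zero`). -/

namespace GraySurface

set_option linter.unusedSectionVars false

/-! ### Calculus of functions, vector fields, one-forms and Lie brackets. -/

section Smooth

variable {E : Type*} [NormedAddCommGroup E] [NormedSpace ℝ E] [FiniteDimensional ℝ E]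
  {H : Type*} [TopologicalSpace H] {I : ModelWithCorners ℝ E H}
  {M : Type*} [TopologicalSpace M] [ChartedSpace H M] [IsManifold I ∞ M]
  {E' : Type*} [NormedAddCommGroup E'] [NormedSpace ℝ E'] [FiniteDimensional ℝ E']
  {H' : Type*} [TopologicalSpace H'] {I' : ModelWithCorners ℝ E' H'}
  {N : Type*} [TopologicalSpace N] [ChartedSpace H' N] [IsManifold I' ∞ N]

/-- The real function `u` is smooth on `U`. -/
abbrev SmoothFn (I : ModelWithCorners ℝ E H) (u : M → ℝ) (U : Set M) : Prop :=
  ContMDiffOn I 𝓘(ℝ, ℝ) ∞ u U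

theorem SmoothFn.mdiffAt {u : M → ℝ} {U : Set M} (hu : SmoothFn I u U) (hU : IsOpen U) {x : M}
    (hx : x ∈ U) : MDifferentiableAt I 𝓘(ℝ, ℝ) u x :=
  (hu.contMDiffAt (hU.mem_nhds hx)).mdifferentiableAt (by simp)

theorem SmoothFn.mono {u : M → ℝ} {U V : Set M} (hu : SmoothFn I u U) (hVU : V ⊆ U) :
    SmoothFn I u V := ContMDiffOn.mono hu hVU

theorem SmoothField.mono {X : Π x : M, TangentSpace I x} {U V : Set M} (h : SmoothField X U)
    (hVU : V ⊆ U) : SmoothField X V := ContMDiffOn.mono h hVU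

theorem SmoothField.diffAt {X : Π x : M, TangentSpace I x} {U : Set M} (h : SmoothField X U)
    (hU : IsOpen U) {x : M} (hx : x ∈ U) : DiffFieldAt X x :=
  (ContMDiffOn.contMDiffAt h (hU.mem_nhds hx)).mdifferentiableAt (by simp)

theorem SmoothField.congr {X Y : Π x : M, TangentSpace I x} {U : Set M} (h : SmoothField X U)
    (hXY : ∀ x ∈ U, Y x = X x) : SmoothField Y U :=
  ContMDiffOn.congr h fun x hx ↦ by simp only [hXY x hx]

theorem SmoothField.smul {u : M → ℝ} {X : Π x : M, TangentSpace I x} {U : Set M}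
    (hu : SmoothFn I u U) (hX : SmoothField X U) : SmoothField (fun x ↦ u x • X x) U :=
  ContMDiffOn.smul_section hu hX

theorem SmoothField.sum {ι : Type*} {s : Finset ι} {X : ι → Π x : M, TangentSpace I x} {U : Set M}
    (hX : ∀ i ∈ s, SmoothField (X i) U) : SmoothField (fun x ↦ ∑ i ∈ s, X i x) U :=
  ContMDiffOn.sum_section hX

/-- The smoothness of a vector field is local. -/
theorem smoothField_of_locally {X : Π x : M, TangentSpace I x} {U : Set M}
    (h : ∀ x ∈ U, ∃ W : Set M, IsOpen W ∧ x ∈ W ∧ SmoothField X W) : SmoothField X U := by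
  intro x hx
  obtain ⟨W, hW, hxW, h⟩ := h x hx
  exact (ContMDiffOn.contMDiffAt h (hW.mem_nhds hxW)).contMDiffWithinAt

theorem exists_smoothField (x : M) (v : TangentSpace I x) :
    ∃ U : Set M, IsOpen U ∧ x ∈ U ∧
      SmoothField (FiberBundle.extend E v : Π y : M, TangentSpace I y) U := by
  obtain ⟨s, hs, h⟩ := FiberBundle.exists_contMDiffOn_extend (k := ∞) I E v
  exact ⟨interior s, isOpen_interior, mem_interior_iff_mem_nhds.2 hs,
    ContMDiffOn.mono h interior_subset⟩

theorem DiffFieldAt.congr {X Y : Π x : M, TangentSpace I x} {x : M} (h : DiffFieldAt X x)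
    (hXY : ∀ᶠ y in 𝓝 x, Y y = X y) : DiffFieldAt Y x :=
  MDifferentiableAt.congr_of_eventuallyEq h (hXY.mono fun y hy ↦ by simp only [hy])

/-! ### Differentials of real functions -/

theorem dfun_add {u v : M → ℝ} {x : M} (hu : MDifferentiableAt I 𝓘(ℝ, ℝ) u x)
    (hv : MDifferentiableAt I 𝓘(ℝ, ℝ) v x) (w : TangentSpace I x) :
    dfun (fun y ↦ u y + v y) x w = dfun u x w + dfun v x w := by
  have := congrArg (fun L ↦ L w) (mfderiv_add hu hv)
  exact this

theorem dfun_mul {u v : M → ℝ} {x : M} (hu : MDifferentiableAt I 𝓘(ℝ, ℝ) u x)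
    (hv : MDifferentiableAt I 𝓘(ℝ, ℝ) v x) (w : TangentSpace I x) :
    dfun (fun y ↦ u y * v y) x w = u x * dfun v x w + v x * dfun u x w := by
  have := congrArg (fun L ↦ L w) (hu.hasMFDerivAt.mul hv.hasMFDerivAt).mfderiv
  exact this

theorem dfun_neg {u : M → ℝ} {x : M} (w : TangentSpace I x) :
    dfun (fun y ↦ -u y) x w = -dfun u x w :=
  congrArg (fun L : TangentSpace I x →L[ℝ] ℝ ↦ L w) (mfderiv_neg (f := u) (x := x))

theorem dfun_const (r : ℝ) (x : M) (w : TangentSpace I x) : dfun (fun _ ↦ r) x w = 0 :=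
  congrArg (fun L : TangentSpace I x →L[ℝ] ℝ ↦ L w) (mfderiv_const (I' := 𝓘(ℝ, ℝ)) (c := r) (x := x))

theorem dfun_congr {u v : M → ℝ} {x : M} (h : ∀ᶠ y in 𝓝 x, u y = v y) :
    dfun (I := I) u x = dfun v x :=
  Filter.EventuallyEq.mfderiv_eq h

theorem mdiffAt_sum {ι : Type*} {s : Finset ι} {u : ι → M → ℝ} {x : M}
    (hu : ∀ i ∈ s, MDifferentiableAt I 𝓘(ℝ, ℝ) (u i) x) :
    MDifferentiableAt I 𝓘(ℝ, ℝ) (fun y ↦ ∑ i ∈ s, u i y) x := by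
  classical
  induction s using Finset.induction_on with
  | empty => simpa using mdifferentiableAt_const
  | insert a s ha ih =>
    simp only [Finset.sum_insert ha]
    exact (hu a (Finset.mem_insert_self a s)).add
      (ih fun i hi ↦ hu i (Finset.mem_insert_of_mem hi))

theorem dfun_sum {ι : Type*} {s : Finset ι} {u : ι → M → ℝ} {x : M}
    (hu : ∀ i ∈ s, MDifferentiableAt I 𝓘(ℝ, ℝ) (u i) x) (w : TangentSpace I x) :
    dfun (fun y ↦ ∑ i ∈ s, u i y) x w = ∑ i ∈ s, dfun (u i) x w := by
  classical
  induction s using Finset.induction_on with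
  | empty => simpa using dfun_const 0 x w
  | insert a s ha ih =>
    have h1 := hu a (Finset.mem_insert_self a s)
    have h2 : ∀ i ∈ s, MDifferentiableAt I 𝓘(ℝ, ℝ) (u i) x :=
      fun i hi ↦ hu i (Finset.mem_insert_of_mem hi)
    simp only [Finset.sum_insert ha]
    rw [dfun_add h1 (mdiffAt_sum h2), ih h2]

/-- The chain rule for a real function of a real function. -/
theorem dfun_comp_real {φ : ℝ → ℝ} {u : M → ℝ} {x : M} (hφ : DifferentiableAt ℝ φ (u x))
    (hu : MDifferentiableAt I 𝓘(ℝ, ℝ) u x) (w : TangentSpace I x) :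
    dfun (fun y ↦ φ (u y)) x w = deriv φ (u x) * dfun u x w := by
  have h := congrArg (fun L ↦ L w) (mfderiv_comp x hφ.mdifferentiableAt hu)
  rw [mfderiv_eq_fderiv] at h
  have h' : dfun (fun y ↦ φ (u y)) x w = fderiv ℝ φ (u x) (dfun u x w) := h
  rw [h', fderiv_eq_smul_deriv, smul_eq_mul, mul_comm]

/-- The chain rule for the composition of a real function with a map. -/
theorem dfun_comp {u : N → ℝ} {F : M → N} {x : M} (hu : MDifferentiableAt I' 𝓘(ℝ, ℝ) u (F x))
    (hF : MDifferentiableAt I I' F x) (w : TangentSpace I x) :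
    dfun (fun y ↦ u (F y)) x w = dfun u (F x) (mfderiv I I' F x w) :=
  congrArg (fun L ↦ L w) (mfderiv_comp x hu hF)

theorem SmoothFn.dfun_apply {u : M → ℝ} {X : Π x : M, TangentSpace I x} {U : Set M}
    (hU : IsOpen U) (hu : SmoothFn I u U) (hX : SmoothField X U) :
    SmoothFn I (fun x ↦ dfun u x (X x)) U := by
  have h1 := hu.contMDiffOn_tangentMapWithin (m := ∞) (by simp) hU.uniqueMDiffOn
  have h2 := h1.comp hX (fun x hx ↦ hx)
  have h3 := (contMDiff_snd_tangentBundle_modelSpace (n := ∞) ℝ 𝓘(ℝ, ℝ)).comp_contMDiffOn h2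
  refine h3.congr fun x hx ↦ ?_
  have h4 : mfderivWithin I 𝓘(ℝ, ℝ) u U x = mfderiv I 𝓘(ℝ, ℝ) u x := mfderivWithin_of_isOpen hU hx
  change mfderiv I 𝓘(ℝ, ℝ) u x (X x) = mfderivWithin I 𝓘(ℝ, ℝ) u U x (X x)
  rw [h4]

/-! ### One-forms -/

/-- The 1-form `α` is smooth on `V`. -/
def SmoothForm (α : Π x : M, TangentSpace I x →L[ℝ] ℝ) (V : Set M) : Prop :=
  ∀ (U : Set M) (X : Π x : M, TangentSpace I x), IsOpen U → U ⊆ V → SmoothField X U →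
    SmoothFn I (fun x ↦ α x (X x)) U

/-- A smooth local frame near a point, with smooth coefficients of vector-valued maps. -/
theorem exists_local_frame (y : N) : ∃ (V : Set N) (b : Fin (Module.finrank ℝ E') →
    Π z : N, TangentSpace I' z) (κ : Fin (Module.finrank ℝ E') → TangentBundle I' N → ℝ),
    IsOpen V ∧ y ∈ V ∧ (∀ i, SmoothField (b i) V) ∧
    (∀ i, ContMDiffOn I'.tangent 𝓘(ℝ, ℝ) ∞ (κ i) (π E' (TangentSpace I') ⁻¹' V)) ∧
    ∀ z ∈ V, ∀ v : TangentSpace I' z, v = ∑ i, κ i ⟨z, v⟩ • b i z := by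
  let e := trivializationAt E' (TangentSpace I' : N → Type _) y
  let bas := Module.finBasis ℝ E'
  refine ⟨e.baseSet, e.localFrame bas, fun i z ↦ bas.repr (e z).2 i, e.open_baseSet,
    FiberBundle.mem_baseSet_trivializationAt' y,
    fun i ↦ e.contMDiffOn_localFrame_baseSet (I := I') ∞ bas i, fun i ↦ ?_, fun z hz v ↦ ?_⟩
  · have h1 : ContMDiffOn I'.tangent (I'.prod 𝓘(ℝ, E')) ∞ e e.source :=
      Trivialization.contMDiffOn e
    have h2 : ContMDiffOn I'.tangent 𝓘(ℝ, E') ∞ (fun z ↦ (e z).2) e.source :=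
      contMDiff_snd.comp_contMDiffOn h1
    rw [e.source_eq] at h2
    have h3 : ContMDiff 𝓘(ℝ, E') 𝓘(ℝ, ℝ) ∞
        (LinearMap.toContinuousLinearMap (bas.coord i)) :=
      (LinearMap.toContinuousLinearMap (bas.coord i)).contMDiff
    exact h3.comp_contMDiffOn h2
  · conv_lhs => rw [← (e.basisAt bas hz).sum_repr v]
    refine Finset.sum_congr rfl fun i _ ↦ ?_
    rw [e.localFrame_apply_of_mem_baseSet bas hz]
    congr 1

/-- A smooth 1-form is a smooth function on the tangent bundle. -/
theorem SmoothForm.comp_tangent {α : Π y : N, TangentSpace I' y →L[ℝ] ℝ} {V : Set N}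
    (hV : IsOpen V) (hα : SmoothForm α V) {U : Set M} {F : M → N} {W : Π x : M, TangentSpace I' (F x)}
    (hW : ContMDiffOn I I'.tangent ∞ (fun x ↦ (⟨F x, W x⟩ : TangentBundle I' N)) U)
    (hF : MapsTo F U V) : SmoothFn I (fun x ↦ α (F x) (W x)) U := by
  have hFs : ContMDiffOn I I' ∞ F U :=
    (contMDiff_proj (TangentSpace I' : N → Type _)).comp_contMDiffOn hW
  intro x hx
  -- The vectors W live along F and need not come from a field on N. So α is evaluated on a local
  -- frame of N, and the coefficients of W are read off as smooth functions on the tangent bundle.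
  obtain ⟨V', b, κ, hV', hxV', hb, hκ, hsum⟩ := exists_local_frame (I' := I') (F x)
  have hO : IsOpen (V ∩ V') := hV.inter hV'
  have hmem : V ∩ V' ∈ 𝓝 (F x) := hO.mem_nhds ⟨hF hx, hxV'⟩
  have hev : ∀ᶠ y in 𝓝[U] x, F y ∈ V ∩ V' := (hFs x hx).continuousWithinAt hmem
  have h1 : ∀ i, ContMDiffWithinAt I 𝓘(ℝ, ℝ) ∞ (fun y ↦ α (F y) (b i (F y))) U x := fun i ↦ by
    have := hα (V ∩ V') (b i) hO inter_subset_left ((hb i).mono inter_subset_right)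
    exact (this.contMDiffAt hmem).comp_contMDiffWithinAt x (hFs x hx)
  have h2 : ∀ i, ContMDiffWithinAt I 𝓘(ℝ, ℝ) ∞ (fun y ↦ κ i ⟨F y, W y⟩) U x := fun i ↦ by
    have hn : π E' (TangentSpace I') ⁻¹' V' ∈ 𝓝 (⟨F x, W x⟩ : TangentBundle I' N) :=
      (hV'.preimage (FiberBundle.continuous_proj E' _)).mem_nhds hxV'
    exact ((hκ i).contMDiffAt hn).comp_contMDiffWithinAt x (hW x hx)
  have h3 : ContMDiffWithinAt I 𝓘(ℝ, ℝ) ∞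
      (fun y ↦ ∑ i, κ i ⟨F y, W y⟩ * α (F y) (b i (F y))) U x :=
    contMDiffWithinAt_finsetSum fun i _ ↦ (h2 i).mul (h1 i)
  have key : ∀ y, F y ∈ V' → α (F y) (W y) = ∑ i, κ i ⟨F y, W y⟩ * α (F y) (b i (F y)) :=
    fun y hy ↦ by
      conv_lhs => rw [hsum (F y) hy (W y)]
      rw [map_sum]
      exact Finset.sum_congr rfl fun i _ ↦ by rw [map_smul, smul_eq_mul]
  exact h3.congr_of_eventuallyEq (hev.mono fun y hy ↦ key y hy.2) (key x hxV')

/-- The pull-back of a smooth 1-form is smooth. -/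
theorem SmoothForm.pullback {α : Π y : N, TangentSpace I' y →L[ℝ] ℝ} {V : Set N}
    (hV : IsOpen V) (hα : SmoothForm α V) {F : M → N} (hF : ContMDiff I I' ∞ F) :
    SmoothForm (fun x ↦ (α (F x)).comp (mfderiv I I' F x)) (F ⁻¹' V) := by
  intro U X hU hUV hX
  have h1 := (hF.contMDiff_tangentMap (m := ∞) (by simp)).comp_contMDiffOn hX
  exact hα.comp_tangent hV (F := F) (W := fun x ↦ mfderiv I I' F x (X x)) h1 hUV

theorem SmoothForm.smul {α : Π x : M, TangentSpace I x →L[ℝ] ℝ} {u : M → ℝ} {V : Set M}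
    (hu : SmoothFn I u V) (h : SmoothForm α V) : SmoothForm (fun x ↦ u x • α x) V :=
  fun U X hU hUV hX ↦ (hu.mono hUV).mul (h U X hU hUV hX)

theorem smoothForm_dfun {u : M → ℝ} {V : Set M} (hu : SmoothFn I u V) :
    SmoothForm (dfun (I := I) u) V :=
  fun _ _ hU hUV hX ↦ SmoothFn.dfun_apply hU (hu.mono hUV) hX

/-- The frame dual to a smooth coframe is smooth. -/
theorem smoothField_dual {n : ℕ} (hn : Module.finrank ℝ E = n)
    {α : Fin n → Π x : M, TangentSpace I x →L[ℝ] ℝ} {e : Fin n → Π x : M, TangentSpace I x}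
    {V : Set M} (hV : IsOpen V) (hα : ∀ i, SmoothForm (α i) V)
    (hd : ∀ x ∈ V, ∀ i k, α i x (e k x) = if i = k then 1 else 0) (k : Fin n) :
    SmoothField (e k) V := by
  subst hn
  refine smoothField_of_locally fun x hx ↦ ?_
  obtain ⟨V', b, κ, hV', hxV', hb, hκ, hsum⟩ := exists_local_frame (I' := I) x
  have hO : IsOpen (V ∩ V') := hV.inter hV'
  refine ⟨V ∩ V', hO, ⟨hx, hxV'⟩, ?_⟩
  -- A holds the values of the coframe on a smooth reference frame and C the coefficients of e in
  -- that frame. Duality says A C = 1, so Cramer's rule expresses the entries of C rationally in the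
  -- smooth entries of A.
  let A : M → Matrix (Fin (Module.finrank ℝ E)) (Fin (Module.finrank ℝ E)) ℝ :=
    fun y ↦ Matrix.of fun i m ↦ α i y (b m y)
  let C : M → Matrix (Fin (Module.finrank ℝ E)) (Fin (Module.finrank ℝ E)) ℝ :=
    fun y ↦ Matrix.of fun m k ↦ κ m ⟨y, e k y⟩
  have hA : ∀ i m, SmoothFn I (fun y ↦ A y i m) (V ∩ V') := fun i m ↦
    hα i _ _ hO inter_subset_left ((hb m).mono inter_subset_right)
  have hAC : ∀ y ∈ V ∩ V', A y * C y = 1 := fun y hy ↦ by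
    ext i k
    rw [Matrix.mul_apply, Matrix.one_apply, ← hd y hy.1 i k]
    conv_rhs => rw [hsum y hy.2 (e k y), map_sum]
    refine Finset.sum_congr rfl fun m _ ↦ ?_
    rw [map_smul, smul_eq_mul, mul_comm]
    rfl
  have hdet : ∀ B : M → Matrix (Fin (Module.finrank ℝ E)) (Fin (Module.finrank ℝ E)) ℝ,
      (∀ i m, SmoothFn I (fun y ↦ B y i m) (V ∩ V')) →
      SmoothFn I (fun y ↦ (B y).det) (V ∩ V') := fun B hB ↦ by
    simp only [Matrix.det_apply']
    refine contMDiffOn_finsetSum fun σ _ ↦ ?_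
    exact contMDiffOn_const.mul (contMDiffOn_finsetProd fun i _ ↦ hB (σ i) i)
  have hC : ∀ m k, SmoothFn I (fun y ↦ C y m k) (V ∩ V') := fun m k ↦ by
    have h1 : SmoothFn I (fun y ↦ (A y).adjugate m k) (V ∩ V') := by
      simp only [Matrix.adjugate_apply]
      refine hdet _ fun i m' ↦ ?_
      simp only [Matrix.updateRow_apply]
      split_ifs with h
      · exact contMDiffOn_const
      · exact hA i m'
    have h2 : ∀ y ∈ V ∩ V', (A y).det ≠ 0 := fun y hy h0 ↦ by
      have := congrArg Matrix.det (hAC y hy)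
      rw [Matrix.det_mul, h0, zero_mul, Matrix.det_one] at this
      exact zero_ne_one this
    have h3 : SmoothFn I (fun y ↦ ((A y).det)⁻¹ * (A y).adjugate m k) (V ∩ V') :=
      ((hdet A hA).inv₀ h2).mul h1
    refine h3.congr fun y hy ↦ ?_
    have h4 : C y = (A y)⁻¹ := (Matrix.inv_eq_right_inv (hAC y hy)).symm
    rw [h4, Matrix.inv_def, Matrix.smul_apply, Ring.inverse_eq_inv', smul_eq_mul]
  have h5 : SmoothField (fun y ↦ ∑ m, C y m k • b m y) (V ∩ V') :=
    SmoothField.sum fun m _ ↦ SmoothField.smul (hC m k) ((hb m).mono inter_subset_right)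
  exact h5.congr fun y hy ↦ hsum y hy.2 (e k y)

/-! ### Lie brackets -/

theorem mlieBracket_smul_right' {u : M → ℝ} {X Y : Π x : M, TangentSpace I x} {x : M}
    (hu : MDifferentiableAt I 𝓘(ℝ, ℝ) u x) (hY : DiffFieldAt Y x) :
    VectorField.mlieBracket I X (fun y ↦ u y • Y y) x =
      dfun u x (X x) • Y x + u x • VectorField.mlieBracket I X Y x :=
  VectorField.mlieBracket_smul_right hu hY

theorem mlieBracket_add_right' {X Y Z : Π x : M, TangentSpace I x} {x : M}
    (hY : DiffFieldAt Y x) (hZ : DiffFieldAt Z x) :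
    VectorField.mlieBracket I X (fun y ↦ Y y + Z y) x =
      VectorField.mlieBracket I X Y x + VectorField.mlieBracket I X Z x :=
  VectorField.mlieBracket_add_right hY hZ

theorem SmoothField.mlieBracket {X Y : Π x : M, TangentSpace I x} {U : Set M} (hU : IsOpen U)
    (hX : SmoothField X U) (hY : SmoothField Y U) :
    SmoothField (fun x ↦ VectorField.mlieBracket I X Y x) U := fun x hx ↦
  have : IsManifold I ((((⊤ : ℕ∞) : WithTop ℕ∞)) + 1) M := by simpa using ‹IsManifold I ∞ M›
  have : IsManifold I (minSmoothness ℝ 2) M := by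
    rw [show minSmoothness ℝ 2 = 2 by simp]
    exact IsManifold.of_le (n := ∞) (WithTop.coe_le_coe.2 le_top)
  (ContMDiffAt.mlieBracket_vectorField (m := ⊤) (n := ⊤)
    (ContMDiffOn.contMDiffAt hX (hU.mem_nhds hx)) (ContMDiffOn.contMDiffAt hY (hU.mem_nhds hx))
    (by simp)).contMDiffWithinAt

/-- The Lie bracket acts on functions as the commutator of derivations. -/
theorem dfun_mlieBracket {u : M → ℝ} {X Y : Π x : M, TangentSpace I x} {U : Set M} (hU : IsOpen U)
    (hu : SmoothFn I u U) (hX : SmoothField X U) (hY : SmoothField Y U) {x : M} (hx : x ∈ U) :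
    dfun u x (VectorField.mlieBracket I X Y x) =
      dfun (fun y ↦ dfun u y (Y y)) x (X x) - dfun (fun y ↦ dfun u y (X y)) x (Y x) := by
  -- In dimension zero both sides vanish. Otherwise an auxiliary field Z with Z x ≠ 0 lets the
  -- derivatives of u be read off from brackets with u Z.
  by_cases hE : ∃ z : E, z ≠ 0
  swap
  · push Not at hE
    have h0 : ∀ v : TangentSpace I x, v = 0 := hE
    rw [h0 (VectorField.mlieBracket I X Y x), h0 (X x), h0 (Y x)]
    simp
  obtain ⟨z, hz⟩ := hE
  obtain ⟨U', hU', hxU', hZ⟩ := exists_smoothField (I := I) x z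
  set Z : Π y : M, TangentSpace I y := FiberBundle.extend E (x := x) z
  have hZx : Z x ≠ 0 := by
    have : Z x = z := FiberBundle.extend_apply_self E (E := (TangentSpace I : M → Type _)) (x := x) z
    rw [this]; exact hz
  have hO : IsOpen (U ∩ U') := hU.inter hU'
  have hxO : x ∈ U ∩ U' := ⟨hx, hxU'⟩
  replace hu := hu.mono (inter_subset_left : U ∩ U' ⊆ U)
  replace hX := hX.mono (inter_subset_left : U ∩ U' ⊆ U)
  replace hY := hY.mono (inter_subset_left : U ∩ U' ⊆ U)
  replace hZ := hZ.mono (inter_subset_right : U ∩ U' ⊆ U')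
  generalize U ∩ U' = O at *
  have huZ := SmoothField.smul hu hZ
  have hXY := SmoothField.mlieBracket hO hX hY
  have first : ∀ W : Π y : M, TangentSpace I y, ∀ y ∈ O,
      VectorField.mlieBracket I W (fun y ↦ u y • Z y) y =
        dfun u y (W y) • Z y + u y • VectorField.mlieBracket I W Z y := fun W y hy ↦
    mlieBracket_smul_right' (hu.mdiffAt hO hy) (hZ.diffAt hO hy)
  have second : ∀ W W' : Π y : M, TangentSpace I y, SmoothField W O → SmoothField W' O →
      VectorField.mlieBracket I W (VectorField.mlieBracket I W' (fun y ↦ u y • Z y)) x =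
        (dfun (fun y ↦ dfun u y (W' y)) x (W x) • Z x
          + dfun u x (W' x) • VectorField.mlieBracket I W Z x)
        + (dfun u x (W x) • VectorField.mlieBracket I W' Z x
          + u x • VectorField.mlieBracket I W (VectorField.mlieBracket I W' Z) x) := by
    intro W W' hW hW'
    have h1 : (VectorField.mlieBracket I W' (fun y ↦ u y • Z y)) =ᶠ[𝓝 x]
        fun y ↦ dfun u y (W' y) • Z y + u y • VectorField.mlieBracket I W' Z y :=
      Filter.eventuallyEq_of_mem (hO.mem_nhds hxO) fun y hy ↦ first W' y hy
    rw [Filter.EventuallyEq.mlieBracket_vectorField_eq (Filter.EventuallyEq.refl _ W) h1]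
    have hdu := SmoothFn.dfun_apply hO hu hW'
    have hW'Z := SmoothField.mlieBracket hO hW' hZ
    rw [mlieBracket_add_right' ((SmoothField.smul hdu hZ).diffAt hO hxO)
        ((SmoothField.smul hu hW'Z).diffAt hO hxO),
      mlieBracket_smul_right' (hdu.mdiffAt hO hxO) (hZ.diffAt hO hxO),
      mlieBracket_smul_right' (hu.mdiffAt hO hxO) (hW'Z.diffAt hO hxO)]
  have ms : minSmoothness ℝ 2 = 2 := by simp
  have toC2 : ∀ W : Π y : M, TangentSpace I y, SmoothField W O →
      ContMDiffAt I I.tangent (minSmoothness ℝ 2) (fun y ↦ (⟨y, W y⟩ : TangentBundle I M)) x :=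
    fun W hW ↦ by
      rw [ms]
      exact (ContMDiffOn.contMDiffAt hW (hO.mem_nhds hxO)).of_le (WithTop.coe_le_coe.2 le_top)
  have : IsManifold I (minSmoothness ℝ 3) M := by
    rw [show minSmoothness ℝ 3 = 3 by simp]
    exact IsManifold.of_le (n := ∞) (WithTop.coe_le_coe.2 le_top)
  -- Jacobi for X, Y, u Z is compared with u times Jacobi for X, Y, Z. The mixed terms (X u)[Y, Z] +
  -- (Y u)[X, Z] are symmetric in X and Y and drop out; what remains is the claimed identity
  -- multiplied by Z x.
  have jac1 := VectorField.leibniz_identity_mlieBracket_apply (I := I) (toC2 X hX) (toC2 Y hY)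
    (toC2 _ huZ)
  have jac2 := VectorField.leibniz_identity_mlieBracket_apply (I := I) (toC2 X hX) (toC2 Y hY)
    (toC2 _ hZ)
  rw [second X Y hX hY, second Y X hY hX, first _ x hxO, jac2] at jac1
  have h6 : (dfun (fun y ↦ dfun u y (Y y)) x (X x) - dfun (fun y ↦ dfun u y (X y)) x (Y x)
      - dfun u x (VectorField.mlieBracket I X Y x)) • Z x = 0 := by
    rw [sub_smul, sub_smul]
    have := sub_eq_zero.2 jac1
    rw [← this]
    module
  have := (smul_eq_zero.1 h6).resolve_right hZx
  linarith

/-- Lie brackets of related vector fields are related. -/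
theorem mfderiv_mlieBracket {F : M → N} {X Y : Π x : M, TangentSpace I x}
    {X' Y' : Π y : N, TangentSpace I' y} {U : Set M} {V : Set N} (hU : IsOpen U) (hV : IsOpen V)
    (hF : ContMDiffOn I I' ∞ F U) (hUV : MapsTo F U V)
    (hX : SmoothField X U) (hY : SmoothField Y U) (hX' : SmoothField X' V) (hY' : SmoothField Y' V)
    (hXX' : ∀ x ∈ U, mfderiv I I' F x (X x) = X' (F x))
    (hYY' : ∀ x ∈ U, mfderiv I I' F x (Y x) = Y' (F x)) {x : M} (hx : x ∈ U) :
    mfderiv I I' F x (VectorField.mlieBracket I X Y x) = VectorField.mlieBracket I' X' Y' (F x) := by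
  have hFd : ∀ y ∈ U, MDifferentiableAt I I' F y := fun y hy ↦
    (hF.contMDiffAt (hU.mem_nhds hy)).mdifferentiableAt (by simp)
  -- The two vectors agree as derivations: differentiating u ∘ F along X is differentiating u along
  -- X', and brackets are commutators of derivations.
  have key : ∀ (u : N → ℝ) (V' : Set N), IsOpen V' → F x ∈ V' → SmoothFn I' u V' →
      dfun u (F x) (mfderiv I I' F x (VectorField.mlieBracket I X Y x)) =
        dfun u (F x) (VectorField.mlieBracket I' X' Y' (F x)) := by
    intro u V' hV' hxV' hu
    have hO : IsOpen (V ∩ V') := hV.inter hV'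
    have hW : IsOpen (U ∩ F ⁻¹' (V ∩ V')) := hF.continuousOn.isOpen_inter_preimage hU hO
    have hxW : x ∈ U ∩ F ⁻¹' (V ∩ V') := ⟨hx, hUV hx, hxV'⟩
    replace hu := hu.mono (inter_subset_right : V ∩ V' ⊆ V')
    have huF : SmoothFn I (fun y ↦ u (F y)) (U ∩ F ⁻¹' (V ∩ V')) :=
      hu.comp (hF.mono inter_subset_left) fun y hy ↦ hy.2
    have chain : ∀ (Z : Π x : M, TangentSpace I x) (Z' : Π y : N, TangentSpace I' y),
        (∀ y ∈ U, mfderiv I I' F y (Z y) = Z' (F y)) → ∀ y ∈ U ∩ F ⁻¹' (V ∩ V'),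
        dfun (fun y ↦ u (F y)) y (Z y) = dfun u (F y) (Z' (F y)) := fun Z Z' hZ y hy ↦ by
      rw [dfun_comp (hu.mdiffAt hO hy.2) (hFd y hy.1), hZ y hy.1]
    have chain2 : ∀ (Z W : Π x : M, TangentSpace I x) (Z' W' : Π y : N, TangentSpace I' y),
        (∀ y ∈ U, mfderiv I I' F y (Z y) = Z' (F y)) →
        (∀ y ∈ U, mfderiv I I' F y (W y) = W' (F y)) → SmoothField Z' V →
        dfun (fun y ↦ dfun (fun y ↦ u (F y)) y (Z y)) x (W x) =
          dfun (fun y ↦ dfun u y (Z' y)) (F x) (W' (F x)) := by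
      intro Z W Z' W' hZ hW' hZ's
      have hd := SmoothFn.dfun_apply hO hu (hZ's.mono inter_subset_left)
      rw [dfun_congr (v := fun y ↦ dfun u (F y) (Z' (F y)))
        (Filter.eventually_of_mem (hW.mem_nhds hxW) (chain Z Z' hZ)),
        dfun_comp (hd.mdiffAt hO hxW.2) (hFd x hx), hW' x hx]
    rw [← dfun_comp (hu.mdiffAt hO hxW.2) (hFd x hx),
      dfun_mlieBracket hW huF (hX.mono inter_subset_left) (hY.mono inter_subset_left) hxW,
      dfun_mlieBracket hO hu (hX'.mono inter_subset_left) (hY'.mono inter_subset_left) hxW.2,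
      chain2 Y X Y' X' hYY' hXX' hY', chain2 X Y X' Y' hXX' hYY' hX']
  -- Linear functionals composed with a chart separate tangent vectors, because the differential of
  -- the chart is injective.
  let φ := extChartAt I' (F x)
  have hφs : ContMDiffOn I' 𝓘(ℝ, E') ∞ φ (chartAt H' (F x)).source := contMDiffOn_extChartAt
  have hsrc : IsOpen (chartAt H' (F x)).source := (chartAt H' (F x)).open_source
  have hmem : F x ∈ (chartAt H' (F x)).source := mem_chart_source H' (F x)
  have hφd : MDifferentiableAt I' 𝓘(ℝ, E') φ (F x) :=
    (hφs.contMDiffAt (hsrc.mem_nhds hmem)).mdifferentiableAt (by simp)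
  have inj : Function.Injective (mfderiv I' 𝓘(ℝ, E') φ (F x)) :=
    (isInvertible_mfderiv_extChartAt (mem_extChartAt_source (F x))).injective
  refine inj ?_
  refine (SeparatingDual.eq_iff_forall_dual_eq (R := ℝ) (V := E')).2 fun ℓ ↦ ?_
  have hℓ : SmoothFn I' (fun y ↦ ℓ (φ y)) (chartAt H' (F x)).source :=
    ℓ.contMDiff.comp_contMDiffOn hφs
  have hk := key _ _ hsrc hmem hℓ
  have hmf : ∀ v, dfun (fun y ↦ ℓ (φ y)) (F x) v = ℓ (mfderiv I' 𝓘(ℝ, E') φ (F x) v) := fun v ↦ by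
    have := congrArg (fun L ↦ L v) (mfderiv_comp (F x) ℓ.mdifferentiableAt hφd)
    rw [ContinuousLinearMap.mfderiv_eq] at this
    exact this
  rw [hmf, hmf] at hk
  exact hk

end Smooth

/-! ### Covariant derivative, curvature and Ricci tensor in a local frame. -/

section Frames

variable {E : Type*} [NormedAddCommGroup E] [NormedSpace ℝ E] [FiniteDimensional ℝ E]
  {H : Type*} [TopologicalSpace H] {I : ModelWithCorners ℝ E H}
  {M : Type*} [TopologicalSpace M] [ChartedSpace H M] [IsManifold I ∞ M] {n : ℕ}

/-! ### Covariant derivatives -/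

theorem conn_add (conn : CovariantDerivative I E (TangentSpace I : M → Type _))
    {X Y : Π x : M, TangentSpace I x} {x : M} (hX : DiffFieldAt X x) (hY : DiffFieldAt Y x)
    (v : TangentSpace I x) : conn (fun y ↦ X y + Y y) x v = conn X x v + conn Y x v :=
  congrArg (fun L ↦ L v) (conn.isCovariantDerivativeOnUniv.add hX hY (mem_univ x))

theorem conn_smul (conn : CovariantDerivative I E (TangentSpace I : M → Type _)) {u : M → ℝ}
    {X : Π x : M, TangentSpace I x} {x : M} (hu : MDifferentiableAt I 𝓘(ℝ, ℝ) u x)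
    (hX : DiffFieldAt X x) (v : TangentSpace I x) :
    conn (fun y ↦ u y • X y) x v = u x • conn X x v + dfun u x v • X x :=
  congrArg (fun L ↦ L v) (conn.isCovariantDerivativeOnUniv.leibniz hX hu (mem_univ x))

theorem conn_congr (conn : CovariantDerivative I E (TangentSpace I : M → Type _))
    {X Y : Π x : M, TangentSpace I x} {x : M} (hX : DiffFieldAt X x)
    (hXY : ∀ᶠ y in 𝓝 x, Y y = X y) : conn Y x = conn X x :=
  conn.isCovariantDerivativeOnUniv.congr_of_eventuallyEq (hX.congr hXY) hX Filter.univ_mem hXY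

theorem diffFieldAt_sum {ι : Type*} {s : Finset ι} {X : ι → Π x : M, TangentSpace I x} {x : M}
    (hX : ∀ i ∈ s, DiffFieldAt (X i) x) : DiffFieldAt (fun y ↦ ∑ i ∈ s, X i y) x :=
  MDifferentiableAt.sum_section hX

theorem conn_sum (conn : CovariantDerivative I E (TangentSpace I : M → Type _)) {ι : Type*}
    {s : Finset ι} {X : ι → Π x : M, TangentSpace I x} {x : M}
    (hX : ∀ i ∈ s, DiffFieldAt (X i) x) (v : TangentSpace I x) :
    conn (fun y ↦ ∑ i ∈ s, X i y) x v = ∑ i ∈ s, conn (X i) x v := by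
  classical
  induction s using Finset.induction_on with
  | empty =>
    simp only [Finset.sum_empty]
    have := congrFun conn.zero x
    exact congrArg (fun L ↦ L v) this
  | insert a s ha ih =>
    have h2 : ∀ i ∈ s, DiffFieldAt (X i) x := fun i hi ↦ hX i (Finset.mem_insert_of_mem hi)
    simp only [Finset.sum_insert ha]
    rw [conn_add conn (hX a (Finset.mem_insert_self a s)) (diffFieldAt_sum h2), ih h2]

/-! ### Local frames with their dual coframes -/

/-- `e` is a smooth frame on the open set `V`, with dual coframe `α`. -/
structure IsFrame (V : Set M) (e : Fin n → Π x : M, TangentSpace I x)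
    (α : Fin n → Π x : M, TangentSpace I x →L[ℝ] ℝ) : Prop where
  isOpen : IsOpen V
  form : ∀ i, SmoothForm (α i) V
  smooth : ∀ i, SmoothField (e i) V
  dual : ∀ x ∈ V, ∀ i k, α i x (e k x) = if i = k then 1 else 0
  sum : ∀ x ∈ V, ∀ v : TangentSpace I x, v = ∑ i, α i x v • e i x

/-- The Christoffel symbol `α k (∇_{e i} e j)`. -/
noncomputable def christoffel (conn : CovariantDerivative I E (TangentSpace I : M → Type _))
    (e : Fin n → Π x : M, TangentSpace I x) (α : Fin n → Π x : M, TangentSpace I x →L[ℝ] ℝ)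
    (i j k : Fin n) (x : M) : ℝ := α k x (conn (e j) x (e i x))

namespace IsFrame

variable {V : Set M} {e : Fin n → Π x : M, TangentSpace I x}
  {α : Fin n → Π x : M, TangentSpace I x →L[ℝ] ℝ}

theorem ext (hF : IsFrame V e α) {x : M} (hx : x ∈ V) {v w : TangentSpace I x}
    (h : ∀ i, α i x v = α i x w) : v = w := by
  rw [hF.sum x hx v, hF.sum x hx w]
  simp only [h]

theorem form_sum (hF : IsFrame V e α) {x : M} (hx : x ∈ V) (r : Fin n → ℝ) (k : Fin n) :
    α k x (∑ i, r i • e i x) = r k := by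
  rw [map_sum]
  simp only [map_smul, hF.dual x hx, smul_eq_mul, mul_ite, mul_one, mul_zero,
    Finset.sum_ite_eq, Finset.mem_univ, if_true]

theorem form_apply (hF : IsFrame V e α) {x : M} (hx : x ∈ V) (φ : TangentSpace I x →L[ℝ] ℝ)
    (v : TangentSpace I x) : φ v = ∑ i, α i x v * φ (e i x) := by
  conv_lhs => rw [hF.sum x hx v]
  rw [map_sum]
  simp only [map_smul, smul_eq_mul]

theorem smoothField (hF : IsFrame V e α) {X : Π x : M, TangentSpace I x} {U : Set M}
    (hUV : U ⊆ V) (h : ∀ i, SmoothFn I (fun x ↦ α i x (X x)) U) : SmoothField X U := by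
  have h5 : SmoothField (fun y ↦ ∑ m, α m y (X y) • e m y) U :=
    SmoothField.sum fun m _ ↦ SmoothField.smul (h m) ((hF.smooth m).mono hUV)
  exact h5.congr fun y hy ↦ hF.sum y (hUV hy) (X y)

theorem coeff_smooth (hF : IsFrame V e α) {X : Π x : M, TangentSpace I x} {U : Set M}
    (hU : IsOpen U) (hX : SmoothField X U) (i : Fin n) :
    SmoothFn I (fun x ↦ α i x (X x)) (U ∩ V) :=
  hF.form i (U ∩ V) X (hU.inter hF.isOpen) inter_subset_right (hX.mono inter_subset_left)

theorem coeff_mdiffAt (hF : IsFrame V e α) {X : Π x : M, TangentSpace I x} {U : Set M}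
    (hU : IsOpen U) (hX : SmoothField X U) {x : M} (hxU : x ∈ U) (hx : x ∈ V) (i : Fin n) :
    MDifferentiableAt I 𝓘(ℝ, ℝ) (fun x ↦ α i x (X x)) x :=
  (hF.coeff_smooth hU hX i).mdiffAt (hU.inter hF.isOpen) ⟨hxU, hx⟩

/-- The covariant derivative in terms of a frame. -/
theorem conn_apply (hF : IsFrame V e α)
    (conn : CovariantDerivative I E (TangentSpace I : M → Type _))
    {X : Π x : M, TangentSpace I x} {U : Set M} (hU : IsOpen U) (hX : SmoothField X U) {x : M}
    (hxU : x ∈ U) (hx : x ∈ V) (v : TangentSpace I x) (k : Fin n) :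
    α k x (conn X x v) = dfun (fun y ↦ α k y (X y)) x v +
      ∑ i, ∑ j, α i x v * α j x (X x) * christoffel conn e α i j k x := by
  have hc := fun i ↦ hF.coeff_mdiffAt hU hX hxU hx i
  have he := fun i ↦ (hF.smooth i).diffAt hF.isOpen hx
  have hs : ∀ i, DiffFieldAt (fun y ↦ α i y (X y) • e i y) x := fun i ↦
    (SmoothField.smul (hF.coeff_smooth hU hX i) ((hF.smooth i).mono inter_subset_right)).diffAt
      (hU.inter hF.isOpen) ⟨hxU, hx⟩
  have h1 : conn X x v = ∑ j, (α j x (X x) • conn (e j) x v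
      + dfun (fun y ↦ α j y (X y)) x v • e j x) := by
    rw [conn_congr conn (X := fun y ↦ ∑ i, α i y (X y) • e i y) (diffFieldAt_sum fun i _ ↦ hs i)
      (Filter.eventually_of_mem (hF.isOpen.mem_nhds hx) fun y hy ↦ hF.sum y hy (X y)),
      conn_sum conn fun i _ ↦ hs i]
    exact Finset.sum_congr rfl fun j _ ↦ conn_smul conn (hc j) (he j) v
  have h2 : ∀ j, α k x (conn (e j) x v) = ∑ i, α i x v * christoffel conn e α i j k x := fun j ↦
    hF.form_apply hx ((α k x).comp (conn (e j) x)) v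
  rw [h1, Finset.sum_add_distrib, map_add, hF.form_sum hx, map_sum, add_comm]
  congr 1
  rw [Finset.sum_comm]
  refine Finset.sum_congr rfl fun j _ ↦ ?_
  rw [map_smul, h2, smul_eq_mul, Finset.mul_sum]
  exact Finset.sum_congr rfl fun i _ ↦ by ring

/-- The Lie bracket in terms of a frame, for a torsion-free connection. -/
theorem mlieBracket_apply (hF : IsFrame V e α)
    {conn : CovariantDerivative I E (TangentSpace I : M → Type _)}
    {G : Π x : M, TangentSpace I x →L[ℝ] TangentSpace I x →L[ℝ] ℝ} (hconn : IsLeviCivita G conn)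
    {X Y : Π x : M, TangentSpace I x} {U : Set M} (hU : IsOpen U) (hX : SmoothField X U)
    (hY : SmoothField Y U) {x : M} (hxU : x ∈ U) (hx : x ∈ V) (k : Fin n) :
    α k x (VectorField.mlieBracket I X Y x) =
      dfun (fun y ↦ α k y (Y y)) x (X x) - dfun (fun y ↦ α k y (X y)) x (Y x) +
      ∑ i, ∑ j, α i x (X x) * α j x (Y x) *
        (christoffel conn e α i j k x - christoffel conn e α j i k x) := by
  rw [← hconn.torsion_free X Y x (hX.diffAt hU hxU) (hY.diffAt hU hxU), map_sub,
    hF.conn_apply conn hU hX hxU hx, hF.conn_apply conn hU hY hxU hx]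
  have : ∑ i, ∑ j, α i x (Y x) * α j x (X x) * christoffel conn e α i j k x =
      ∑ i, ∑ j, α i x (X x) * α j x (Y x) * christoffel conn e α j i k x := by
    rw [Finset.sum_comm]
    exact Finset.sum_congr rfl fun i _ ↦ Finset.sum_congr rfl fun j _ ↦ by ring
  rw [this]
  simp only [mul_sub, Finset.sum_sub_distrib]
  ring

/-- The components of the curvature in terms of the Christoffel symbols and their derivatives. -/
noncomputable def curvatureSymbol (Γ : Fin n → Fin n → Fin n → ℝ)
    (D : Fin n → Fin n → Fin n → Fin n → ℝ) (i j k l : Fin n) : ℝ :=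
  D i j k l - D j i k l + ∑ m, (Γ j k m * Γ i m l - Γ i k m * Γ j m l)
    - ∑ m, (Γ i j m - Γ j i m) * Γ m k l

/-- The algebra behind the tensoriality of the curvature: all first derivatives of the fields
cancel. Here u, v, w are the components of X, Y, Z; xv stands for the derivatives of the components
of X along Y, yu for those of Y along X, and zu, zv for those of Z along X and Y. The entry D a i j
l is the derivative of Γ i j l along the a-th frame vector. -/
theorem curvatureSymbol_sum (Γ : Fin n → Fin n → Fin n → ℝ)
    (D : Fin n → Fin n → Fin n → Fin n → ℝ) (u v w xv yu zu zv : Fin n → ℝ) (l : Fin n) :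
    (∑ i, ∑ j, (v i * w j * (∑ a, u a * D a i j l) + Γ i j l * (v i * zu j + w j * yu i))
      + ∑ i, ∑ j, u i * (zv j + ∑ a, ∑ b, v a * w b * Γ a b j) * Γ i j l)
    - (∑ i, ∑ j, (u i * w j * (∑ a, v a * D a i j l) + Γ i j l * (u i * zv j + w j * xv i))
      + ∑ i, ∑ j, v i * (zu j + ∑ a, ∑ b, u a * w b * Γ a b j) * Γ i j l)
    - ∑ i, ∑ j, (yu i - xv i + ∑ a, ∑ b, u a * v b * (Γ a b i - Γ b a i)) * w j * Γ i j l
    = ∑ i, ∑ j, ∑ k, u i * v j * w k * curvatureSymbol Γ D i j k l := by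
  have e1 : ∀ (p q : Fin n → ℝ), ∑ i, ∑ j, p i * w j * (∑ a, q a * D a i j l) =
      ∑ i, ∑ j, ∑ k, q i * p j * w k * D i j k l := fun p q ↦ by
    simp only [Finset.mul_sum]
    rw [Finset.sum_congr rfl fun i _ ↦ Finset.sum_comm, Finset.sum_comm]
    refine Finset.sum_congr rfl fun i _ ↦ Finset.sum_congr rfl fun j _ ↦
      Finset.sum_congr rfl fun k _ ↦ by ring
  have e2 : ∀ (p q : Fin n → ℝ), ∑ i, ∑ j, q i * (∑ a, ∑ b, p a * w b * Γ a b j) * Γ i j l =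
      ∑ i, ∑ j, ∑ k, q i * p j * w k * ∑ m, Γ j k m * Γ i m l := fun p q ↦ by
    refine Finset.sum_congr rfl fun i _ ↦ ?_
    simp only [Finset.mul_sum, Finset.sum_mul]
    rw [Finset.sum_comm]
    refine Finset.sum_congr rfl fun j _ ↦ ?_
    rw [Finset.sum_comm]
    refine Finset.sum_congr rfl fun k _ ↦ Finset.sum_congr rfl fun m _ ↦ by ring
  have e3 : ∑ i, ∑ j, (∑ a, ∑ b, u a * v b * (Γ a b i - Γ b a i)) * w j * Γ i j l =
      ∑ i, ∑ j, ∑ k, u i * v j * w k * ∑ m, (Γ i j m - Γ j i m) * Γ m k l := by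
    simp only [Finset.mul_sum, Finset.sum_mul]
    rw [Finset.sum_congr rfl fun i _ ↦ Finset.sum_comm, Finset.sum_comm]
    refine Finset.sum_congr rfl fun i _ ↦ ?_
    rw [Finset.sum_congr rfl fun i _ ↦ Finset.sum_comm, Finset.sum_comm]
    refine Finset.sum_congr rfl fun j _ ↦ ?_
    rw [Finset.sum_comm]
    refine Finset.sum_congr rfl fun k _ ↦ Finset.sum_congr rfl fun m _ ↦ by ring
  have e4 : ∀ p q : Fin n → ℝ, ∑ i, ∑ j, ∑ k, p i * q j * w k * D j i k l =
      ∑ i, ∑ j, ∑ k, q i * p j * w k * D i j k l := fun p q ↦ by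
    rw [Finset.sum_comm]
    refine Finset.sum_congr rfl fun i _ ↦ Finset.sum_congr rfl fun j _ ↦
      Finset.sum_congr rfl fun k _ ↦ by ring
  have e5 : ∑ i, ∑ j, ∑ k, u i * v j * w k * ∑ m, Γ i k m * Γ j m l =
      ∑ i, ∑ j, ∑ k, v i * u j * w k * ∑ m, Γ j k m * Γ i m l := by
    rw [Finset.sum_comm]
    refine Finset.sum_congr rfl fun i _ ↦ Finset.sum_congr rfl fun j _ ↦
      Finset.sum_congr rfl fun k _ ↦ by ring
  have l1 : ∀ (p q yy zz zz' : Fin n → ℝ),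
      (∑ i, ∑ j, (p i * w j * (∑ a, q a * D a i j l) + Γ i j l * (p i * zz j + w j * yy i))
      + ∑ i, ∑ j, q i * (zz' j + ∑ a, ∑ b, p a * w b * Γ a b j) * Γ i j l) =
      ∑ i, ∑ j, p i * w j * (∑ a, q a * D a i j l) + ∑ i, ∑ j, Γ i j l * p i * zz j
      + ∑ i, ∑ j, Γ i j l * w j * yy i + ∑ i, ∑ j, Γ i j l * q i * zz' j
      + ∑ i, ∑ j, q i * (∑ a, ∑ b, p a * w b * Γ a b j) * Γ i j l := fun p q yy zz zz' ↦ by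
    simp only [← Finset.sum_add_distrib]
    refine Finset.sum_congr rfl fun i _ ↦ Finset.sum_congr rfl fun j _ ↦ by ring
  have l2 : ∑ i, ∑ j, (yu i - xv i + ∑ a, ∑ b, u a * v b * (Γ a b i - Γ b a i)) * w j * Γ i j l =
      ∑ i, ∑ j, Γ i j l * w j * yu i - ∑ i, ∑ j, Γ i j l * w j * xv i
      + ∑ i, ∑ j, (∑ a, ∑ b, u a * v b * (Γ a b i - Γ b a i)) * w j * Γ i j l := by
    simp only [← Finset.sum_add_distrib, ← Finset.sum_sub_distrib]
    refine Finset.sum_congr rfl fun i _ ↦ Finset.sum_congr rfl fun j _ ↦ by ring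
  have l3 : ∑ i, ∑ j, ∑ k, u i * v j * w k * curvatureSymbol Γ D i j k l =
      ∑ i, ∑ j, ∑ k, u i * v j * w k * D i j k l - ∑ i, ∑ j, ∑ k, u i * v j * w k * D j i k l
      + ∑ i, ∑ j, ∑ k, u i * v j * w k * (∑ m, Γ j k m * Γ i m l)
      - ∑ i, ∑ j, ∑ k, u i * v j * w k * (∑ m, Γ i k m * Γ j m l)
      - ∑ i, ∑ j, ∑ k, u i * v j * w k * ∑ m, (Γ i j m - Γ j i m) * Γ m k l := by
    simp only [← Finset.sum_add_distrib, ← Finset.sum_sub_distrib, curvatureSymbol]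
    refine Finset.sum_congr rfl fun i _ ↦ Finset.sum_congr rfl fun j _ ↦
      Finset.sum_congr rfl fun k _ ↦ ?_
    rw [Finset.sum_sub_distrib]
    ring
  rw [l1, l1, l2, l3, e1, e1, e2, e2, e3, e4, e5]
  ring

/-- Needed so that a covariant derivative can itself be differentiated in the curvature. -/
theorem smoothField_conn (hF : IsFrame V e α)
    {conn : CovariantDerivative I E (TangentSpace I : M → Type _)}
    (hΓ : ∀ i j k, SmoothFn I (christoffel conn e α i j k) V) {O : Set M} (hO : IsOpen O)
    (hOV : O ⊆ V) {Z W : Π y : M, TangentSpace I y} (hZ : SmoothField Z O) (hW : SmoothField W O) :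
    SmoothField (fun y ↦ conn Z y (W y)) O := by
  have cs : ∀ {W : Π y : M, TangentSpace I y}, SmoothField W O →
      ∀ i, SmoothFn I (fun y ↦ α i y (W y)) O := fun hW i ↦ by
    have := hF.coeff_smooth hO hW i
    rwa [inter_eq_left.2 hOV] at this
  refine hF.smoothField hOV fun m ↦ ContMDiffOn.congr ?_ fun y hy ↦
    hF.conn_apply conn hO hZ hy (hOV hy) (W y) m
  exact (SmoothFn.dfun_apply hO (cs hZ m) hW).add (contMDiffOn_finsetSum fun i _ ↦
    contMDiffOn_finsetSum fun j _ ↦ ((cs hW i).mul (cs hZ j)).mul ((hΓ i j m).mono hOV))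

/-- The second derivatives of the components of Z cancel against the derivative along [X, Y] by
`dfun_mlieBracket`; the remaining terms are matched by `curvatureSymbol_sum`. -/
theorem curvature_fields_apply (hF : IsFrame V e α)
    {conn : CovariantDerivative I E (TangentSpace I : M → Type _)}
    {G : Π x : M, TangentSpace I x →L[ℝ] TangentSpace I x →L[ℝ] ℝ} (hconn : IsLeviCivita G conn)
    (hΓ : ∀ i j k, SmoothFn I (christoffel conn e α i j k) V) {O : Set M} (hO : IsOpen O)
    (hOV : O ⊆ V) {X Y Z : Π y : M, TangentSpace I y} (hX : SmoothField X O) (hY : SmoothField Y O)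
    (hZ : SmoothField Z O) {x : M} (hxO : x ∈ O) (l : Fin n) :
    α l x (conn (fun y ↦ conn Z y (Y y)) x (X x) - conn (fun y ↦ conn Z y (X y)) x (Y x)
      - conn Z x (VectorField.mlieBracket I X Y x)) =
      ∑ i, ∑ j, ∑ k, α i x (X x) * α j x (Y x) * α k x (Z x) *
      curvatureSymbol (fun i j k ↦ christoffel conn e α i j k x)
        (fun i j k l ↦ dfun (christoffel conn e α j k l) x (e i x)) i j k l := by
  have hx := hOV hxO
  set Γ := christoffel conn e α with hΓdef
  have cs : ∀ {W : Π y : M, TangentSpace I y}, SmoothField W O →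
      ∀ i, SmoothFn I (fun y ↦ α i y (W y)) O := fun hW i ↦ by
    have := hF.coeff_smooth hO hW i
    rwa [inter_eq_left.2 hOV] at this
  have step : ∀ {W : Π y : M, TangentSpace I y}, SmoothField W O → ∀ (u' : TangentSpace I x) l,
      α l x (conn (fun y ↦ conn Z y (W y)) x u') =
      dfun (fun y ↦ dfun (fun y ↦ α l y (Z y)) y (W y)) x u' +
      (∑ i, ∑ j, (α i x (W x) * α j x (Z x) * (∑ a, α a x u' * dfun (Γ i j l) x (e a x)) +
        Γ i j l x * (α i x (W x) * dfun (fun y ↦ α j y (Z y)) x u' +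
          α j x (Z x) * dfun (fun y ↦ α i y (W y)) x u'))
      + ∑ i, ∑ j, α i x u' * (dfun (fun y ↦ α j y (Z y)) x (W x) +
          ∑ a, ∑ b, α a x (W x) * α b x (Z x) * Γ a b j x) * Γ i j l x) := by
    intro W hW u' l
    have hval : ∀ m, ∀ y ∈ O, α m y (conn Z y (W y)) = dfun (fun y ↦ α m y (Z y)) y (W y) +
        ∑ i, ∑ j, α i y (W y) * α j y (Z y) * Γ i j m y := fun m y hy ↦
      hF.conn_apply conn hO hZ hy (hOV hy) (W y) m
    have hd : ∀ m, SmoothFn I (fun y ↦ dfun (fun y ↦ α m y (Z y)) y (W y)) O := fun m ↦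
      SmoothFn.dfun_apply hO (cs hZ m) hW
    have ht : ∀ m i j, SmoothFn I (fun y ↦ α i y (W y) * α j y (Z y) * Γ i j m y) O :=
      fun m i j ↦ ((cs hW i).mul (cs hZ j)).mul ((hΓ i j m).mono hOV)
    have hsm : SmoothField (fun y ↦ conn Z y (W y)) O := hF.smoothField_conn hΓ hO hOV hZ hW
    rw [hF.conn_apply conn hO hsm hxO hx, dfun_congr
      (Filter.eventually_of_mem (hO.mem_nhds hxO) (hval l)),
      dfun_add ((hd l).mdiffAt hO hxO)
        (mdiffAt_sum fun i _ ↦ mdiffAt_sum fun j _ ↦ (ht l i j).mdiffAt hO hxO),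
      dfun_sum (fun i _ ↦ mdiffAt_sum fun j _ ↦ (ht l i j).mdiffAt hO hxO), add_assoc]
    congr 1
    congr 1
    · refine Finset.sum_congr rfl fun i _ ↦ ?_
      rw [dfun_sum fun j _ ↦ (ht l i j).mdiffAt hO hxO]
      refine Finset.sum_congr rfl fun j _ ↦ ?_
      have h1 := (cs hW i).mdiffAt hO hxO
      have h2 := (cs hZ j).mdiffAt hO hxO
      rw [dfun_mul (u := fun y ↦ α i y (W y) * α j y (Z y)) (h1.mul h2) (((hΓ i j l).mono hOV).mdiffAt hO hxO), dfun_mul h1 h2,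
        hF.form_apply hx (dfun (Γ i j l) x) u']
    · simp only [hval _ x hxO]
      rfl
  have hXY := hF.mlieBracket_apply hconn hO hX hY hxO hx
  have hdd := dfun_mlieBracket hO (cs hZ l) hX hY hxO
  have hX' := step hX (Y x) l
  have hY' := step hY (X x) l
  rw [map_sub, map_sub, hX', hY', hF.conn_apply conn hO hZ hxO hx, hdd]
  simp only [hXY]
  rw [← curvatureSymbol_sum _ _ (fun i ↦ α i x (X x)) (fun i ↦ α i x (Y x)) (fun i ↦ α i x (Z x))
    (fun i ↦ dfun (fun y ↦ α i y (X y)) x (Y x)) (fun i ↦ dfun (fun y ↦ α i y (Y y)) x (X x))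
    (fun i ↦ dfun (fun y ↦ α i y (Z y)) x (X x)) (fun i ↦ dfun (fun y ↦ α i y (Z y)) x (Y x)) l]
  ring

/-- The curvature tensor in terms of a frame. -/
theorem curvature_apply (hF : IsFrame V e α)
    {conn : CovariantDerivative I E (TangentSpace I : M → Type _)}
    {G : Π x : M, TangentSpace I x →L[ℝ] TangentSpace I x →L[ℝ] ℝ} (hconn : IsLeviCivita G conn)
    (hΓ : ∀ i j k, SmoothFn I (christoffel conn e α i j k) V) {x : M} (hx : x ∈ V)
    (u v w : TangentSpace I x) (l : Fin n) :
    α l x (curvature conn x u v w) = ∑ i, ∑ j, ∑ k, α i x u * α j x v * α k x w *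
      curvatureSymbol (fun i j k ↦ christoffel conn e α i j k x)
        (fun i j k l ↦ dfun (christoffel conn e α j k l) x (e i x)) i j k l := by
  obtain ⟨U₁, hU₁, hxU₁, hX⟩ := exists_smoothField (I := I) x u
  obtain ⟨U₂, hU₂, hxU₂, hY⟩ := exists_smoothField (I := I) x v
  obtain ⟨U₃, hU₃, hxU₃, hZ⟩ := exists_smoothField (I := I) x w
  have hXx : (FiberBundle.extend E u : Π y : M, TangentSpace I y) x = u :=
    FiberBundle.extend_apply_self E (E := (TangentSpace I : M → Type _)) u
  have hYx : (FiberBundle.extend E v : Π y : M, TangentSpace I y) x = v :=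
    FiberBundle.extend_apply_self E (E := (TangentSpace I : M → Type _)) v
  have hZx : (FiberBundle.extend E w : Π y : M, TangentSpace I y) x = w :=
    FiberBundle.extend_apply_self E (E := (TangentSpace I : M → Type _)) w
  simp only [curvature]
  generalize (FiberBundle.extend E u : Π y : M, TangentSpace I y) = X at *
  generalize (FiberBundle.extend E v : Π y : M, TangentSpace I y) = Y at *
  generalize (FiberBundle.extend E w : Π y : M, TangentSpace I y) = Z at *
  have hO : IsOpen (U₁ ∩ U₂ ∩ U₃ ∩ V) := ((hU₁.inter hU₂).inter hU₃).inter hF.isOpen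
  have hxO : x ∈ U₁ ∩ U₂ ∩ U₃ ∩ V := ⟨⟨⟨hxU₁, hxU₂⟩, hxU₃⟩, hx⟩
  have hOV : U₁ ∩ U₂ ∩ U₃ ∩ V ⊆ V := inter_subset_right
  replace hX := hX.mono (V := U₁ ∩ U₂ ∩ U₃ ∩ V) fun y hy ↦ hy.1.1.1
  replace hY := hY.mono (V := U₁ ∩ U₂ ∩ U₃ ∩ V) fun y hy ↦ hy.1.1.2
  replace hZ := hZ.mono (V := U₁ ∩ U₂ ∩ U₃ ∩ V) fun y hy ↦ hy.1.2
  generalize U₁ ∩ U₂ ∩ U₃ ∩ V = O at *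
  rw [← hXx, ← hYx, ← hZx]
  exact hF.curvature_fields_apply hconn hΓ hO hOV hX hY hZ hxO l

/-- Frees the curvature from the particular extensions in its definition, so that extensions adapted
to a distribution can be used. -/
theorem curvature_eq_fields (hF : IsFrame V e α)
    {conn : CovariantDerivative I E (TangentSpace I : M → Type _)}
    {G : Π x : M, TangentSpace I x →L[ℝ] TangentSpace I x →L[ℝ] ℝ} (hconn : IsLeviCivita G conn)
    (hΓ : ∀ i j k, SmoothFn I (christoffel conn e α i j k) V) {O : Set M} (hO : IsOpen O)
    (hOV : O ⊆ V) {X Y Z : Π y : M, TangentSpace I y} (hX : SmoothField X O) (hY : SmoothField Y O)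
    (hZ : SmoothField Z O) {x : M} (hxO : x ∈ O) :
    curvature conn x (X x) (Y x) (Z x) =
      conn (fun y ↦ conn Z y (Y y)) x (X x) - conn (fun y ↦ conn Z y (X y)) x (Y x)
      - conn Z x (VectorField.mlieBracket I X Y x) :=
  hF.ext (hOV hxO) fun l ↦ by
    rw [hF.curvature_apply hconn hΓ (hOV hxO), hF.curvature_fields_apply hconn hΓ hO hOV hX hY hZ hxO]

/-- The trace of a linear map, computed with a frame. -/
theorem trace_eq {x : M} (L : TangentSpace I x → TangentSpace I x)
    (hL : ∀ v, L v = ∑ k, α k x v • L (e k x)) :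
    ∑ i, tcoord I x i (L (tbasis I x i)) = ∑ k, α k x (L (e k x)) := by
  have h1 : ∀ i, tcoord I x i (L (tbasis I x i)) =
      ∑ k, tcoord I x i (L (e k x)) * α k x (tbasis I x i) := fun i ↦ by
    rw [hL, map_sum]
    exact Finset.sum_congr rfl fun k _ ↦ by rw [map_smul, smul_eq_mul, mul_comm]
  rw [Finset.sum_congr rfl fun i _ ↦ h1 i, Finset.sum_comm]
  refine Finset.sum_congr rfl fun k _ ↦ ?_
  have h2 : L (e k x) = ∑ i, tcoord I x i (L (e k x)) • tbasis I x i :=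
    ((Module.finBasis ℝ E).sum_repr (L (e k x))).symm
  conv_rhs => rw [h2, map_sum]
  exact Finset.sum_congr rfl fun i _ ↦ by rw [map_smul, smul_eq_mul]

/-- The components of the Ricci tensor in terms of a frame. -/
theorem ricci_apply (hF : IsFrame V e α)
    {conn : CovariantDerivative I E (TangentSpace I : M → Type _)} {x : M} (hx : x ∈ V)
    {R : Fin n → Fin n → Fin n → Fin n → ℝ}
    (hR : ∀ (u v w : TangentSpace I x) (l : Fin n), α l x (curvature conn x u v w) =
      ∑ i, ∑ j, ∑ k, α i x u * α j x v * α k x w * R i j k l) (v w : TangentSpace I x) :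
    ricci conn x v w = ∑ j, ∑ k, α j x v * α k x w * ∑ i, R i j k i := by
  have h1 : ∀ i l, α l x (curvature conn x (e i x) v w) =
      ∑ j, ∑ k, α j x v * α k x w * R i j k l := fun i l ↦ by
    rw [hR, Finset.sum_eq_single i]
    · simp only [hF.dual x hx, if_true, one_mul]
    · intro b _ hb
      simp only [hF.dual x hx, hb, if_false, zero_mul, Finset.sum_const_zero]
    · simp
  have h2 : ricci conn x v w = ∑ i, α i x (curvature conn x (e i x) v w) := by
    refine IsFrame.trace_eq (fun u ↦ curvature conn x u v w) fun u ↦ hF.ext hx fun l ↦ ?_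
    rw [map_sum, hR]
    refine Finset.sum_congr rfl fun i _ ↦ ?_
    rw [map_smul, h1, smul_eq_mul, Finset.mul_sum]
    refine Finset.sum_congr rfl fun j _ ↦ ?_
    rw [Finset.mul_sum]
    exact Finset.sum_congr rfl fun k _ ↦ by ring
  rw [h2]
  simp only [h1]
  rw [Finset.sum_comm]
  refine Finset.sum_congr rfl fun j _ ↦ ?_
  rw [Finset.sum_comm]
  refine Finset.sum_congr rfl fun k _ ↦ ?_
  rw [Finset.mul_sum]

end IsFrame

/-- `e` is a smooth orthonormal frame on the open set `V`, with dual coframe `α`. -/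
structure IsOrthonormalFrame (G : Π x : M, TangentSpace I x →L[ℝ] TangentSpace I x →L[ℝ] ℝ)
    (V : Set M) (e : Fin n → Π x : M, TangentSpace I x)
    (α : Fin n → Π x : M, TangentSpace I x →L[ℝ] ℝ) : Prop extends IsFrame V e α where
  metric : ∀ x ∈ V, ∀ v w : TangentSpace I x, G x v w = ∑ i, α i x v * α i x w

namespace IsOrthonormalFrame

variable {V : Set M} {e : Fin n → Π x : M, TangentSpace I x}
  {α : Fin n → Π x : M, TangentSpace I x →L[ℝ] ℝ}
  {G : Π x : M, TangentSpace I x →L[ℝ] TangentSpace I x →L[ℝ] ℝ}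

theorem metric_left (hF : IsOrthonormalFrame G V e α) {x : M} (hx : x ∈ V) (i : Fin n)
    (v : TangentSpace I x) : G x (e i x) v = α i x v := by
  rw [hF.metric x hx]
  simp only [hF.dual x hx, ite_mul, one_mul, zero_mul, Finset.sum_ite_eq', Finset.mem_univ, if_true]

theorem metric_right (hF : IsOrthonormalFrame G V e α) {x : M} (hx : x ∈ V) (i : Fin n)
    (v : TangentSpace I x) : G x v (e i x) = α i x v := by
  rw [hF.metric x hx]
  simp only [hF.dual x hx, mul_ite, mul_one, mul_zero, Finset.sum_ite_eq', Finset.mem_univ, if_true]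

/-- `inverse` is zero on maps that are not invertible, so the value has to be justified by
exhibiting a two-sided inverse of G x, given by raising indices in the orthonormal frame. -/
theorem inverse_apply (hF : IsOrthonormalFrame G V e α) {x : M} (hx : x ∈ V)
    (φ : TangentSpace I x →L[ℝ] ℝ) : (G x).inverse φ = ∑ i, φ (e i x) • e i x := by
  let b : Fin n → E := fun i ↦ e i x
  let L' : (E →L[ℝ] ℝ) →L[ℝ] E :=
    ∑ i, (ContinuousLinearMap.apply ℝ ℝ (b i)).smulRight (b i)
  let L : (TangentSpace I x →L[ℝ] ℝ) →L[ℝ] TangentSpace I x := L'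
  have hL' : ∀ ψ : E →L[ℝ] ℝ, L' ψ = ∑ i, ψ (b i) • b i := fun ψ ↦ by
    simp only [L', sum_apply, ContinuousLinearMap.smulRight_apply, ContinuousLinearMap.apply_apply]
  have hL : ∀ ψ, L ψ = ∑ i, ψ (e i x) • e i x := hL'
  have h : (G x).inverse = L := by
    refine ContinuousLinearMap.inverse_eq ?_ ?_
    · ext ψ v
      simp only [ContinuousLinearMap.comp_apply, hL, ContinuousLinearMap.id_apply, map_sum, map_smul,
        sum_apply, smul_apply, hF.metric_left hx]
      rw [hF.form_apply hx ψ v]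
      exact Finset.sum_congr rfl fun i _ ↦ by rw [smul_eq_mul, mul_comm]
    · ext v
      simp only [ContinuousLinearMap.comp_apply, hL, ContinuousLinearMap.id_apply,
        hF.metric_right hx]
      exact (hF.sum x hx v).symm
  rw [h, hL]

theorem gradient_eq (hF : IsOrthonormalFrame G V e α) {x : M} (hx : x ∈ V) (u : M → ℝ) :
    gradient G u x = ∑ i, dfun u x (e i x) • e i x := hF.inverse_apply hx _

theorem christoffel_antisymm (hF : IsOrthonormalFrame G V e α)
    {conn : CovariantDerivative I E (TangentSpace I : M → Type _)} (hconn : IsLeviCivita G conn)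
    {x : M} (hx : x ∈ V) (i j k : Fin n) :
    christoffel conn e α i j k x = -christoffel conn e α i k j x := by
  have h := hconn.metric (e j) (e k) x ((hF.smooth j).diffAt hF.isOpen hx)
    ((hF.smooth k).diffAt hF.isOpen hx) (e i x)
  rw [dfun_congr (v := fun _ ↦ if j = k then (1 : ℝ) else 0) (Filter.eventually_of_mem
    (hF.isOpen.mem_nhds hx) fun y hy ↦ by rw [hF.metric_left hy, hF.dual y hy]), dfun_const,
    hF.metric_right hx, hF.metric_left hx] at h
  simp only [christoffel]
  linarith

/-- The Koszul formula: the Christoffel symbols of an orthonormal frame are determined by the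
Lie brackets. -/
theorem christoffel_eq (hF : IsOrthonormalFrame G V e α)
    {conn : CovariantDerivative I E (TangentSpace I : M → Type _)} (hconn : IsLeviCivita G conn)
    {x : M} (hx : x ∈ V) {Γ : Fin n → Fin n → Fin n → ℝ} (hanti : ∀ i j k, Γ i j k = -Γ i k j)
    (hbr : ∀ i j k, α k x (VectorField.mlieBracket I (e i) (e j) x) = Γ i j k - Γ j i k)
    (i j k : Fin n) : christoffel conn e α i j k x = Γ i j k := by
  have h1 : ∀ i j k, christoffel conn e α i j k x - christoffel conn e α j i k x =
      Γ i j k - Γ j i k := fun i j k ↦ by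
    rw [← hbr, ← hconn.torsion_free (e i) (e j) x ((hF.smooth i).diffAt hF.isOpen hx)
      ((hF.smooth j).diffAt hF.isOpen hx), map_sub]
    rfl
  have h2 := fun i j k ↦ hF.christoffel_antisymm hconn hx i j k
  -- A three-index symbol skew in its last two indices is determined by its skew part in the first
  -- two: this is the cyclic combination of Koszul.
  linarith [h1 i j k, h1 j k i, h1 k i j, h2 i j k, h2 j k i, h2 k i j, hanti i j k, hanti j k i,
    hanti k i j]

/-- The definition pairs `tbasis` with its reciprocal basis. Since ρ(v, ·) is linear, summing
against the coordinates of e k reassembles ρ(v, e k), whatever the basis. -/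
theorem ricciEnd_apply (hF : IsOrthonormalFrame G V e α)
    {conn : CovariantDerivative I E (TangentSpace I : M → Type _)} {x : M} (hx : x ∈ V)
    {ρ : Fin n → Fin n → ℝ}
    (hρ : ∀ v w : TangentSpace I x, ricci conn x v w = ∑ j, ∑ k, α j x v * α k x w * ρ j k)
    (v : TangentSpace I x) (k : Fin n) :
    α k x (ricciEnd G conn x v) = ∑ j, α j x v * ρ j k := by
  let L : TangentSpace I x → ℝ := fun w ↦ ∑ j, ∑ k, α j x v * α k x w * ρ j k
  have hLs : ∀ (r : Fin (Module.finrank ℝ E) → ℝ) (w : Fin (Module.finrank ℝ E) → TangentSpace I x),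
      L (∑ i, r i • w i) = ∑ i, r i * L (w i) := fun r w ↦ by
    simp only [L, map_sum, map_smul, smul_eq_mul, Finset.mul_sum, Finset.sum_mul]
    rw [Finset.sum_congr rfl fun j _ ↦ Finset.sum_comm, Finset.sum_comm]
    refine Finset.sum_congr rfl fun i _ ↦ Finset.sum_congr rfl fun j _ ↦
      Finset.sum_congr rfl fun k _ ↦ by ring
  have h1 : α k x (ricciEnd G conn x v) = ∑ i, tcoord I x i (e k x) * L (tbasis I x i) := by
    simp only [ricciEnd, map_sum, map_smul, hF.inverse_apply hx, hF.form_sum hx, smul_eq_mul]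
    refine Finset.sum_congr rfl fun i _ ↦ ?_
    rw [hρ, mul_comm]
  have h2 : e k x = ∑ i, tcoord I x i (e k x) • tbasis I x i :=
    ((Module.finBasis ℝ E).sum_repr (e k x)).symm
  rw [h1, ← hLs, ← h2]
  refine Finset.sum_congr rfl fun j _ ↦ ?_
  simp only [hF.dual x hx, mul_ite, mul_one, mul_zero, ite_mul, zero_mul, Finset.sum_ite_eq',
    Finset.mem_univ, if_true]

theorem scalarCurvature_eq (hF : IsOrthonormalFrame G V e α)
    {conn : CovariantDerivative I E (TangentSpace I : M → Type _)} {x : M} (hx : x ∈ V)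
    {ρ : Fin n → Fin n → ℝ}
    (hρ : ∀ v w : TangentSpace I x, ricci conn x v w = ∑ j, ∑ k, α j x v * α k x w * ρ j k) :
    scalarCurvature G conn x = ∑ k, ρ k k := by
  have h1 : ∀ j k, α k x (ricciEnd G conn x (e j x)) = ρ j k := fun j k ↦ by
    rw [hF.ricciEnd_apply hx hρ]
    simp only [hF.dual x hx, ite_mul, one_mul, zero_mul, Finset.sum_ite_eq', Finset.mem_univ,
      if_true]
  rw [scalarCurvature, IsFrame.trace_eq (e := e) (α := α) (ricciEnd G conn x) fun v ↦ hF.ext hx fun k ↦ ?_]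
  · exact Finset.sum_congr rfl fun k _ ↦ h1 k k
  · rw [hF.ricciEnd_apply hx hρ, map_sum]
    exact Finset.sum_congr rfl fun j _ ↦ by rw [map_smul, h1, smul_eq_mul]

end IsOrthonormalFrame

end Frames

/-! ### Frames obtained from coframes, and smoothness of a Riemannian metric. -/

section DualFrames

variable {E : Type*} [NormedAddCommGroup E] [NormedSpace ℝ E] [FiniteDimensional ℝ E]
  {H : Type*} [TopologicalSpace H] {I : ModelWithCorners ℝ E H}
  {M : Type*} [TopologicalSpace M] [ChartedSpace H M] [IsManifold I ∞ M] {n : ℕ}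

/-- A family of vectors with dual forms, as many as the dimension, is a basis. -/
theorem sum_of_dual {W : Type*} [AddCommGroup W] [Module ℝ W] [FiniteDimensional ℝ W]
    (hn : Module.finrank ℝ W = n) {α : Fin n → W → ℝ} (hadd : ∀ i v w, α i (v + w) = α i v + α i w)
    (hsmul : ∀ i (r : ℝ) v, α i (r • v) = r * α i v) {e : Fin n → W}
    (hd : ∀ i k, α i (e k) = if i = k then 1 else 0) (v : W) : v = ∑ i, α i v • e i := by
  let A : Fin n → W →ₗ[ℝ] ℝ := fun i ↦ ⟨⟨α i, hadd i⟩, hsmul i⟩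
  have hA : ∀ i (r : Fin n → ℝ), A i (∑ k, r k • e k) = r i := fun i r ↦ by
    rw [map_sum]
    have : ∀ k, A i (r k • e k) = r k * if i = k then 1 else 0 := fun k ↦ by
      rw [map_smul, smul_eq_mul]; exact congrArg _ (hd i k)
    simp [this]
  have hli : LinearIndependent ℝ e := by
    rw [Fintype.linearIndependent_iff]
    intro r hr i
    rw [← hA i r, hr, map_zero]
  have hspan : Submodule.span ℝ (range e) = ⊤ :=
    hli.span_eq_top_of_card_eq_finrank' (by simp [hn])
  obtain ⟨r, hr⟩ := (Submodule.mem_span_range_iff_exists_fun ℝ).1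
    (hspan ▸ Submodule.mem_top : v ∈ Submodule.span ℝ (range e))
  conv_lhs => rw [← hr]
  refine Finset.sum_congr rfl fun i _ ↦ ?_
  congr 1
  rw [← hr]
  exact (hA i r).symm

theorem isFrame_of_dual (hn : Module.finrank ℝ E = n)
    {α : Fin n → Π x : M, TangentSpace I x →L[ℝ] ℝ} {e : Fin n → Π x : M, TangentSpace I x}
    {V : Set M} (hV : IsOpen V) (hα : ∀ i, SmoothForm (α i) V)
    (hd : ∀ x ∈ V, ∀ i k, α i x (e k x) = if i = k then 1 else 0) : IsFrame V e α where
  isOpen := hV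
  form := hα
  smooth := smoothField_dual hn hV hα hd
  dual := hd
  sum x hx v := sum_of_dual (W := E) hn (α := fun i ↦ α i x) (fun i ↦ map_add (α i x))
    (fun i r v ↦ map_smul (α i x) r v) (e := fun i ↦ e i x) (hd x hx) v

/-- A smooth coframe has a dual frame. -/
theorem exists_isFrame (hn : Module.finrank ℝ E = n)
    {α : Fin n → Π x : M, TangentSpace I x →L[ℝ] ℝ}
    {V : Set M} (hV : IsOpen V) (hα : ∀ i, SmoothForm (α i) V)
    (hinj : ∀ x ∈ V, ∀ v : TangentSpace I x, (∀ i, α i x v = 0) → v = 0) :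
    ∃ e : Fin n → Π x : M, TangentSpace I x, IsFrame V e α := by
  classical
  have key : ∀ x, ∀ k : Fin n, ∃ v : TangentSpace I x,
      x ∈ V → ∀ i, α i x v = if i = k then 1 else 0 := by
    intro x k
    by_cases hx : x ∈ V
    swap
    · exact ⟨0, fun h ↦ absurd h hx⟩
    let A : E →ₗ[ℝ] (Fin n → ℝ) := LinearMap.pi fun i ↦ (α i x : E →L[ℝ] ℝ).toLinearMap
    have hA : Function.Injective A := by
      rw [← LinearMap.ker_eq_bot, LinearMap.ker_eq_bot']
      intro v hv
      exact hinj x hx v fun i ↦ congrFun hv i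
    have hs : Function.Surjective A :=
      (LinearMap.injective_iff_surjective_of_finrank_eq_finrank (by simp [hn])).1 hA
    obtain ⟨v, hv⟩ := hs (fun i ↦ if i = k then 1 else 0)
    exact ⟨v, fun _ i ↦ congrFun hv i⟩
  choose e he using fun k x ↦ key x k
  exact ⟨e, isFrame_of_dual hn hV hα fun x hx i k ↦ he k x hx i⟩

/-- The smoothness of a Riemannian metric. -/
theorem smoothFn_metric (h : ContMDiffRiemannianMetric I ∞ E (TangentSpace I : M → Type _))
    {X Y : Π x : M, TangentSpace I x} {U : Set M} (hX : SmoothField X U) (hY : SmoothField Y U) :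
    SmoothFn I (fun x ↦ h.inner x (X x) (Y x)) U := by
  intro x hx
  have : ContMDiffWithinAt I (I.prod 𝓘(ℝ)) ∞
      (fun m ↦ TotalSpace.mk' ℝ (E := Bundle.Trivial M ℝ) m (h.inner m (X m) (Y m))) U x := by
    apply ContMDiffWithinAt.clm_bundle_apply₂ (F₁ := E) (F₂ := E)
    · exact h.contMDiff.contMDiffAt.contMDiffWithinAt
    · exact hX x hx
    · exact hY x hx
  simp only [contMDiffWithinAt_totalSpace] at this
  exact this.2

end DualFrames

/-! ### The surface of constant curvature. -/

section Base

variable {B : Type*} [TopologicalSpace B] [ChartedSpace (EuclideanSpace ℝ (Fin 2)) B]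
  [IsManifold (𝓡 2) ∞ B]

/-- A local orthonormal frame of a surface of constant curvature. -/
theorem exists_surface_frame
    (h : ContMDiffRiemannianMetric (𝓡 2) ∞ (EuclideanSpace ℝ (Fin 2))
      (TangentSpace (𝓡 2) : B → Type _))
    {j : Π y : B, TangentSpace (𝓡 2) y →L[ℝ] TangentSpace (𝓡 2) y}
    (hj : IsHermitianStructure h.inner j) {K : ℝ} (hK : HasConstantCurvature h.inner K) (y₀ : B) :
    ∃ (V : Set B) (w : Fin 2 → Π y : B, TangentSpace (𝓡 2) y) (a : Fin 2 → B → ℝ), y₀ ∈ V ∧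
      IsOrthonormalFrame h.inner V w (fun i y ↦ h.inner y (w i y)) ∧
      (∀ y ∈ V, j y (w 0 y) = w 1 y) ∧ (∀ k, SmoothFn (𝓡 2) (a k) V) ∧
      (∀ k, ∀ y ∈ V, h.inner y (w k y) (VectorField.mlieBracket (𝓡 2) (w 0) (w 1) y) = - a k y) ∧
      ∀ y ∈ V, dfun (a 0) y (w 1 y) - dfun (a 1) y (w 0 y) - a 0 y ^ 2 - a 1 y ^ 2 = K := by
  obtain ⟨z, hz⟩ : ∃ z : EuclideanSpace ℝ (Fin 2), z ≠ 0 := exists_ne 0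
  obtain ⟨U, hU, hyU, hZ⟩ := exists_smoothField (I := 𝓡 2) y₀ z
  have hZy : (FiberBundle.extend (EuclideanSpace ℝ (Fin 2)) (x := y₀) z :
      Π y : B, TangentSpace (𝓡 2) y) y₀ = z :=
    FiberBundle.extend_apply_self _ (E := (TangentSpace (𝓡 2) : B → Type _)) (x := y₀) z
  generalize (FiberBundle.extend (EuclideanSpace ℝ (Fin 2)) (x := y₀) z :
      Π y : B, TangentSpace (𝓡 2) y) = Z at *
  have hN : SmoothFn (𝓡 2) (fun y ↦ h.inner y (Z y) (Z y)) U := smoothFn_metric h hZ hZ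
  let V : Set B := U ∩ (fun y ↦ h.inner y (Z y) (Z y)) ⁻¹' Ioi 0
  have hV : IsOpen V := hN.continuousOn.isOpen_inter_preimage hU isOpen_Ioi
  have hVU : V ⊆ U := inter_subset_left
  have hyV : y₀ ∈ V := ⟨hyU, h.pos y₀ (Z y₀) (by rw [hZy]; exact hz)⟩
  let r : B → ℝ := fun y ↦ (Real.sqrt (h.inner y (Z y) (Z y)))⁻¹
  have hr : SmoothFn (𝓡 2) r V := by
    intro y hy
    have h1 : ContDiffAt ℝ ∞ (fun s : ℝ ↦ (Real.sqrt s)⁻¹) (h.inner y (Z y) (Z y)) :=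
      (Real.contDiffAt_sqrt (ne_of_gt hy.2)).inv (Real.sqrt_ne_zero'.2 hy.2)
    exact ContMDiffAt.comp_contMDiffWithinAt (g := fun s : ℝ ↦ (Real.sqrt s)⁻¹) y h1.contMDiffAt ((hN.mono hVU) y hy)
  let w₀ : Π y : B, TangentSpace (𝓡 2) y := fun y ↦ r y • Z y
  let w : Fin 2 → Π y : B, TangentSpace (𝓡 2) y := ![w₀, fun y ↦ j y (w₀ y)]
  have hw₀ : SmoothField w₀ V := SmoothField.smul hr (hZ.mono hVU)
  have hw : ∀ i, SmoothField (w i) V := fun i ↦ by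
    fin_cases i
    · exact hw₀
    · exact hj.smooth V w₀ hV hw₀
  have h00 : ∀ y ∈ V, h.inner y (w₀ y) (w₀ y) = 1 := fun y hy ↦ by
    have h1 : 0 < h.inner y (Z y) (Z y) := hy.2
    simp only [w₀, map_smul, smul_apply, smul_eq_mul, r]
    have h2 := Real.mul_self_sqrt h1.le
    have h3 := Real.sqrt_ne_zero'.2 h1
    field_simp
    rw [sq, h2]
  have h01 : ∀ y, ∀ v, h.inner y v (j y v) = 0 := fun y v ↦ by
    have h1 := hj.orthogonal y v (j y v)
    rw [hj.square, map_neg, h.symm y (j y v) v] at h1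
    linarith
  have hd : ∀ y ∈ V, ∀ i k, h.inner y (w i y) (w k y) = if i = k then 1 else 0 := by
    intro y hy i k
    fin_cases i <;> fin_cases k
    · exact h00 y hy
    · exact h01 y (w₀ y)
    · exact (h.symm y _ _).trans (h01 y (w₀ y))
    · exact (hj.orthogonal y _ _).trans (h00 y hy)
  have hform : ∀ i, SmoothForm (fun y ↦ h.inner y (w i y)) V := fun i U' X hU' hUV hX ↦
    smoothFn_metric h ((hw i).mono hUV) hX
  have hF : IsOrthonormalFrame h.inner V w (fun i y ↦ h.inner y (w i y)) :=
    { isFrame_of_dual (by simp) hV hform hd with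
      metric := fun y hy v v' ↦ by
        have hs := (isFrame_of_dual (by simp) hV hform hd).sum y hy v
        conv_lhs => rw [hs, map_sum]
        simp only [map_smul, sum_apply, smul_apply, smul_eq_mul] }
  obtain ⟨conn, hconn, hcurv⟩ := hK
  -- The sign is chosen so that ∇ w 0 = a k • w 1 in the direction w k: zero torsion then gives [w
  -- 0, w 1] = -a 0 w 0 - a 1 w 1.
  let a : Fin 2 → B → ℝ := fun k y ↦
    -h.inner y (w k y) (VectorField.mlieBracket (𝓡 2) (w 0) (w 1) y)
  have ha : ∀ k, SmoothFn (𝓡 2) (a k) V := fun k ↦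
    (smoothFn_metric h (hw k) (SmoothField.mlieBracket hV (hw 0) (hw 1))).neg
  let tab : (Fin 2 → ℝ) → Fin 2 → Fin 2 → Fin 2 → ℝ := fun a i j k ↦
    a i * (if j = 0 ∧ k = 1 then 1 else if j = 1 ∧ k = 0 then -1 else 0)
  have hchr : ∀ i k l, ∀ y ∈ V, christoffel conn w (fun i y ↦ h.inner y (w i y)) i k l y =
      tab (fun i ↦ a i y) i k l := by
    intro i k l y hy
    refine hF.christoffel_eq hconn hy ?_ ?_ i k l
    · intro i k l
      fin_cases k <;> fin_cases l <;> simp [tab]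
    · intro i k l
      have hsw : VectorField.mlieBracket (𝓡 2) (w 1) (w 0) y =
        -VectorField.mlieBracket (𝓡 2) (w 0) (w 1) y := VectorField.mlieBracket_swap_apply
      fin_cases i <;> fin_cases k <;> fin_cases l <;> simp [tab, a, hsw]
  have hchs : ∀ i k l, SmoothFn (𝓡 2) (christoffel conn w (fun i y ↦ h.inner y (w i y)) i k l) V :=
    fun i k l ↦ ContMDiffOn.congr ((ha i).mul contMDiffOn_const) (hchr i k l)
  refine ⟨V, w, a, hyV, hF, fun _ _ ↦ rfl, ha, fun k y _ ↦ by simp [a], fun y hy ↦ ?_⟩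
  have hdchr : ∀ (i k l : Fin 2) (v : TangentSpace (𝓡 2) y), dfun (christoffel conn w (fun i y ↦ h.inner y (w i y)) i k l) y v =
      tab (fun i ↦ dfun (a i) y v) i k l := fun i k l v ↦ by
    rw [dfun_congr (Filter.eventually_of_mem (hV.mem_nhds hy) (hchr i k l))]
    have := dfun_mul (I := 𝓡 2) (v := fun _ ↦ (if k = 0 ∧ l = 1 then (1 : ℝ) else
      if k = 1 ∧ l = 0 then -1 else 0)) ((ha i).mdiffAt hV hy) mdifferentiableAt_const v
    rw [dfun_const, mul_zero, zero_add, mul_comm] at this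
    exact this
  -- The component of R(w 0, w 1) w 1 along w 0 is the Gauss curvature K; expanding it in the
  -- connection coefficients gives the differential equation for a.
  have hR := hF.curvature_apply hconn hchs hy (w 0 y) (w 1 y) (w 1 y) 0
  rw [hcurv] at hR
  simp only [hd y hy, map_smul, map_sub, hchr _ _ _ y hy, hdchr] at hR
  simp [Fin.sum_univ_two, IsFrame.curvatureSymbol, tab] at hR
  linarith

end Base

/-! ### The coordinate t, and frames on the circle bundle and on the cylinder. -/

section Coordinate

variable {P : Type*} [TopologicalSpace P] [ChartedSpace (EuclideanSpace ℝ (Fin 3)) P]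
  [IsManifold (𝓡 3) ∞ P] {a b : ℝ}

theorem contMDiff_tCoord : ContMDiff cylModel 𝓘(ℝ, ℝ) ∞ (tCoord : Cyl a b P → ℝ) :=
  contMDiff_subtype_val.comp contMDiff_fst

theorem tCoord_mem (x : Cyl a b P) : tCoord x ∈ Ioo a b := x.1.2

end Coordinate

section CircleBundleFrame

variable {B : Type*} [TopologicalSpace B] [ChartedSpace (EuclideanSpace ℝ (Fin 2)) B]
  [IsManifold (𝓡 2) ∞ B]
  {P : Type*} [TopologicalSpace P] [ChartedSpace (EuclideanSpace ℝ (Fin 3)) P]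
  [IsManifold (𝓡 3) ∞ P] [MulAction Circle P]

/-- The generator of the circle action is vertical and `θ` takes the value `1` on it. -/
theorem exists_generator {p : P → B} (hp : IsCircleBundle p)
    {θ : Π q : P, TangentSpace (𝓡 3) q →L[ℝ] ℝ} (hθ : IsConnectionForm θ) (q : P) :
    ∃ ζ : TangentSpace (𝓡 3) q, mfderiv (𝓡 3) (𝓡 2) p q ζ = 0 ∧ θ q ζ = 1 := by
  have := hp.smooth_action
  let γ : ℝ → P := fun s ↦ Circle.exp s • q
  have hγ : ContMDiff 𝓘(ℝ, ℝ) (𝓡 3) ∞ γ :=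
    (ContMDiffSMul.contMDiff_smul (I := 𝓡 1) (I' := 𝓡 3) (n := ∞) (G := Circle) (M := P)).comp
      (contMDiff_circleExp.prodMk contMDiff_const)
  have hc : p ∘ γ = fun _ ↦ p q := by
    ext s
    exact ((hp.fibres q (γ s)).2 ⟨Circle.exp s, rfl⟩).symm
  have h1 := mfderiv_comp (I' := 𝓡 3) (0 : ℝ) (hp.smooth.mdifferentiable (by simp) (γ 0))
    (hγ.mdifferentiable (by simp) 0)
  rw [hc, mfderiv_const] at h1
  -- The orbit lies in one fibre, so its velocity is vertical. That velocity sits at exp 0 • q,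
  -- which equals q only propositionally; hence the existential statement, which can be transported
  -- by rewriting.
  have h2 : ∃ ζ : TangentSpace (𝓡 3) (Circle.exp 0 • q),
      mfderiv (𝓡 3) (𝓡 2) p (Circle.exp 0 • q) ζ = 0 ∧ θ (Circle.exp 0 • q) ζ = 1 :=
    ⟨mfderiv 𝓘(ℝ, ℝ) (𝓡 3) γ 0 (1 : ℝ), (congrArg (fun L ↦ L (1 : ℝ)) h1).symm, hθ.generator q⟩
  have h3 : Circle.exp 0 • q = q := by rw [Circle.exp_zero, one_smul]
  rwa [h3] at h2

/-- The connection form and the differential of the projection separate tangent vectors. -/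
theorem eq_zero_of_connection {p : P → B} (hp : IsCircleBundle p)
    {θ : Π q : P, TangentSpace (𝓡 3) q →L[ℝ] ℝ} (hθ : IsConnectionForm θ) {q : P}
    {v : TangentSpace (𝓡 3) q} (hv : θ q v = 0) (hpv : mfderiv (𝓡 3) (𝓡 2) p q v = 0) : v = 0 := by
  obtain ⟨ζ, hζ, hθζ⟩ := exists_generator hp hθ q
  let L : EuclideanSpace ℝ (Fin 3) →ₗ[ℝ] EuclideanSpace ℝ (Fin 2) :=
    (mfderiv (𝓡 3) (𝓡 2) p q : EuclideanSpace ℝ (Fin 3) →L[ℝ] EuclideanSpace ℝ (Fin 2)).toLinearMap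
  have hL : Function.Surjective L := hp.submersion q
  have h1 := L.finrank_range_add_finrank_ker
  rw [LinearMap.range_eq_top.2 hL, finrank_top] at h1
  simp only [finrank_euclideanSpace, Fintype.card_fin] at h1
  -- The vertical space has dimension 3 - 2 = 1 and is spanned by the generator ζ, on which θ does
  -- not vanish.
  have h2 : Module.finrank ℝ L.ker = 1 := by omega
  have hζ0 : (⟨ζ, hζ⟩ : L.ker) ≠ 0 := by
    intro h
    have h3 : ζ = 0 := congrArg Subtype.val h
    rw [h3, map_zero] at hθζ
    exact zero_ne_one hθζ
  obtain ⟨r, hr⟩ := (finrank_eq_one_iff_of_nonzero' (⟨ζ, hζ⟩ : L.ker) hζ0).1 h2 ⟨v, hpv⟩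
  have hr' : r • ζ = v := congrArg Subtype.val hr
  have h4 : θ q v = r := by rw [← hr', map_smul, hθζ, smul_eq_mul, mul_one]
  rw [← hr', ← h4, hv, zero_smul]

variable (h : ContMDiffRiemannianMetric (𝓡 2) ∞ (EuclideanSpace ℝ (Fin 2))
      (TangentSpace (𝓡 2) : B → Type _))

/-- The coframe `θ, p^* w_0^♭, p^* w_1^♭` of a circle bundle with connection. -/
noncomputable def bundleCoframe (p : P → B) (θ : Π q : P, TangentSpace (𝓡 3) q →L[ℝ] ℝ)
    (w : Fin 2 → Π y : B, TangentSpace (𝓡 2) y) :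
    Fin 3 → Π q : P, TangentSpace (𝓡 3) q →L[ℝ] ℝ :=
  ![θ, fun q ↦ (h.inner (p q) (w 0 (p q))).comp (mfderiv (𝓡 3) (𝓡 2) p q),
    fun q ↦ (h.inner (p q) (w 1 (p q))).comp (mfderiv (𝓡 3) (𝓡 2) p q)]

/-- The elementary skew-symmetric matrix. -/
def skew {n : ℕ} (a b i j : Fin n) : ℝ :=
  (if i = a ∧ j = b then 1 else 0) - (if i = b ∧ j = a then 1 else 0)

/-- The horizontal lifts of a local orthonormal frame, together with the generator of the action,
and their Lie brackets. -/
theorem exists_bundle_frame {j : Π y : B, TangentSpace (𝓡 2) y →L[ℝ] TangentSpace (𝓡 2) y}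
    {p : P → B} (hp : IsCircleBundle p) {θ : Π q : P, TangentSpace (𝓡 3) q →L[ℝ] ℝ}
    (hθ : IsConnectionForm θ) {c : ℝ} (hc : HasCurvatureForm h.inner j p θ c) {V : Set B}
    {w : Fin 2 → Π y : B, TangentSpace (𝓡 2) y} {a : Fin 2 → B → ℝ}
    (hw : IsOrthonormalFrame h.inner V w (fun i y ↦ h.inner y (w i y)))
    (hjw : ∀ y ∈ V, j y (w 0 y) = w 1 y) (hjw' : ∀ y ∈ V, j y (w 1 y) = -w 0 y)
    (hbr : ∀ k, ∀ y ∈ V, h.inner y (w k y) (VectorField.mlieBracket (𝓡 2) (w 0) (w 1) y) = - a k y) :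
    ∃ f : Fin 3 → Π q : P, TangentSpace (𝓡 3) q,
      IsFrame (p ⁻¹' V) f (bundleCoframe h p θ w) ∧
      (∀ q ∈ p ⁻¹' V, ∀ i, mfderiv (𝓡 3) (𝓡 2) p q (f i q) =
        (![fun _ ↦ 0, w 0, w 1] : Fin 3 → Π y : B, TangentSpace (𝓡 2) y) i (p q)) ∧
      ∀ q ∈ p ⁻¹' V, ∀ i k l, bundleCoframe h p θ w l q (VectorField.mlieBracket (𝓡 3) (f i) (f k) q) =
        skew 1 2 i k * (![-c, -a 0 (p q), -a 1 (p q)] : Fin 3 → ℝ) l := by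
  have hO : IsOpen (p ⁻¹' V) := hw.isOpen.preimage hp.smooth.continuous
  have hsm : ∀ i, SmoothForm (bundleCoframe h p θ w i) (p ⁻¹' V) := by
    intro i
    fin_cases i
    · exact fun U X hU _ hX ↦ hθ.smooth U X hU hX
    · exact (hw.form 0).pullback hw.isOpen hp.smooth
    · exact (hw.form 1).pullback hw.isOpen hp.smooth
  obtain ⟨f, hf⟩ := exists_isFrame (by simp) hO hsm fun q hq v hv ↦ by
    refine eq_zero_of_connection hp hθ (hv 0) (hw.ext hq fun i ↦ ?_)
    rw [map_zero]
    fin_cases i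
    · exact hv 1
    · exact hv 2
  -- The first frame field is vertical, hence p-related to zero. All three fields are thus p-related
  -- to fields on the surface, and the horizontal part of their brackets comes from there.
  let w' : Fin 3 → Π y : B, TangentSpace (𝓡 2) y := ![fun _ ↦ 0, w 0, w 1]
  have hw's : ∀ i, SmoothField (w' i) V := by
    intro i
    fin_cases i
    · have h0 : SmoothField (fun y ↦ (0 : ℝ) • w 0 y) V :=
        SmoothField.smul contMDiffOn_const (hw.smooth 0)
      exact h0.congr fun y _ ↦ (zero_smul ℝ (w 0 y)).symm
    · exact hw.smooth 0
    · exact hw.smooth 1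
  have hww' : ∀ y ∈ V, ∀ k i, h.inner y (w k y) (w' i y) = if k.succ = i then 1 else 0 := by
    intro y hy k i
    have hd := hw.dual y hy
    fin_cases i
    · exact (map_zero _).trans (if_neg (Fin.succ_ne_zero k)).symm
    · exact (hd k 0).trans (by fin_cases k <;> rfl)
    · exact (hd k 1).trans (by fin_cases k <;> rfl)
  have hrel : ∀ q ∈ p ⁻¹' V, ∀ i, mfderiv (𝓡 3) (𝓡 2) p q (f i q) = w' i (p q) := by
    intro q hq i
    refine hw.ext hq fun k ↦ ?_
    have h1 := hf.dual q hq k.succ i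
    rw [hww' _ hq, ← h1]
    fin_cases k <;> rfl
  refine ⟨f, hf, hrel, fun q hq i k l ↦ ?_⟩
  have hpb : mfderiv (𝓡 3) (𝓡 2) p q (VectorField.mlieBracket (𝓡 3) (f i) (f k) q) =
      VectorField.mlieBracket (𝓡 2) (w' i) (w' k) (p q) :=
    mfderiv_mlieBracket hO hw.isOpen hp.smooth.contMDiffOn (fun _ h ↦ h) (hf.smooth i) (hf.smooth k)
      (hw's i) (hw's k) (fun q hq ↦ hrel q hq i) (fun q hq ↦ hrel q hq k) hq
  have hbase : ∀ m, h.inner (p q) (w m (p q)) (VectorField.mlieBracket (𝓡 2) (w' i) (w' k) (p q)) =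
      skew 1 2 i k * -a m (p q) := by
    intro m
    have z1 : ∀ X : Π y : B, TangentSpace (𝓡 2) y,
        VectorField.mlieBracket (𝓡 2) (fun _ ↦ 0) X (p q) = 0 := fun X ↦
      congrFun (VectorField.mlieBracket_zero_left (I := 𝓡 2) (W := X)) (p q)
    have z2 : ∀ X : Π y : B, TangentSpace (𝓡 2) y,
        VectorField.mlieBracket (𝓡 2) X (fun _ ↦ 0) (p q) = 0 := fun X ↦
      congrFun (VectorField.mlieBracket_zero_right (I := 𝓡 2) (W := X)) (p q)
    have z3 : ∀ X : Π y : B, TangentSpace (𝓡 2) y,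
        VectorField.mlieBracket (𝓡 2) X X (p q) = 0 := fun X ↦
      congrFun (VectorField.mlieBracket_self (I := 𝓡 2) (V := X)) (p q)
    have z4 : VectorField.mlieBracket (𝓡 2) (w 1) (w 0) (p q) =
        -VectorField.mlieBracket (𝓡 2) (w 0) (w 1) (p q) := VectorField.mlieBracket_swap_apply
    have hs : VectorField.mlieBracket (𝓡 2) (w' i) (w' k) (p q) =
        skew 1 2 i k • VectorField.mlieBracket (𝓡 2) (w 0) (w 1) (p q) := by
      fin_cases i <;> fin_cases k
      · exact (z3 _).trans (by simp [skew])
      · exact (z1 _).trans (by simp [skew])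
      · exact (z1 _).trans (by simp [skew])
      · exact (z2 _).trans (by simp [skew])
      · exact (z3 _).trans (by simp [skew])
      · exact (one_smul ℝ _).symm.trans (by simp [skew]; rfl)
      · exact (z2 _).trans (by simp [skew])
      · exact z4.trans (by simp [skew])
      · exact (z3 _).trans (by simp [skew])
    rw [hs, map_smul, hbr m (p q) hq, smul_eq_mul]
  fin_cases l
  -- Since θ is constant on the frame fields, dθ(f i, f k) = -θ([f i, f k]), and the curvature form
  -- gives the vertical part of the bracket.
  · have h1 := hc (p ⁻¹' V) (f i) (f k) hO (hf.smooth i) (hf.smooth k) q hq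
    have h2 : ∀ (i : Fin 3) (v : TangentSpace (𝓡 3) q), dfun (fun q' ↦ θ q' (f i q')) q v = 0 :=
        fun i v ↦ by
      rw [dfun_congr (u := fun q' ↦ θ q' (f i q')) (v := fun _ ↦ if (0 : Fin 3) = i then (1 : ℝ) else 0)
        (Filter.eventually_of_mem (hO.mem_nhds hq) fun y hy ↦ hf.dual y hy 0 i), dfun_const]
    rw [h2, h2, hrel q hq, hrel q hq] at h1
    change θ q _ = skew 1 2 i k * (-c)
    have h3 : h.inner (p q) (j (p q) (w' i (p q))) (w' k (p q)) = skew 1 2 i k := by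
      have hj' : j (p q) (w' i (p q)) =
          (if i = 1 then (1 : ℝ) else 0) • w 1 (p q) - (if i = 2 then (1 : ℝ) else 0) • w 0 (p q) := by
        fin_cases i
        · exact (map_zero _).trans (by simp)
        · exact (hjw (p q) hq).trans (by simp)
        · exact (hjw' (p q) hq).trans (by simp)
      rw [hj', map_sub, map_smul, map_smul, sub_apply,
        smul_apply, smul_apply, hww' _ hq, hww' _ hq]
      fin_cases i <;> fin_cases k <;> simp [skew]
    change _ = c * h.inner (p q) (j (p q) (w' i (p q))) (w' k (p q)) at h1
    rw [h3] at h1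
    linarith
  · exact (congrArg (h.inner (p q) (w 0 (p q))) hpb).trans (hbase 0)
  · exact (congrArg (h.inner (p q) (w 1 (p q))) hpb).trans (hbase 1)

/-! ### The product with an interval -/

variable {a b : ℝ}

/-- The coframe `dt, θ, p^* w_0^♭, p^* w_1^♭`. -/
noncomputable def cylCoframe (p : P → B) (θ : Π q : P, TangentSpace (𝓡 3) q →L[ℝ] ℝ)
    (w : Fin 2 → Π y : B, TangentSpace (𝓡 2) y) :
    Fin 4 → Π x : Cyl a b P, TangentSpace cylModel x →L[ℝ] ℝ :=
  ![dt, thetaForm θ, fun x ↦ (h.inner (p x.2) (w 0 (p x.2))).comp (dproj p x),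
    fun x ↦ (h.inner (p x.2) (w 1 (p x.2))).comp (dproj p x)]

theorem dproj_eq {p : P → B} (hp : IsCircleBundle p) (x : Cyl a b P) (v : TangentSpace cylModel x) :
    dproj p x v = mfderiv (𝓡 3) (𝓡 2) p x.2 (mfderiv cylModel (𝓡 3) (Prod.snd : Cyl a b P → P) x v) := by
  have h1 := mfderiv_comp (I := cylModel) (I' := 𝓡 3) (I'' := 𝓡 2) x
    (hp.smooth.mdifferentiable (by simp) x.2) (mdifferentiableAt_snd (I := 𝓘(ℝ, ℝ)) (I' := 𝓡 3))
  exact congrArg (fun L ↦ L v) h1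

theorem cylCoframe_succ {p : P → B} (hp : IsCircleBundle p)
    (θ : Π q : P, TangentSpace (𝓡 3) q →L[ℝ] ℝ) (w : Fin 2 → Π y : B, TangentSpace (𝓡 2) y)
    (k : Fin 3) (x : Cyl a b P) (v : TangentSpace cylModel x) :
    cylCoframe h p θ w k.succ x v =
      bundleCoframe h p θ w k x.2 (mfderiv cylModel (𝓡 3) (Prod.snd : Cyl a b P → P) x v) := by
  fin_cases k
  · rfl
  · exact congrArg (h.inner (p x.2) (w 0 (p x.2))) (dproj_eq hp x v)
  · exact congrArg (h.inner (p x.2) (w 1 (p x.2))) (dproj_eq hp x v)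

theorem eq_zero_of_dt {x : Cyl a b P} {v : TangentSpace cylModel x} (hv : dt x v = 0)
    (hv' : mfderiv cylModel (𝓡 3) (Prod.snd : Cyl a b P → P) x v = 0) : v = 0 := by
  have h1 : ContMDiff 𝓘(ℝ, ℝ) 𝓘(ℝ, ℝ) ∞
      (Subtype.val : (⟨Ioo a b, isOpen_Ioo⟩ : TopologicalSpace.Opens ℝ) → ℝ) :=
    contMDiff_subtype_val
  have h2 := mfderiv_comp (I := cylModel) (I' := 𝓘(ℝ, ℝ)) x (h1.mdifferentiable (by simp) x.1)
    (mdifferentiableAt_fst (I := 𝓘(ℝ, ℝ)) (I' := 𝓡 3))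
  have h3 : dt x v = mfderiv 𝓘(ℝ, ℝ) 𝓘(ℝ, ℝ) (Subtype.val :
      (⟨Ioo a b, isOpen_Ioo⟩ : TopologicalSpace.Opens ℝ) → ℝ) x.1
      (mfderiv cylModel 𝓘(ℝ, ℝ) Prod.fst x v) := congrArg (fun L ↦ L v) h2
  rw [mfderiv_fst] at h3
  rw [mfderiv_snd] at hv'
  have h4 : mfderiv 𝓘(ℝ, ℝ) 𝓘(ℝ, ℝ) (Subtype.val :
      (⟨Ioo a b, isOpen_Ioo⟩ : TopologicalSpace.Opens ℝ) → ℝ) x.1 v.1 = 0 := h3.symm.trans hv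
  -- The inclusion of the interval is its own chart, so its differential is injective.
  have h5 : (Subtype.val : (⟨Ioo a b, isOpen_Ioo⟩ : TopologicalSpace.Opens ℝ) → ℝ) =
      extChartAt 𝓘(ℝ, ℝ) x.1 := by
    ext y
    rfl
  have h6 : Function.Injective (mfderiv 𝓘(ℝ, ℝ) 𝓘(ℝ, ℝ) (Subtype.val :
      (⟨Ioo a b, isOpen_Ioo⟩ : TopologicalSpace.Opens ℝ) → ℝ) x.1) := by
    rw [h5]
    exact (isInvertible_mfderiv_extChartAt (mem_extChartAt_source x.1)).injective
  have h7 : v.1 = 0 := h6 (h4.trans (map_zero _).symm)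
  exact Prod.ext h7 hv'

end CircleBundleFrame

section BracketSmul

variable {E : Type*} [NormedAddCommGroup E] [NormedSpace ℝ E] [FiniteDimensional ℝ E]
  {H : Type*} [TopologicalSpace H] {I : ModelWithCorners ℝ E H}
  {M : Type*} [TopologicalSpace M] [ChartedSpace H M] [IsManifold I ∞ M]

theorem mlieBracket_smul_smul {u v : M → ℝ} {X Y : Π x : M, TangentSpace I x} {x : M}
    (hu : MDifferentiableAt I 𝓘(ℝ, ℝ) u x) (hv : MDifferentiableAt I 𝓘(ℝ, ℝ) v x)
    (hX : DiffFieldAt X x) (hY : DiffFieldAt Y x) :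
    VectorField.mlieBracket I (fun y ↦ u y • X y) (fun y ↦ v y • Y y) x =
      (u x * dfun v x (X x)) • Y x - (v x * dfun u x (Y x)) • X x
        + (u x * v x) • VectorField.mlieBracket I X Y x := by
  have h1 : VectorField.mlieBracket I (fun y ↦ u y • X y) Y x =
      u x • VectorField.mlieBracket I X Y x - dfun u x (Y x) • X x := by
    rw [VectorField.mlieBracket_swap_apply, mlieBracket_smul_right' hu hX,
      VectorField.mlieBracket_swap_apply (V := Y) (W := X)]
    module
  rw [mlieBracket_smul_right' hv hY, h1, map_smul, smul_eq_mul]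
  module

end BracketSmul

section CylFrame

variable {B : Type*} [TopologicalSpace B] [ChartedSpace (EuclideanSpace ℝ (Fin 2)) B]
  [IsManifold (𝓡 2) ∞ B]
  {P : Type*} [TopologicalSpace P] [ChartedSpace (EuclideanSpace ℝ (Fin 3)) P]
  [IsManifold (𝓡 3) ∞ P] [MulAction Circle P] {a b : ℝ}
  (h : ContMDiffRiemannianMetric (𝓡 2) ∞ (EuclideanSpace ℝ (Fin 2))
      (TangentSpace (𝓡 2) : B → Type _))

/-- The local frame of `(a, b) × P` given by `∂_t` and a local frame of `P`. -/
theorem exists_cyl_frame {j : Π y : B, TangentSpace (𝓡 2) y →L[ℝ] TangentSpace (𝓡 2) y}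
    {p : P → B} (hp : IsCircleBundle p) {θ : Π q : P, TangentSpace (𝓡 3) q →L[ℝ] ℝ}
    (hθ : IsConnectionForm θ) {c : ℝ} (hc : HasCurvatureForm h.inner j p θ c) {V : Set B}
    {w : Fin 2 → Π y : B, TangentSpace (𝓡 2) y} {κ : Fin 2 → B → ℝ}
    (hw : IsOrthonormalFrame h.inner V w (fun i y ↦ h.inner y (w i y)))
    (hjw : ∀ y ∈ V, j y (w 0 y) = w 1 y) (hjw' : ∀ y ∈ V, j y (w 1 y) = -w 0 y)
    (hbr : ∀ k, ∀ y ∈ V, h.inner y (w k y) (VectorField.mlieBracket (𝓡 2) (w 0) (w 1) y) = - κ k y) :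
    ∃ F : Fin 4 → Π x : Cyl a b P, TangentSpace cylModel x,
      IsFrame {x | p x.2 ∈ V} F (cylCoframe h p θ w) ∧
      (∀ x : Cyl a b P, p x.2 ∈ V → ∀ i, dproj p x (F i x) =
        (![fun _ ↦ 0, fun _ ↦ 0, w 0, w 1] : Fin 4 → Π y : B, TangentSpace (𝓡 2) y) i (p x.2)) ∧
      ∀ x : Cyl a b P, p x.2 ∈ V → ∀ i k l,
        cylCoframe h p θ w l x (VectorField.mlieBracket cylModel (F i) (F k) x) =
          skew 2 3 i k * (![0, -c, -κ 0 (p x.2), -κ 1 (p x.2)] : Fin 4 → ℝ) l := by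
  obtain ⟨f, hf, hpf, hfbr⟩ := exists_bundle_frame h hp hθ hc hw hjw hjw' hbr
  have hO : IsOpen {x : Cyl a b P | p x.2 ∈ V} := hf.isOpen.preimage continuous_snd
  have hsucc := cylCoframe_succ (a := a) (b := b) h hp θ w
  have hsnd : ContMDiff cylModel (𝓡 3) ∞ (Prod.snd : Cyl a b P → P) := contMDiff_snd
  have hsm : ∀ i, SmoothForm (cylCoframe h p θ w i) {x : Cyl a b P | p x.2 ∈ V} := by
    intro i
    refine Fin.cases ?_ (fun k ↦ ?_) i
    · exact smoothForm_dfun contMDiff_tCoord.contMDiffOn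
    · have h1 := (hf.form k).pullback hf.isOpen hsnd
      intro U X hU hUV hX
      exact (h1 U X hU hUV hX).congr fun x _ ↦ hsucc k x (X x)
  obtain ⟨F, hF⟩ := exists_isFrame (by simp) hO hsm fun x hx v hv ↦ by
    refine eq_zero_of_dt (hv 0) (hf.ext (x := x.2) hx fun k ↦ ?_)
    rw [map_zero, ← hsucc]
    exact hv k.succ
  let f' : Fin 4 → Π q : P, TangentSpace (𝓡 3) q := Fin.cons (fun _ ↦ 0) f
  have hf's : ∀ i, SmoothField (f' i) (p ⁻¹' V) := by
    intro i
    refine Fin.cases ?_ (fun k ↦ ?_) i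
    · have h0 : SmoothField (fun y ↦ (0 : ℝ) • f 0 y) (p ⁻¹' V) :=
        SmoothField.smul contMDiffOn_const (hf.smooth 0)
      exact h0.congr fun y _ ↦ (zero_smul ℝ (f 0 y)).symm
    · exact hf.smooth k
  have hrel : ∀ x ∈ {x : Cyl a b P | p x.2 ∈ V}, ∀ i,
      mfderiv cylModel (𝓡 3) (Prod.snd : Cyl a b P → P) x (F i x) = f' i x.2 := by
    intro x hx i
    refine hf.ext (x := x.2) hx fun k ↦ ?_
    rw [← hsucc, hF.dual x hx k.succ i]
    refine Fin.cases ?_ (fun m ↦ ?_) i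
    · exact (if_neg (Fin.succ_ne_zero k)).trans (map_zero _).symm
    · exact (if_congr Fin.succ_inj rfl rfl).trans (hf.dual x.2 hx k m).symm
  refine ⟨F, hF, fun x hx i ↦ ?_, fun x hx i k l ↦ ?_⟩
  · rw [dproj_eq hp, hrel x hx]
    refine Fin.cases ?_ (fun m ↦ ?_) i
    · exact map_zero _
    · refine (hpf x.2 hx m).trans ?_
      fin_cases m <;> rfl
  refine Fin.cases ?_ (fun m ↦ ?_) l
  -- The form dt is exact and constant on the frame, so it annihilates all brackets.
  · have h1 := dfun_mlieBracket hO (contMDiff_tCoord (a := a) (b := b) (P := P)).contMDiffOn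
      (hF.smooth i) (hF.smooth k) hx
    have h2 : ∀ (i : Fin 4) (v : TangentSpace cylModel x),
        dfun (fun y ↦ dfun (tCoord : Cyl a b P → ℝ) y (F i y)) x v = 0 := fun i v ↦ by
      rw [dfun_congr (u := fun y ↦ dfun (tCoord : Cyl a b P → ℝ) y (F i y))
        (v := fun _ ↦ if (0 : Fin 4) = i then (1 : ℝ) else 0)
        (Filter.eventually_of_mem (hO.mem_nhds hx) fun y hy ↦ hF.dual y hy 0 i), dfun_const]
    rw [h2, h2, sub_zero] at h1
    exact h1.trans (mul_zero _).symm
  · rw [hsucc]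
    have hpb : mfderiv cylModel (𝓡 3) (Prod.snd : Cyl a b P → P) x
        (VectorField.mlieBracket cylModel (F i) (F k) x) =
        VectorField.mlieBracket (𝓡 3) (f' i) (f' k) x.2 :=
      mfderiv_mlieBracket hO hf.isOpen hsnd.contMDiffOn (fun _ h ↦ h) (hF.smooth i) (hF.smooth k)
        (hf's i) (hf's k) (fun x hx ↦ hrel x hx i) (fun x hx ↦ hrel x hx k) hx
    rw [hpb]
    have z1 : ∀ X : Π y : P, TangentSpace (𝓡 3) y,
        VectorField.mlieBracket (𝓡 3) (fun _ ↦ 0) X x.2 = 0 := fun X ↦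
      congrFun (VectorField.mlieBracket_zero_left (I := 𝓡 3) (W := X)) x.2
    have z2 : ∀ X : Π y : P, TangentSpace (𝓡 3) y,
        VectorField.mlieBracket (𝓡 3) X (fun _ ↦ 0) x.2 = 0 := fun X ↦
      congrFun (VectorField.mlieBracket_zero_right (I := 𝓡 3) (W := X)) x.2
    have hm : (![0, -c, -κ 0 (p x.2), -κ 1 (p x.2)] : Fin 4 → ℝ) m.succ =
        (![-c, -κ 0 (p x.2), -κ 1 (p x.2)] : Fin 3 → ℝ) m := rfl
    rw [hm]
    refine Fin.cases ?_ (fun i ↦ ?_) i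
    · have h3 : skew 2 3 (0 : Fin 4) k = 0 := by simp [skew]
      rw [h3, zero_mul]
      exact (congrArg _ (z1 _)).trans (map_zero _)
    refine Fin.cases ?_ (fun k ↦ ?_) k
    · have h3 : skew 2 3 i.succ (0 : Fin 4) = 0 := by simp [skew]
      rw [h3, zero_mul]
      exact (congrArg _ (z2 _)).trans (map_zero _)
    refine (hfbr x.2 hx i k m).trans ?_
    have h3 : skew 2 3 i.succ k.succ = skew 1 2 i k := by
      have e2 : (2 : Fin 4) = Fin.succ 1 := rfl
      have e3 : (3 : Fin 4) = Fin.succ 2 := rfl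
      simp only [skew, e2, e3, Fin.succ_inj]
    rw [h3]

/-- `partialT`, `thetaSharp` and `warpedJ` are defined through `inverse`, which would be zero for a
non-invertible map; this gives them their intended meaning. Injectivity suffices, as both sides have
dimension 4. -/
theorem isInvertible_coframe {p : P → B} (hp : IsCircleBundle p)
    {θ : Π q : P, TangentSpace (𝓡 3) q →L[ℝ] ℝ} (hθ : IsConnectionForm θ) {r : ℝ} (hr : r ≠ 0)
    (x : Cyl a b P) : (coframe p θ r x).IsInvertible := by
  let L : (ℝ × EuclideanSpace ℝ (Fin 3)) →L[ℝ] ℝ × ℝ × EuclideanSpace ℝ (Fin 2) := coframe p θ r x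
  have hinj : Function.Injective L := by
    refine (injective_iff_map_eq_zero L).2 fun v hv ↦ ?_
    have h1 : dt x v = 0 := congrArg Prod.fst hv
    have h2 : r * thetaForm θ x v = 0 := congrArg (fun z ↦ z.2.1) hv
    have h3 : dproj p x v = 0 := congrArg (fun z ↦ z.2.2) hv
    exact eq_zero_of_dt h1 (eq_zero_of_connection hp hθ ((mul_eq_zero.1 h2).resolve_left hr)
      ((dproj_eq hp x v).symm.trans h3))
  let eL := (LinearMap.linearEquivOfInjective L.toLinearMap hinj (by simp)).toContinuousLinearEquiv
  exact ⟨eL, ContinuousLinearMap.ext fun _ ↦ rfl⟩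

end CylFrame

/-! ### The orthonormal frame adapted to the warped metric. -/

section AdaptedFrame

variable {B : Type*} [TopologicalSpace B] [ChartedSpace (EuclideanSpace ℝ (Fin 2)) B]
  [IsManifold (𝓡 2) ∞ B]
  {P : Type*} [TopologicalSpace P] [ChartedSpace (EuclideanSpace ℝ (Fin 3)) P]
  [IsManifold (𝓡 3) ∞ P] {a b : ℝ}

/-- The connection coefficients of a warped metric in an adapted frame. -/
def warpedSymbol (p q s b₀ b₁ : ℝ) (i j k : Fin 4) : ℝ :=
  (if i = 1 then p * skew 0 1 j k + s * skew 2 3 j k else 0)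
    + (if i = 2 then q * skew 0 2 j k + s * skew 1 3 j k + b₀ * skew 2 3 j k else 0)
    + (if i = 3 then q * skew 0 3 j k - s * skew 1 2 j k + b₁ * skew 2 3 j k else 0)

theorem skew_swap {n : ℕ} (a b i j : Fin n) : skew a b j i = -skew a b i j := by
  simp only [skew, and_comm, neg_sub]

theorem warpedSymbol_antisymm (p q s b₀ b₁ : ℝ) (i j k : Fin 4) :
    warpedSymbol p q s b₀ b₁ i j k = -warpedSymbol p q s b₀ b₁ i k j := by
  unfold warpedSymbol
  simp only [skew_swap _ _ j k]
  split_ifs <;> ring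

/-- The left side is the k-th component of the bracket of the frame fields divided by the weights 1,
f, g, g, in the shape produced by `mlieBracket_smul_smul`. The vertical part -c f / g² of [e2, e3]
is shared equally by two connection coefficients, whence the 2 in s = c f / (2 g²). -/
theorem warpedSymbol_bracket {f g : ℝ} (hf : f ≠ 0) (hg : g ≠ 0) (f' g' c a₀ a₁ : ℝ) (i j k : Fin 4) :
    (![1, f, g, g] : Fin 4 → ℝ) k *
      (((![1, f, g, g] : Fin 4 → ℝ) i)⁻¹ * (-(![0, f', g', g'] : Fin 4 → ℝ) j /
          (![1, f, g, g] : Fin 4 → ℝ) j ^ 2 * if 0 = i then 1 else 0) * (if k = j then 1 else 0) -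
        ((![1, f, g, g] : Fin 4 → ℝ) j)⁻¹ * (-(![0, f', g', g'] : Fin 4 → ℝ) i /
          (![1, f, g, g] : Fin 4 → ℝ) i ^ 2 * if 0 = j then 1 else 0) * (if k = i then 1 else 0) +
        ((![1, f, g, g] : Fin 4 → ℝ) i)⁻¹ * ((![1, f, g, g] : Fin 4 → ℝ) j)⁻¹ *
          (skew 2 3 i j * (![0, -c, -a₀, -a₁] : Fin 4 → ℝ) k)) =
      warpedSymbol (f' / f) (g' / g) (c * f / (2 * g ^ 2)) (g⁻¹ * a₀) (g⁻¹ * a₁) i j k -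
        warpedSymbol (f' / f) (g' / g) (c * f / (2 * g ^ 2)) (g⁻¹ * a₀) (g⁻¹ * a₁) j i k := by
  fin_cases i <;> fin_cases j <;> fin_cases k <;> simp [warpedSymbol, skew] <;> field_simp <;> ring

/-- The connection coefficients of the metric `dt² + f² θ² + g² p^* h` at `x`. -/
noncomputable def cylSymbol (f g : ℝ → ℝ) (c : ℝ) (κ : Fin 2 → Cyl a b P → ℝ) (x : Cyl a b P)
    (i j k : Fin 4) : ℝ :=
  warpedSymbol (deriv f (tCoord x) / f (tCoord x)) (deriv g (tCoord x) / g (tCoord x))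
    (c * f (tCoord x) / (2 * g (tCoord x) ^ 2)) (κ 0 x) (κ 1 x) i j k

/-- A pair of smooth positive functions on `(a, b)`. -/
structure IsWarpPair (a b : ℝ) (f g : ℝ → ℝ) : Prop where
  smooth_f : ContDiffOn ℝ ∞ f (Ioo a b)
  smooth_g : ContDiffOn ℝ ∞ g (Ioo a b)
  pos_f : ∀ t ∈ Ioo a b, 0 < f t
  pos_g : ∀ t ∈ Ioo a b, 0 < g t

/-- An orthonormal frame `∂_t, f⁻¹ θ^♯, g⁻¹ W_0, g⁻¹ W_1`, where `W_0, W_1` are the horizontal lifts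
of a local orthonormal frame of the base.  The functions `κ` are the connection coefficients of the
latter, divided by `g`. -/
structure IsAdaptedFrame (h : Π y : B, TangentSpace (𝓡 2) y →L[ℝ] TangentSpace (𝓡 2) y →L[ℝ] ℝ)
    (j : Π y : B, TangentSpace (𝓡 2) y →L[ℝ] TangentSpace (𝓡 2) y)
    (p : P → B) (θ : Π q : P, TangentSpace (𝓡 3) q →L[ℝ] ℝ) (f g : ℝ → ℝ) (c K : ℝ)
    (V : Set (Cyl a b P)) (e : Fin 4 → Π x : Cyl a b P, TangentSpace cylModel x)
    (α : Fin 4 → Π x : Cyl a b P, TangentSpace cylModel x →L[ℝ] ℝ)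
    (κ : Fin 2 → Cyl a b P → ℝ) : Prop
    extends IsOrthonormalFrame (warpedMetric h p θ f g) V e α where
  warp : IsWarpPair a b f g
  form_zero : ∀ x ∈ V, ∀ v, α 0 x v = dt x v
  partialT_eq : ∀ x ∈ V, partialT p θ x = e 0 x
  thetaSharp_eq : ∀ x ∈ V, thetaSharp p θ x = f (tCoord x) • e 1 x
  warpedJ_apply : ∀ x ∈ V, ∀ (ε : ℝ) (v : TangentSpace cylModel x) (k : Fin 4),
    α k x (warpedJ j p θ f ε x v) =
      (![-(ε * α 1 x v), ε * α 0 x v, -α 3 x v, α 2 x v] : Fin 4 → ℝ) k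
  bracket : ∀ x ∈ V, ∀ i j k, α k x (VectorField.mlieBracket cylModel (e i) (e j) x) =
    cylSymbol f g c κ x i j k - cylSymbol f g c κ x j i k
  coeff : ∀ k, SmoothFn cylModel (κ k) V
  dcoeff_zero : ∀ x ∈ V, ∀ k, dfun (κ k) x (e 0 x) =
    -(deriv g (tCoord x) / g (tCoord x) * κ k x)
  dcoeff_one : ∀ x ∈ V, ∀ k, dfun (κ k) x (e 1 x) = 0
  dcoeff : ∀ x ∈ V, dfun (κ 0) x (e 3 x) - dfun (κ 1) x (e 2 x) =
    K / g (tCoord x) ^ 2 + κ 0 x ^ 2 + κ 1 x ^ 2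

theorem smoothFn_comp_tCoord {φ : ℝ → ℝ} (hφ : ContDiffOn ℝ ∞ φ (Ioo a b)) :
    SmoothFn cylModel (fun x : Cyl a b P ↦ φ (tCoord x)) univ :=
  hφ.contMDiffOn.comp (t := Ioo a b) contMDiff_tCoord.contMDiffOn fun x _ ↦ tCoord_mem x

theorem dfun_comp_tCoord {φ : ℝ → ℝ} (hφ : ContDiffOn ℝ ∞ φ (Ioo a b)) (x : Cyl a b P)
    (v : TangentSpace cylModel x) :
    dfun (fun y : Cyl a b P ↦ φ (tCoord y)) x v = deriv φ (tCoord x) * dt x v :=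
  dfun_comp_real ((hφ.differentiableOn (by simp)).differentiableAt
    (isOpen_Ioo.mem_nhds (tCoord_mem x))) (contMDiff_tCoord.mdifferentiable (by simp) x) v

variable [MulAction Circle P]

/-- Dividing the frame of `exists_cyl_frame` by 1, f, g, g makes it orthonormal for the warped
metric. After this, only the data recorded in `IsAdaptedFrame` are needed about the bundle and the
surface. -/
theorem exists_adapted_frame (h : ContMDiffRiemannianMetric (𝓡 2) ∞ (EuclideanSpace ℝ (Fin 2))
      (TangentSpace (𝓡 2) : B → Type _))
    {j : Π y : B, TangentSpace (𝓡 2) y →L[ℝ] TangentSpace (𝓡 2) y}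
    (hj : IsHermitianStructure h.inner j) {K : ℝ} (hK : HasConstantCurvature h.inner K)
    {p : P → B} (hp : IsCircleBundle p) {θ : Π q : P, TangentSpace (𝓡 3) q →L[ℝ] ℝ}
    (hθ : IsConnectionForm θ) {c : ℝ} (hc : HasCurvatureForm h.inner j p θ c) {f g : ℝ → ℝ}
    (hfg : IsWarpPair a b f g) (x₀ : Cyl a b P) :
    ∃ V e α κ, x₀ ∈ V ∧ IsAdaptedFrame h.inner j p θ f g c K V e α κ := by
  obtain ⟨hf, hg, hf_pos, hg_pos⟩ := hfg
  obtain ⟨V, w, a', hyV, hw, hjw, ha', hbr, hcurv⟩ := exists_surface_frame h hj hK (p x₀.2)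
  have hjw' : ∀ y ∈ V, j y (w 1 y) = -w 0 y := fun y hy ↦ by rw [← hjw y hy, hj.square]
  obtain ⟨F, hF, hpF, hFbr⟩ := exists_cyl_frame (a := a) (b := b) h hp hθ hc hw hjw hjw' hbr
  let φ : Fin 4 → ℝ → ℝ := ![fun _ ↦ 1, f, g, g]
  have hφ : ∀ i, ContDiffOn ℝ ∞ (φ i) (Ioo a b) := by
    intro i
    fin_cases i
    exacts [contDiffOn_const, hf, hg, hg]
  have hφ0 : ∀ i, ∀ t ∈ Ioo a b, φ i t ≠ 0 := by
    intro i t ht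
    fin_cases i
    exacts [one_ne_zero, (hf_pos t ht).ne', (hg_pos t ht).ne', (hg_pos t ht).ne']
  have hψ : ∀ i, ContDiffOn ℝ ∞ (fun t ↦ (φ i t)⁻¹) (Ioo a b) := fun i ↦ (hφ i).inv (hφ0 i)
  have hφs : ∀ i U, SmoothFn cylModel (fun x : Cyl a b P ↦ φ i (tCoord x)) U := fun i U ↦
    (smoothFn_comp_tCoord (hφ i)).mono (subset_univ U)
  have hψs : ∀ i U, SmoothFn cylModel (fun x : Cyl a b P ↦ (φ i (tCoord x))⁻¹) U := fun i U ↦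
    (smoothFn_comp_tCoord (hψ i)).mono (subset_univ U)
  let e : Fin 4 → Π x : Cyl a b P, TangentSpace cylModel x := fun i x ↦ (φ i (tCoord x))⁻¹ • F i x
  let β := cylCoframe (a := a) (b := b) h p θ w
  let α : Fin 4 → Π x : Cyl a b P, TangentSpace cylModel x →L[ℝ] ℝ := fun i x ↦ φ i (tCoord x) • β i x
  have hα : ∀ i x v, α i x v = φ i (tCoord x) * β i x v := fun i x v ↦ rfl
  have he : IsFrame {x : Cyl a b P | p x.2 ∈ V} e α := by
    refine isFrame_of_dual (by simp) hF.isOpen (fun i ↦ (hF.form i).smul (hφs i _)) ?_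
    intro x hx i k
    rw [hα, map_smul, hF.dual x hx, smul_eq_mul, mul_ite, mul_one, mul_zero, mul_ite, mul_zero]
    refine if_ctx_congr Iff.rfl (fun hik ↦ ?_) fun _ ↦ rfl
    rw [hik]
    exact mul_inv_cancel₀ (hφ0 k _ (tCoord_mem x))
  have hmet : ∀ x ∈ {x : Cyl a b P | p x.2 ∈ V}, ∀ v v' : TangentSpace cylModel x,
      warpedMetric h.inner p θ f g x v v' = ∑ i, α i x v * α i x v' := by
    intro x hx v v'
    have h1 := hw.metric (p x.2) hx (dproj p x v) (dproj p x v')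
    rw [Fin.sum_univ_two] at h1
    rw [Fin.sum_univ_four]
    change dt x v * dt x v' + f (tCoord x) ^ 2 * (thetaForm θ x v * thetaForm θ x v') +
      g (tCoord x) ^ 2 * h.inner (p x.2) (dproj p x v) (dproj p x v') =
      (1 * dt x v) * (1 * dt x v') + (f (tCoord x) * thetaForm θ x v) * (f (tCoord x) * thetaForm θ x v') +
      (g (tCoord x) * h.inner (p x.2) (w 0 (p x.2)) (dproj p x v)) *
        (g (tCoord x) * h.inner (p x.2) (w 0 (p x.2)) (dproj p x v')) +
      (g (tCoord x) * h.inner (p x.2) (w 1 (p x.2)) (dproj p x v)) *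
        (g (tCoord x) * h.inner (p x.2) (w 1 (p x.2)) (dproj p x v'))
    rw [h1]
    ring
  have hsnd : ContMDiff cylModel (𝓡 2) ∞ (fun x : Cyl a b P ↦ p x.2) := hp.smooth.comp contMDiff_snd
  have ha's : ∀ k, SmoothFn cylModel (fun x : Cyl a b P ↦ a' k (p x.2)) {x : Cyl a b P | p x.2 ∈ V} :=
    fun k ↦ (ha' k).comp hsnd.contMDiffOn fun x hx ↦ hx
  let κ : Fin 2 → Cyl a b P → ℝ := fun k x ↦ (g (tCoord x))⁻¹ * a' k (p x.2)
  have hκ : ∀ x : Cyl a b P, p x.2 ∈ V → ∀ k, ∀ v : TangentSpace cylModel x, dfun (κ k) x v =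
      (g (tCoord x))⁻¹ * dfun (a' k) (p x.2) (dproj p x v) +
        a' k (p x.2) * (-deriv g (tCoord x) / g (tCoord x) ^ 2 * dt x v) := by
    intro x hx k v
    have h1 : dfun (κ k) x v = _ := dfun_mul (u := fun x : Cyl a b P ↦ (g (tCoord x))⁻¹)
      (v := fun x ↦ a' k (p x.2))
      ((hψs 2 _).mdiffAt hF.isOpen hx) ((ha's k).mdiffAt hF.isOpen hx) v
    rw [h1, dfun_comp (F := fun x : Cyl a b P ↦ p x.2) ((ha' k).mdiffAt hw.isOpen hx)
      (hsnd.mdifferentiable (by simp) x)]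
    have h2 := dfun_comp_tCoord (hψ 2) x v
    have h3 : deriv (fun t ↦ (φ 2 t)⁻¹) (tCoord x) = -deriv g (tCoord x) / g (tCoord x) ^ 2 :=
      deriv_fun_inv'' (((hφ 2).differentiableOn (by simp)).differentiableAt
        (isOpen_Ioo.mem_nhds (tCoord_mem x))) (hφ0 2 _ (tCoord_mem x))
    rw [h3] at h2
    rw [← h2]
    rfl
  have hβ0 : ∀ x : Cyl a b P, p x.2 ∈ V → ∀ i, dt x (F i x) = if 0 = i then 1 else 0 :=
    fun x hx i ↦ hF.dual x hx 0 i
  have hdte : ∀ x : Cyl a b P, p x.2 ∈ V → ∀ i, dt x (e i x) = if 0 = i then 1 else 0 := by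
    intro x hx i
    rw [← he.dual x hx 0 i]
    exact (one_mul _).symm
  have hθe : ∀ x : Cyl a b P, p x.2 ∈ V → ∀ i, thetaForm θ x (e i x) =
      if 1 = i then (f (tCoord x))⁻¹ else 0 := by
    intro x hx i
    have h1 : f (tCoord x) * thetaForm θ x (e i x) = _ := he.dual x hx 1 i
    have h2 := (hf_pos _ (tCoord_mem x)).ne'
    rw [← mul_right_inj' h2, h1, mul_ite, mul_inv_cancel₀ h2, mul_zero]
  have hpe : ∀ x : Cyl a b P, p x.2 ∈ V → ∀ i, dproj p x (e i x) = (φ i (tCoord x))⁻¹ •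
      (![fun _ ↦ 0, fun _ ↦ 0, w 0, w 1] : Fin 4 → Π y : B, TangentSpace (𝓡 2) y) i (p x.2) :=
    fun x hx i ↦ (map_smul _ _ _).trans (congrArg _ (hpF x hx i))
  refine ⟨_, e, α, κ, hyV, { he with
    metric := hmet
    warp := ⟨hf, hg, hf_pos, hg_pos⟩
    form_zero := fun x _ v ↦ one_mul _
    partialT_eq := ?_, thetaSharp_eq := ?_, warpedJ_apply := ?_, bracket := ?_
    coeff := fun k ↦ (hψs 2 _).mul (ha's k)
    dcoeff_zero := ?_, dcoeff_one := ?_, dcoeff := ?_ }⟩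
  · intro x hx
    -- A vector defined by the inverse coframe is identified by its three slots dt, θ and dp.
    refine (isInvertible_coframe hp hθ one_ne_zero x).inverse_apply_eq.2 (Prod.ext ?_ (Prod.ext ?_ ?_))
    · exact (hdte x hx 0).symm
    · exact ((congrArg _ (hθe x hx 0)).trans (mul_zero _)).symm
    · exact ((hpe x hx 0).trans (smul_zero _)).symm
  · intro x hx
    refine (isInvertible_coframe hp hθ one_ne_zero x).inverse_apply_eq.2 ?_
    rw [map_smul]
    refine Prod.ext ?_ (Prod.ext ?_ ?_)
    · exact ((congrArg _ (hdte x hx 1)).trans (mul_zero _)).symm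
    · refine (mul_inv_cancel₀ (hf_pos _ (tCoord_mem x)).ne').symm.trans (congrArg _ ?_)
      exact (one_mul _).symm.trans (congrArg _ (hθe x hx 1).symm)
    · exact ((congrArg _ ((hpe x hx 1).trans (smul_zero _))).trans (smul_zero _)).symm
  · intro x hx ε v k
    -- The inverse coframe need not be computed: the conjugation formula becomes an intertwining
    -- relation, which is compared slot by slot. The horizontal slot uses that j is orthogonal and w
    -- 1 = j (w 0).
    have hJ : modelJ (j (p x.2)) ε (coframe p θ (f (tCoord x)) x v) =
        coframe p θ (f (tCoord x)) x (warpedJ j p θ f ε x v) :=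
      (isInvertible_coframe hp hθ (hf_pos _ (tCoord_mem x)).ne' x).inverse_apply_eq.1 rfl
    have h0 : -ε * (f (tCoord x) * thetaForm θ x v) = dt x (warpedJ j p θ f ε x v) :=
      congrArg Prod.fst hJ
    have h1 : ε * dt x v = f (tCoord x) * thetaForm θ x (warpedJ j p θ f ε x v) :=
      congrArg (fun z ↦ z.2.1) hJ
    have h2 : j (p x.2) (dproj p x v) = dproj p x (warpedJ j p θ f ε x v) :=
      congrArg (fun z ↦ z.2.2) hJ
    have h3 : h.inner (p x.2) (w 0 (p x.2)) (j (p x.2) (dproj p x v)) =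
        -h.inner (p x.2) (w 1 (p x.2)) (dproj p x v) := by
      rw [← hj.orthogonal, hj.square, hjw _ hx, map_neg]
    have h4 : h.inner (p x.2) (w 1 (p x.2)) (j (p x.2) (dproj p x v)) =
        h.inner (p x.2) (w 0 (p x.2)) (dproj p x v) := by
      rw [← hj.orthogonal, hj.square, hjw' _ hx, map_neg, map_neg, neg_apply, neg_neg]
    rw [h2] at h3 h4
    fin_cases k
    · change 1 * dt x _ = -(ε * (f (tCoord x) * thetaForm θ x v))
      rw [← h0]
      ring
    · change f (tCoord x) * thetaForm θ x _ = ε * (1 * dt x v)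
      rw [← h1]
      ring
    · change g (tCoord x) * h.inner (p x.2) (w 0 (p x.2)) (dproj p x _) =
        -(g (tCoord x) * h.inner (p x.2) (w 1 (p x.2)) (dproj p x v))
      rw [h3]
      ring
    · change g (tCoord x) * h.inner (p x.2) (w 1 (p x.2)) (dproj p x _) =
        g (tCoord x) * h.inner (p x.2) (w 0 (p x.2)) (dproj p x v)
      rw [h4]
  · intro x hx i k l
    have hx' : x ∈ {x : Cyl a b P | p x.2 ∈ V} := hx
    have hm : ∀ i, MDifferentiableAt cylModel 𝓘(ℝ, ℝ) (fun x : Cyl a b P ↦ (φ i (tCoord x))⁻¹) x :=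
      fun i ↦ (hψs i _).mdiffAt hF.isOpen hx'
    have h1 : VectorField.mlieBracket cylModel (e i) (e k) x = _ := mlieBracket_smul_smul (hm i) (hm k)
      ((hF.smooth i).diffAt hF.isOpen hx') ((hF.smooth k).diffAt hF.isOpen hx')
    have h2 : ∀ i (v : TangentSpace cylModel x),
        dfun (fun x : Cyl a b P ↦ (φ i (tCoord x))⁻¹) x v =
          -deriv (φ i) (tCoord x) / φ i (tCoord x) ^ 2 * dt x v := fun i v ↦ by
      rw [dfun_comp_tCoord (hψ i) x v]
      congr 1
      exact deriv_fun_inv'' (((hφ i).differentiableOn (by simp)).differentiableAt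
        (isOpen_Ioo.mem_nhds (tCoord_mem x))) (hφ0 i _ (tCoord_mem x))
    rw [hα, h1, map_add, map_sub, map_smul, map_smul, map_smul, hF.dual x hx', hF.dual x hx',
      hFbr x hx, h2, h2, hβ0 x hx, hβ0 x hx]
    have hf0 := hφ0 1 _ (tCoord_mem x)
    have hg0 := hφ0 2 _ (tCoord_mem x)
    have hd : ∀ i, deriv (φ i) (tCoord x) = (![0, deriv f (tCoord x), deriv g (tCoord x),
        deriv g (tCoord x)] : Fin 4 → ℝ) i := by
      intro i
      fin_cases i
      exacts [deriv_const _ _, rfl, rfl, rfl]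
    have hv : ∀ i, φ i (tCoord x) = (![1, f (tCoord x), g (tCoord x), g (tCoord x)] : Fin 4 → ℝ) i := by
      intro i
      fin_cases i <;> rfl
    simp only [hd, hv, smul_eq_mul]
    exact warpedSymbol_bracket hf0 hg0 _ _ c (a' 0 (p x.2)) (a' 1 (p x.2)) i k l
  · intro x hx k
    rw [hκ x hx, hdte x hx, hpe x hx]
    have hz : (dfun (I := 𝓡 2) (a' k) (p x.2)) ((φ 0 (tCoord x))⁻¹ • 0) = 0 := by rw [smul_zero, map_zero]
    refine (congrArg₂ (· + ·) (congrArg _ hz) rfl).trans ?_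
    have hg0 := (hg_pos _ (tCoord_mem x)).ne'
    simp only [κ, if_true]
    field_simp
    ring
  · intro x hx k
    rw [hκ x hx, hdte x hx, hpe x hx]
    have hz : (dfun (I := 𝓡 2) (a' k) (p x.2)) ((φ 1 (tCoord x))⁻¹ • 0) = 0 := by rw [smul_zero, map_zero]
    refine (congrArg₂ (· + ·) (congrArg _ hz) rfl).trans ?_
    simp
  · intro x hx
    have hg0 := (hg_pos _ (tCoord_mem x)).ne'
    have h3 : dfun (a' 0) (p x.2) (dproj p x (e 3 x)) =
        (g (tCoord x))⁻¹ * dfun (a' 0) (p x.2) (w 1 (p x.2)) := by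
      rw [hpe x hx]
      exact map_smul _ _ _
    have h2 : dfun (a' 1) (p x.2) (dproj p x (e 2 x)) =
        (g (tCoord x))⁻¹ * dfun (a' 1) (p x.2) (w 0 (p x.2)) := by
      rw [hpe x hx]
      exact map_smul _ _ _
    rw [hκ x hx, hκ x hx, hdte x hx, hdte x hx, h3, h2, ← hcurv (p x.2) hx]
    have e3 : (if (0 : Fin 4) = 3 then (1 : ℝ) else 0) = 0 := if_neg (by decide)
    have e2 : (if (0 : Fin 4) = 2 then (1 : ℝ) else 0) = 0 := if_neg (by decide)
    rw [e3, e2]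
    simp only [κ]
    field_simp
    ring

end AdaptedFrame

/-! ### Curvature and Ricci tensor of the warped metric. -/

section Algebra

/-- The curvature components of a warped metric in an adapted frame. -/
def warpedCurvature (φ η δ γ m : ℝ) (i j k l : Fin 4) : ℝ :=
  skew 0 1 k l * (φ * skew 0 1 i j + 2 * m * skew 2 3 i j)
    + skew 0 2 k l * (η * skew 0 2 i j + m * skew 1 3 i j)
    + skew 0 3 k l * (η * skew 0 3 i j - m * skew 1 2 i j)
    + skew 1 2 k l * (δ * skew 1 2 i j - m * skew 0 3 i j)
    + skew 1 3 k l * (δ * skew 1 3 i j + m * skew 0 2 i j)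
    + skew 2 3 k l * (2 * m * skew 0 1 i j - γ * skew 2 3 i j)

-- A check of all index values. The four entries are the derivatives of the coefficients along e0,
-- ..., e3: along e0 one has s' = s (p - 2 q) and the surface coefficients b scale by -q, along e1
-- nothing varies, and along e2, e3 only the b do. Those enter the result solely through the
-- combination v₀ - u₁ - b₀² - b₁², which is K / g².
set_option maxHeartbeats 4000000 in
theorem curvatureSymbol_warped (p q s b₀ b₁ p' q' u₀ u₁ v₀ v₁ : ℝ) (i j k l : Fin 4) :
    IsFrame.curvatureSymbol (warpedSymbol p q s b₀ b₁) (fun i ↦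
      (![warpedSymbol p' q' (s * (p - 2 * q)) (-(q * b₀)) (-(q * b₁)), warpedSymbol 0 0 0 0 0,
        warpedSymbol 0 0 0 u₀ u₁, warpedSymbol 0 0 0 v₀ v₁] : Fin 4 → Fin 4 → Fin 4 → Fin 4 → ℝ) i)
      i j k l =
    warpedCurvature (p' + p ^ 2) (q' + q ^ 2) (p * q - s ^ 2)
      (v₀ - u₁ - b₀ ^ 2 - b₁ ^ 2 - 3 * s ^ 2 - q ^ 2) (s * (p - q)) i j k l := by
  unfold IsFrame.curvatureSymbol warpedCurvature
  simp only [Fin.sum_univ_four]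
  fin_cases i <;> fin_cases j <;> fin_cases k <;> fin_cases l <;>
    simp [warpedSymbol, skew] <;> ring

end Algebra

section WarpedFunctions

/-- The function `c f / (2 g²)`. -/
noncomputable def twist (f g : ℝ → ℝ) (c : ℝ) (t : ℝ) : ℝ := c * f t / (2 * g t ^ 2)

/-- The curvature function `g'' / g`. -/
noncomputable def etaFn (g : ℝ → ℝ) (t : ℝ) : ℝ := deriv (deriv g) t / g t

/-- The curvature function `(f' / f) (g' / g) - s²`, where `s` is the twist. -/
noncomputable def deltaFn (f g : ℝ → ℝ) (c : ℝ) (t : ℝ) : ℝ :=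
  deriv f t / f t * (deriv g t / g t) - twist f g c t ^ 2

/-- The curvature function `K / g² - 3 s² - (g' / g)²`, where `s` is the twist. -/
noncomputable def gammaFn (f g : ℝ → ℝ) (c K : ℝ) (t : ℝ) : ℝ :=
  K / g t ^ 2 - 3 * twist f g c t ^ 2 - (deriv g t / g t) ^ 2

/-- The curvature function `s (f' / f - g' / g)`, where `s` is the twist. -/
noncomputable def mixedFn (f g : ℝ → ℝ) (c : ℝ) (t : ℝ) : ℝ :=
  twist f g c t * (deriv f t / f t - deriv g t / g t)

variable {a b : ℝ} {f g : ℝ → ℝ}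

theorem contDiffOn_deriv (hf : ContDiffOn ℝ ∞ f (Ioo a b)) : ContDiffOn ℝ ∞ (deriv f) (Ioo a b) :=
  hf.deriv_of_isOpen isOpen_Ioo (by simp)

theorem hasDerivAt_of_contDiffOn (hf : ContDiffOn ℝ ∞ f (Ioo a b)) {t : ℝ} (ht : t ∈ Ioo a b) :
    HasDerivAt f (deriv f t) t :=
  ((hf.differentiableOn (by simp)).differentiableAt (isOpen_Ioo.mem_nhds ht)).hasDerivAt

theorem contDiffOn_logDeriv (hf : ContDiffOn ℝ ∞ f (Ioo a b)) (h0 : ∀ t ∈ Ioo a b, 0 < f t) :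
    ContDiffOn ℝ ∞ (fun t ↦ deriv f t / f t) (Ioo a b) :=
  (contDiffOn_deriv hf).div hf fun t ht ↦ (h0 t ht).ne'

theorem deriv_logDeriv (hf : ContDiffOn ℝ ∞ f (Ioo a b)) (h0 : ∀ t ∈ Ioo a b, 0 < f t) {t : ℝ}
    (ht : t ∈ Ioo a b) :
    deriv (fun t ↦ deriv f t / f t) t = etaFn f t - (deriv f t / f t) ^ 2 := by
  have h1 := ((hasDerivAt_of_contDiffOn (contDiffOn_deriv hf) ht).div
    (hasDerivAt_of_contDiffOn hf ht) (h0 t ht).ne').deriv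
  have := (h0 t ht).ne'
  refine h1.trans ?_
  unfold etaFn
  field_simp

namespace IsWarpPair

theorem contDiffOn_twist (hfg : IsWarpPair a b f g) (c : ℝ) :
    ContDiffOn ℝ ∞ (twist f g c) (Ioo a b) :=
  (contDiffOn_const.mul hfg.smooth_f).div (contDiffOn_const.mul (hfg.smooth_g.pow 2)) fun t ht ↦
    mul_ne_zero two_ne_zero (pow_ne_zero 2 (hfg.pos_g t ht).ne')

theorem deriv_twist (hfg : IsWarpPair a b f g) (c : ℝ) {t : ℝ} (ht : t ∈ Ioo a b) :
    deriv (twist f g c) t =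
      twist f g c t * (deriv f t / f t - 2 * (deriv g t / g t)) := by
  have hg := (hfg.pos_g t ht).ne'
  have hf := (hfg.pos_f t ht).ne'
  have h1 := ((((hasDerivAt_of_contDiffOn hfg.smooth_f ht).const_mul c).div
    (((hasDerivAt_of_contDiffOn hfg.smooth_g ht).pow 2).const_mul 2)
    (mul_ne_zero two_ne_zero (pow_ne_zero 2 hg)))).deriv
  refine h1.trans ?_
  unfold twist
  simp only [Pi.pow_apply]
  field_simp
  ring

end IsWarpPair

end WarpedFunctions

section LinearSymbol

/-- Linearity in the five parameters reduces smoothness and differentiation of the symbols to those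
of the parameters. -/
theorem warpedSymbol_eq (p q s b₀ b₁ : ℝ) (i j k : Fin 4) :
    warpedSymbol p q s b₀ b₁ i j k = warpedSymbol 1 0 0 0 0 i j k * p +
      (warpedSymbol 0 1 0 0 0 i j k * q + (warpedSymbol 0 0 1 0 0 i j k * s +
      (warpedSymbol 0 0 0 1 0 i j k * b₀ + warpedSymbol 0 0 0 0 1 i j k * b₁))) := by
  unfold warpedSymbol
  split_ifs <;> ring

variable {E : Type*} [NormedAddCommGroup E] [NormedSpace ℝ E] [FiniteDimensional ℝ E]
  {H : Type*} [TopologicalSpace H] {I : ModelWithCorners ℝ E H}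
  {M : Type*} [TopologicalSpace M] [ChartedSpace H M] [IsManifold I ∞ M]

theorem smoothFn_warpedSymbol {p q s b₀ b₁ : M → ℝ} {V : Set M} (hp : SmoothFn I p V)
    (hq : SmoothFn I q V) (hs : SmoothFn I s V) (h₀ : SmoothFn I b₀ V) (h₁ : SmoothFn I b₁ V)
    (i j k : Fin 4) :
    SmoothFn I (fun x ↦ warpedSymbol (p x) (q x) (s x) (b₀ x) (b₁ x) i j k) V := by
  simp only [warpedSymbol_eq (p _) (q _)]
  exact (contMDiffOn_const.mul hp).add ((contMDiffOn_const.mul hq).add ((contMDiffOn_const.mul hs).add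
    ((contMDiffOn_const.mul h₀).add (contMDiffOn_const.mul h₁))))

theorem dfun_warpedSymbol {p q s b₀ b₁ : M → ℝ} {x : M} (hp : MDifferentiableAt I 𝓘(ℝ, ℝ) p x)
    (hq : MDifferentiableAt I 𝓘(ℝ, ℝ) q x) (hs : MDifferentiableAt I 𝓘(ℝ, ℝ) s x)
    (h₀ : MDifferentiableAt I 𝓘(ℝ, ℝ) b₀ x) (h₁ : MDifferentiableAt I 𝓘(ℝ, ℝ) b₁ x)
    (i j k : Fin 4) (v : TangentSpace I x) :
    dfun (fun x ↦ warpedSymbol (p x) (q x) (s x) (b₀ x) (b₁ x) i j k) x v =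
      warpedSymbol (dfun p x v) (dfun q x v) (dfun s x v) (dfun b₀ x v) (dfun b₁ x v) i j k := by
  have hm : ∀ (r : ℝ) {u : M → ℝ}, MDifferentiableAt I 𝓘(ℝ, ℝ) u x →
      MDifferentiableAt I 𝓘(ℝ, ℝ) (fun y ↦ r * u y) x := fun r u hu ↦ mdifferentiableAt_const.mul hu
  have hd : ∀ (r : ℝ) {u : M → ℝ}, MDifferentiableAt I 𝓘(ℝ, ℝ) u x →
      dfun (fun y ↦ r * u y) x v = r * dfun u x v := fun r u hu ↦ by
    rw [dfun_mul (u := fun _ ↦ r) mdifferentiableAt_const hu, dfun_const, mul_zero, add_zero]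
  simp only [warpedSymbol_eq (p _) (q _), warpedSymbol_eq (dfun p _ _)]
  have ha : ∀ {u w : M → ℝ}, MDifferentiableAt I 𝓘(ℝ, ℝ) u x → MDifferentiableAt I 𝓘(ℝ, ℝ) w x →
      MDifferentiableAt I 𝓘(ℝ, ℝ) (fun y ↦ u y + w y) x := fun hu hw ↦ hu.add hw
  rw [dfun_add (hm _ hp) (ha (hm _ hq) (ha (hm _ hs) (ha (hm _ h₀) (hm _ h₁)))),
    dfun_add (hm _ hq) (ha (hm _ hs) (ha (hm _ h₀) (hm _ h₁))),
    dfun_add (hm _ hs) (ha (hm _ h₀) (hm _ h₁)), dfun_add (hm _ h₀) (hm _ h₁),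
    hd _ hp, hd _ hq, hd _ hs, hd _ h₀, hd _ h₁]

end LinearSymbol

section Curvature

variable {B : Type*} [TopologicalSpace B] [ChartedSpace (EuclideanSpace ℝ (Fin 2)) B]
  [IsManifold (𝓡 2) ∞ B]
  {P : Type*} [TopologicalSpace P] [ChartedSpace (EuclideanSpace ℝ (Fin 3)) P]
  [IsManifold (𝓡 3) ∞ P] {a b : ℝ}
  {h : Π y : B, TangentSpace (𝓡 2) y →L[ℝ] TangentSpace (𝓡 2) y →L[ℝ] ℝ}
  {j : Π y : B, TangentSpace (𝓡 2) y →L[ℝ] TangentSpace (𝓡 2) y}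
  {p : P → B} {θ : Π q : P, TangentSpace (𝓡 3) q →L[ℝ] ℝ} {f g : ℝ → ℝ} {c K : ℝ}
  {V : Set (Cyl a b P)} {e : Fin 4 → Π x : Cyl a b P, TangentSpace cylModel x}
  {α : Fin 4 → Π x : Cyl a b P, TangentSpace cylModel x →L[ℝ] ℝ} {κ : Fin 2 → Cyl a b P → ℝ}
  {conn : CovariantDerivative cylModel (ℝ × EuclideanSpace ℝ (Fin 3))
    (TangentSpace cylModel : Cyl a b P → Type _)}

/-- The curvature components of the metric `dt² + f² θ² + g² p^* h`. -/
noncomputable def cylCurvature (f g : ℝ → ℝ) (c K t : ℝ) (i j k l : Fin 4) : ℝ :=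
  warpedCurvature (etaFn f t) (etaFn g t) (deltaFn f g c t) (gammaFn f g c K t) (mixedFn f g c t)
    i j k l

/-- The eigenvalues of the Ricci tensor of the metric `dt² + f² θ² + g² p^* h`. -/
noncomputable def cylRicci (f g : ℝ → ℝ) (c K t : ℝ) (i : Fin 4) : ℝ :=
  (![-etaFn f t - 2 * etaFn g t, -etaFn f t - 2 * deltaFn f g c t,
    -etaFn g t - deltaFn f g c t + gammaFn f g c K t,
    -etaFn g t - deltaFn f g c t + gammaFn f g c K t] : Fin 4 → ℝ) i

/-- The mixed function m occurs only for complementary index pairs, which the trace never meets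
because its two pairs share an index. This is why the Ricci tensor is diagonal and free of m. -/
theorem cylCurvature_trace (f g : ℝ → ℝ) (c K t : ℝ) (j k : Fin 4) :
    ∑ i, cylCurvature f g c K t i j k i = if j = k then cylRicci f g c K t j else 0 := by
  unfold cylCurvature warpedCurvature cylRicci
  rw [Fin.sum_univ_four]
  fin_cases j <;> fin_cases k <;> simp [skew] <;> ring

namespace IsAdaptedFrame

theorem christoffel_eq_cylSymbol (hA : IsAdaptedFrame h j p θ f g c K V e α κ)
    (hconn : IsLeviCivita (warpedMetric h p θ f g) conn) {x : Cyl a b P} (hx : x ∈ V)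
    (i j k : Fin 4) : christoffel conn e α i j k x = cylSymbol f g c κ x i j k :=
  hA.toIsOrthonormalFrame.christoffel_eq (Γ := cylSymbol f g c κ x) hconn hx (fun _ _ _ ↦ warpedSymbol_antisymm _ _ _ _ _ _ _ _)
    (hA.bracket x hx) i j k

theorem smoothFn_cylSymbol (hA : IsAdaptedFrame h j p θ f g c K V e α κ) (i j k : Fin 4) :
    SmoothFn cylModel (fun x ↦ cylSymbol f g c κ x i j k) V :=
  smoothFn_warpedSymbol
    ((smoothFn_comp_tCoord (contDiffOn_logDeriv hA.warp.smooth_f hA.warp.pos_f)).mono (subset_univ V))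
    ((smoothFn_comp_tCoord (contDiffOn_logDeriv hA.warp.smooth_g hA.warp.pos_g)).mono (subset_univ V))
    ((smoothFn_comp_tCoord (hA.warp.contDiffOn_twist c)).mono (subset_univ V)) (hA.coeff 0) (hA.coeff 1)
    i j k

theorem smoothFn_christoffel (hA : IsAdaptedFrame h j p θ f g c K V e α κ)
    (hconn : IsLeviCivita (warpedMetric h p θ f g) conn) (i j k : Fin 4) :
    SmoothFn cylModel (christoffel conn e α i j k) V :=
  (hA.smoothFn_cylSymbol i j k).congr fun _ hx ↦ hA.christoffel_eq_cylSymbol hconn hx i j k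

theorem dt_frame (hA : IsAdaptedFrame h j p θ f g c K V e α κ) {x : Cyl a b P} (hx : x ∈ V)
    (i : Fin 4) : dt x (e i x) = if 0 = i then 1 else 0 := by
  rw [← hA.form_zero x hx, hA.dual x hx]

/-- The first three parameters of the symbols are functions of t and vary only along e0; the last
two are pulled back from the surface up to the factor 1/g, so they are constant along e1. -/
theorem dfun_christoffel (hA : IsAdaptedFrame h j p θ f g c K V e α κ)
    (hconn : IsLeviCivita (warpedMetric h p θ f g) conn) {x : Cyl a b P} (hx : x ∈ V)
    (i j k l : Fin 4) :
    dfun (christoffel conn e α j k l) x (e i x) =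
      (![warpedSymbol (etaFn f (tCoord x) - (deriv f (tCoord x) / f (tCoord x)) ^ 2)
          (etaFn g (tCoord x) - (deriv g (tCoord x) / g (tCoord x)) ^ 2)
          (twist f g c (tCoord x) * (deriv f (tCoord x) / f (tCoord x) -
            2 * (deriv g (tCoord x) / g (tCoord x))))
          (-(deriv g (tCoord x) / g (tCoord x) * κ 0 x)) (-(deriv g (tCoord x) / g (tCoord x) * κ 1 x)),
        warpedSymbol 0 0 0 0 0,
        warpedSymbol 0 0 0 (dfun (κ 0) x (e 2 x)) (dfun (κ 1) x (e 2 x)),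
        warpedSymbol 0 0 0 (dfun (κ 0) x (e 3 x)) (dfun (κ 1) x (e 3 x))] :
        Fin 4 → Fin 4 → Fin 4 → Fin 4 → ℝ) i j k l := by
  have hw := hA.warp
  have ht := tCoord_mem x
  have hm : ∀ {u : ℝ → ℝ}, ContDiffOn ℝ ∞ u (Ioo a b) →
      MDifferentiableAt cylModel 𝓘(ℝ, ℝ) (fun y : Cyl a b P ↦ u (tCoord y)) x := fun hu ↦
    (smoothFn_comp_tCoord hu).mdiffAt isOpen_univ (mem_univ x)
  have hp := contDiffOn_logDeriv hw.smooth_f hw.pos_f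
  have hq := contDiffOn_logDeriv hw.smooth_g hw.pos_g
  have h1 : dfun (I := cylModel) (christoffel conn e α j k l) x = dfun (fun y ↦ cylSymbol f g c κ y j k l) x :=
    dfun_congr (Filter.eventually_of_mem (hA.isOpen.mem_nhds hx) fun y hy ↦
      hA.christoffel_eq_cylSymbol hconn hy j k l)
  have h2 : dfun (fun y ↦ cylSymbol f g c κ y j k l) x (e i x) = _ :=
    dfun_warpedSymbol (hm hp) (hm hq) (hm (hw.contDiffOn_twist c))
      ((hA.coeff 0).mdiffAt hA.isOpen hx) ((hA.coeff 1).mdiffAt hA.isOpen hx) j k l (e i x)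
  rw [h1, h2, dfun_comp_tCoord hp, dfun_comp_tCoord hq, dfun_comp_tCoord (hw.contDiffOn_twist c),
    deriv_logDeriv hw.smooth_f hw.pos_f ht, deriv_logDeriv hw.smooth_g hw.pos_g ht,
    hw.deriv_twist c ht, hA.dt_frame hx]
  have e1 : (if (0 : Fin 4) = 1 then (1 : ℝ) else 0) = 0 := if_neg (by decide)
  have e2 : (if (0 : Fin 4) = 2 then (1 : ℝ) else 0) = 0 := if_neg (by decide)
  have e3 : (if (0 : Fin 4) = 3 then (1 : ℝ) else 0) = 0 := if_neg (by decide)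
  have e0 : (if (0 : Fin 4) = 0 then (1 : ℝ) else 0) = 1 := if_pos rfl
  have hi : i = 0 ∨ i = 1 ∨ i = 2 ∨ i = 3 := by fin_cases i <;> simp
  rcases hi with rfl | rfl | rfl | rfl
  · rw [e0, mul_one, mul_one, mul_one, hA.dcoeff_zero x hx, hA.dcoeff_zero x hx]
    rfl
  · rw [e1, mul_zero, mul_zero, mul_zero, hA.dcoeff_one x hx, hA.dcoeff_one x hx]
    rfl
  · rw [e2, mul_zero, mul_zero, mul_zero]
    rfl
  · rw [e3, mul_zero, mul_zero, mul_zero]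
    rfl

theorem curvature_eq (hA : IsAdaptedFrame h j p θ f g c K V e α κ)
    (hconn : IsLeviCivita (warpedMetric h p θ f g) conn) {x : Cyl a b P} (hx : x ∈ V)
    (u v w : TangentSpace cylModel x) (l : Fin 4) :
    α l x (curvature conn x u v w) = ∑ i, ∑ j, ∑ k, α i x u * α j x v * α k x w *
      cylCurvature f g c K (tCoord x) i j k l := by
  rw [hA.curvature_apply hconn (hA.smoothFn_christoffel hconn) hx]
  have h1 : (fun i j k ↦ christoffel conn e α i j k x) = cylSymbol f g c κ x := by
    funext i j k
    exact hA.christoffel_eq_cylSymbol hconn hx i j k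
  refine Finset.sum_congr rfl fun i _ ↦ Finset.sum_congr rfl fun j _ ↦ Finset.sum_congr rfl fun k _ ↦ ?_
  congr 1
  rw [h1]
  simp only [hA.dfun_christoffel hconn hx]
  refine (curvatureSymbol_warped _ _ _ _ _ _ _ _ _ _ _ i j k l).trans ?_
  unfold cylCurvature
  -- Here p' + p² = f''/f and q' + q² = g''/g, while the Gauss equation on the surface cancels the
  -- squares of κ and leaves K / g².
  rw [sub_add_cancel, sub_add_cancel, hA.dcoeff x hx, add_sub_right_comm, add_sub_cancel_right,
    add_sub_cancel_right]
  rfl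

theorem ricci_eq (hA : IsAdaptedFrame h j p θ f g c K V e α κ)
    (hconn : IsLeviCivita (warpedMetric h p θ f g) conn) {x : Cyl a b P} (hx : x ∈ V)
    (v w : TangentSpace cylModel x) :
    ricci conn x v w = ∑ j, ∑ k, α j x v * α k x w *
      if j = k then cylRicci f g c K (tCoord x) j else 0 := by
  rw [hA.ricci_apply hx (hA.curvature_eq hconn hx)]
  simp only [cylCurvature_trace]

theorem ricciEnd_eq (hA : IsAdaptedFrame h j p θ f g c K V e α κ)
    (hconn : IsLeviCivita (warpedMetric h p θ f g) conn) {x : Cyl a b P} (hx : x ∈ V)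
    (v : TangentSpace cylModel x) (k : Fin 4) :
    α k x (ricciEnd (warpedMetric h p θ f g) conn x v) = cylRicci f g c K (tCoord x) k * α k x v := by
  rw [hA.ricciEnd_apply hx (hA.ricci_eq hconn hx)]
  simp only [mul_ite, mul_zero, Finset.sum_ite_eq', Finset.mem_univ, if_true]
  exact mul_comm _ _

theorem scalarCurvature_eq_sum (hA : IsAdaptedFrame h j p θ f g c K V e α κ)
    (hconn : IsLeviCivita (warpedMetric h p θ f g) conn) {x : Cyl a b P} (hx : x ∈ V) :
    scalarCurvature (warpedMetric h p θ f g) conn x = ∑ k, cylRicci f g c K (tCoord x) k := by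
  rw [hA.scalarCurvature_eq hx (hA.ricci_eq hconn hx)]
  simp only [if_true]

end IsAdaptedFrame

end Curvature

/-! ### The vertical foliation, its complement and the two complex structures. -/

section FrameDistribution

variable {E : Type*} [NormedAddCommGroup E] [NormedSpace ℝ E] [FiniteDimensional ℝ E]
  {H : Type*} [TopologicalSpace H] {I : ModelWithCorners ℝ E H}
  {M : Type*} [TopologicalSpace M] [ChartedSpace H M] [IsManifold I ∞ M] {n k : ℕ}
  {V : Set M} {e : Fin n → Π x : M, TangentSpace I x}
  {α : Fin n → Π x : M, TangentSpace I x →L[ℝ] ℝ}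

theorem IsFrame.mem_span_iff (hF : IsFrame V e α) {x : M} (hx : x ∈ V) (σ : Fin k → Fin n)
    (v : TangentSpace I x) :
    v ∈ Submodule.span ℝ (range fun i ↦ e (σ i) x) ↔ ∀ i, i ∉ range σ → α i x v = 0 := by
  constructor
  · intro hv i hi
    induction hv using Submodule.span_induction with
    | mem w hw =>
      obtain ⟨m, rfl⟩ := hw
      rw [hF.dual x hx, if_neg fun him ↦ hi ⟨m, him.symm⟩]
    | zero => exact map_zero _
    | add v w _ _ hv hw => rw [map_add, hv, hw, add_zero]
    | smul r v _ hv => rw [map_smul, hv, smul_zero]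
  · intro hv
    rw [hF.sum x hx v]
    refine Submodule.sum_mem _ fun i _ ↦ ?_
    by_cases hi : i ∈ range σ
    · obtain ⟨m, rfl⟩ := hi
      exact Submodule.smul_mem _ _ (Submodule.subset_span ⟨m, rfl⟩)
    · rw [hv i hi, zero_smul]
      exact Submodule.zero_mem _

theorem IsFrame.linearIndependent (hF : IsFrame V e α) {x : M} (hx : x ∈ V) :
    LinearIndependent ℝ (fun i ↦ e i x) :=
  Fintype.linearIndependent_iff.2 fun r hr i ↦ by rw [← hF.form_sum hx r i, hr, map_zero]

/-- A distribution which is locally spanned by `k` members of a frame is smooth of rank `k`. -/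
theorem isDistribution_of_frame {Δ : Π x : M, Submodule ℝ (TangentSpace I x)}
    (σ : Fin k → Fin n) (hσ : Function.Injective σ)
    (h : ∀ x₀ : M, ∃ V, x₀ ∈ V ∧ ∃ (e : Fin n → Π x : M, TangentSpace I x)
      (α : Fin n → Π x : M, TangentSpace I x →L[ℝ] ℝ), IsFrame V e α ∧
      ∀ x ∈ V, ∀ v, v ∈ Δ x ↔ ∀ i, i ∉ range σ → α i x v = 0) : IsDistribution k Δ := by
  intro x₀
  obtain ⟨V, hx₀, e, α, hF, hΔ⟩ := h x₀
  refine ⟨V, hF.isOpen, hx₀, fun i ↦ e (σ i), fun i ↦ hF.smooth (σ i), fun x hx ↦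
    ⟨(hF.linearIndependent hx).comp σ hσ, ?_⟩⟩
  ext v
  rw [hΔ x hx, hF.mem_span_iff hx]

theorem dfun_eq_zero_of_inter {V U : Set M} (hV : IsOpen V) (hU : IsOpen U) {u : M → ℝ}
    (hu : ∀ y ∈ U ∩ V, u y = 0) {x : M} (hxU : x ∈ U) (hx : x ∈ V) (v : TangentSpace I x) :
    dfun (I := I) u x v = 0 := by
  rw [dfun_congr (v := fun _ ↦ (0 : ℝ))
    (Filter.eventually_of_mem ((hU.inter hV).mem_nhds ⟨hxU, hx⟩) hu), dfun_const]

end FrameDistribution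

section SymbolSums

/-- The zeroth-order part of the covariant derivative along v, written out once so that the
geometric claims become substitutions. -/
theorem sum_warpedSymbol (p q s b₀ b₁ : ℝ) (v x : Fin 4 → ℝ) (k : Fin 4) :
    ∑ i, ∑ j, v i * x j * warpedSymbol p q s b₀ b₁ i j k =
      (![-(p * v 1 * x 1) - q * v 2 * x 2 - q * v 3 * x 3,
        p * v 1 * x 0 - s * v 2 * x 3 + s * v 3 * x 2,
        q * v 2 * x 0 - s * v 1 * x 3 - s * v 3 * x 1 - b₀ * v 2 * x 3 - b₁ * v 3 * x 3,
        q * v 3 * x 0 + s * v 1 * x 2 + s * v 2 * x 1 + b₀ * v 2 * x 2 + b₁ * v 3 * x 2] :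
        Fin 4 → ℝ) k := by
  simp only [Fin.sum_univ_four]
  fin_cases k <;> simp [warpedSymbol, skew] <;> ring

/-- The zeroth-order part of the Lie bracket; its first entry vanishes because dt is closed. -/
theorem sum_warpedSymbol_sub (p q s b₀ b₁ : ℝ) (x y : Fin 4 → ℝ) (k : Fin 4) :
    ∑ i, ∑ j, x i * y j * (warpedSymbol p q s b₀ b₁ i j k - warpedSymbol p q s b₀ b₁ j i k) =
      (![0, -(p * (x 0 * y 1 - x 1 * y 0)) - 2 * s * (x 2 * y 3 - x 3 * y 2),
        -(q * (x 0 * y 2 - x 2 * y 0)) - b₀ * (x 2 * y 3 - x 3 * y 2),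
        -(q * (x 0 * y 3 - x 3 * y 0)) - b₁ * (x 2 * y 3 - x 3 * y 2)] : Fin 4 → ℝ) k := by
  have h1 : ∑ i, ∑ j, x i * y j * (warpedSymbol p q s b₀ b₁ i j k - warpedSymbol p q s b₀ b₁ j i k) =
      ∑ i, ∑ j, x i * y j * warpedSymbol p q s b₀ b₁ i j k -
        ∑ i, ∑ j, y i * x j * warpedSymbol p q s b₀ b₁ i j k := by
    rw [Finset.sum_comm (f := fun i j ↦ y i * x j * warpedSymbol p q s b₀ b₁ i j k)]
    simp only [← Finset.sum_sub_distrib]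
    exact Finset.sum_congr rfl fun i _ ↦ Finset.sum_congr rfl fun j _ ↦ by ring
  rw [h1, sum_warpedSymbol, sum_warpedSymbol]
  have hk : k = 0 ∨ k = 1 ∨ k = 2 ∨ k = 3 := by fin_cases k <;> simp
  rcases hk with rfl | rfl | rfl | rfl <;> simp <;> ring

end SymbolSums

section FirstConclusions

variable {B : Type*} [TopologicalSpace B] [ChartedSpace (EuclideanSpace ℝ (Fin 2)) B]
  [IsManifold (𝓡 2) ∞ B]
  {P : Type*} [TopologicalSpace P] [ChartedSpace (EuclideanSpace ℝ (Fin 3)) P]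
  [IsManifold (𝓡 3) ∞ P] {a b : ℝ}
  {h : Π y : B, TangentSpace (𝓡 2) y →L[ℝ] TangentSpace (𝓡 2) y →L[ℝ] ℝ}
  {j : Π y : B, TangentSpace (𝓡 2) y →L[ℝ] TangentSpace (𝓡 2) y}
  {p : P → B} {θ : Π q : P, TangentSpace (𝓡 3) q →L[ℝ] ℝ} {f g : ℝ → ℝ} {c K : ℝ}
  {conn : CovariantDerivative cylModel (ℝ × EuclideanSpace ℝ (Fin 3))
    (TangentSpace cylModel : Cyl a b P → Type _)}

namespace IsAdaptedFrame

variable {V : Set (Cyl a b P)} {e : Fin 4 → Π x : Cyl a b P, TangentSpace cylModel x}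
  {α : Fin 4 → Π x : Cyl a b P, TangentSpace cylModel x →L[ℝ] ℝ} {κ : Fin 2 → Cyl a b P → ℝ}

theorem mem_vertDistribution (hA : IsAdaptedFrame h j p θ f g c K V e α κ) {x : Cyl a b P}
    (hx : x ∈ V) (v : TangentSpace cylModel x) :
    v ∈ vertDistribution p θ x ↔ α 2 x v = 0 ∧ α 3 x v = 0 := by
  have hd := hA.dual x hx
  have hf := (hA.warp.pos_f _ (tCoord_mem x)).ne'
  rw [vertDistribution, hA.partialT_eq x hx, hA.thetaSharp_eq x hx, Submodule.mem_span_pair]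
  constructor
  · rintro ⟨r, s, rfl⟩
    simp [hd]
  · rintro ⟨h2, h3⟩
    refine ⟨α 1 x v / f (tCoord x), α 0 x v, ?_⟩
    have hs := hA.sum x hx v
    rw [Fin.sum_univ_four, h2, h3, zero_smul, zero_smul, add_zero, add_zero] at hs
    rw [smul_smul, div_mul_cancel₀ _ hf, add_comm]
    exact hs.symm

theorem mem_orthDistribution (hA : IsAdaptedFrame h j p θ f g c K V e α κ) {x : Cyl a b P}
    (hx : x ∈ V) (v : TangentSpace cylModel x) :
    v ∈ orthDistribution (warpedMetric h p θ f g) (vertDistribution p θ) x ↔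
      α 0 x v = 0 ∧ α 1 x v = 0 := by
  have hd := hA.dual x hx
  constructor
  · intro hv
    refine ⟨?_, ?_⟩
    · rw [← hA.metric_left hx]
      exact hv _ ((hA.mem_vertDistribution hx _).2 (by simp [hd]))
    · rw [← hA.metric_left hx]
      exact hv _ ((hA.mem_vertDistribution hx _).2 (by simp [hd]))
  · rintro ⟨h0, h1⟩ w hw
    obtain ⟨h2, h3⟩ := (hA.mem_vertDistribution hx w).1 hw
    rw [hA.metric x hx, Fin.sum_univ_four, h0, h1, h2, h3]
    ring

/-- The covariant derivative in an adapted frame. -/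
theorem conn_eq (hA : IsAdaptedFrame h j p θ f g c K V e α κ)
    (hconn : IsLeviCivita (warpedMetric h p θ f g) conn) {X : Π x : Cyl a b P, TangentSpace cylModel x}
    {U : Set (Cyl a b P)} (hU : IsOpen U) (hX : SmoothField X U) {x : Cyl a b P}
    (hxU : x ∈ U) (hx : x ∈ V) (v : TangentSpace cylModel x) (k : Fin 4) :
    α k x (conn X x v) = dfun (fun y ↦ α k y (X y)) x v + ∑ i, ∑ j, α i x v * α j x (X x) *
      cylSymbol f g c κ x i j k := by
  rw [hA.conn_apply conn hU hX hxU hx]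
  simp only [hA.christoffel_eq_cylSymbol hconn hx]

/-- The Lie bracket in an adapted frame. -/
theorem mlieBracket_eq (hA : IsAdaptedFrame h j p θ f g c K V e α κ)
    (hconn : IsLeviCivita (warpedMetric h p θ f g) conn)
    {X Y : Π x : Cyl a b P, TangentSpace cylModel x} {U : Set (Cyl a b P)} (hU : IsOpen U)
    (hX : SmoothField X U) (hY : SmoothField Y U) {x : Cyl a b P} (hxU : x ∈ U) (hx : x ∈ V)
    (k : Fin 4) :
    α k x (VectorField.mlieBracket cylModel X Y x) =
      dfun (fun y ↦ α k y (Y y)) x (X x) - dfun (fun y ↦ α k y (X y)) x (Y x) +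
      ∑ i, ∑ j, α i x (X x) * α j x (Y x) *
        (cylSymbol f g c κ x i j k - cylSymbol f g c κ x j i k) := by
  rw [hA.mlieBracket_apply hconn hU hX hY hxU hx]
  simp only [hA.christoffel_eq_cylSymbol hconn hx]

end IsAdaptedFrame

variable (hcov : ∀ x₀ : Cyl a b P, ∃ V e α κ, x₀ ∈ V ∧ IsAdaptedFrame h j p θ f g c K V e α κ)
  (hconn : IsLeviCivita (warpedMetric h p θ f g) conn)

include hcov hconn

/-- The vertical fields are those with components 2 and 3 zero. Every term in these components of a
bracket or of a covariant derivative contains a horizontal component of one of the fields, and so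
vanishes. -/
theorem isTotallyGeodesicFoliation_vertDistribution :
    IsTotallyGeodesicFoliation conn 2 (vertDistribution p θ) where
  distribution := by
    refine isDistribution_of_frame (n := 4) ![0, 1] (by decide) fun x₀ ↦ ?_
    obtain ⟨V, e, α, κ, hx₀, hA⟩ := hcov x₀
    refine ⟨V, hx₀, e, α, hA.toIsFrame, fun x hx v ↦ (hA.mem_vertDistribution hx v).trans ?_⟩
    constructor
    · rintro ⟨h2, h3⟩ i hi
      have hi' : i = 0 ∨ i = 1 ∨ i = 2 ∨ i = 3 := by fin_cases i <;> simp
      rcases hi' with rfl | rfl | rfl | rfl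
      exacts [(hi ⟨0, rfl⟩).elim, (hi ⟨1, rfl⟩).elim, h2, h3]
    · intro hi
      exact ⟨hi 2 (by decide), hi 3 (by decide)⟩
  involutive U X Y hU hX hY x hx := by
    obtain ⟨V, e, α, κ, hxV, hA⟩ := hcov x
    have hX' := fun y (hy : y ∈ U ∩ V) ↦ (hA.mem_vertDistribution hy.2 _).1 (hX.2 y hy.1)
    have hY' := fun y (hy : y ∈ U ∩ V) ↦ (hA.mem_vertDistribution hy.2 _).1 (hY.2 y hy.1)
    obtain ⟨hX2, hX3⟩ := hX' x ⟨hx, hxV⟩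
    obtain ⟨hY2, hY3⟩ := hY' x ⟨hx, hxV⟩
    refine (hA.mem_vertDistribution hxV _).2 ⟨?_, ?_⟩
    · rw [hA.mlieBracket_eq hconn hU hX.1 hY.1 hx hxV,
        dfun_eq_zero_of_inter hA.isOpen hU (fun y hy ↦ (hX' y hy).1) hx hxV,
        dfun_eq_zero_of_inter hA.isOpen hU (fun y hy ↦ (hY' y hy).1) hx hxV]
      refine (congrArg _ (sum_warpedSymbol_sub _ _ _ _ _ _ _ _)).trans ?_
      simp [hX2, hX3, hY2, hY3]
    · rw [hA.mlieBracket_eq hconn hU hX.1 hY.1 hx hxV,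
        dfun_eq_zero_of_inter hA.isOpen hU (fun y hy ↦ (hX' y hy).2) hx hxV,
        dfun_eq_zero_of_inter hA.isOpen hU (fun y hy ↦ (hY' y hy).2) hx hxV]
      refine (congrArg _ (sum_warpedSymbol_sub _ _ _ _ _ _ _ _)).trans ?_
      simp [hX2, hX3, hY2, hY3]
  totally_geodesic U X hU hX x hx := by
    obtain ⟨V, e, α, κ, hxV, hA⟩ := hcov x
    have hX' := fun y (hy : y ∈ U ∩ V) ↦ (hA.mem_vertDistribution hy.2 _).1 (hX.2 y hy.1)
    obtain ⟨hX2, hX3⟩ := hX' x ⟨hx, hxV⟩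
    refine (hA.mem_vertDistribution hxV _).2 ⟨?_, ?_⟩
    · rw [hA.conn_eq hconn hU hX.1 hx hxV,
        dfun_eq_zero_of_inter hA.isOpen hU (fun y hy ↦ (hX' y hy).1) hx hxV]
      refine (congrArg _ (sum_warpedSymbol _ _ _ _ _ _ _ _)).trans ?_
      simp [hX2, hX3]
    · rw [hA.conn_eq hconn hU hX.1 hx hxV,
        dfun_eq_zero_of_inter hA.isOpen hU (fun y hy ↦ (hX' y hy).2) hx hxV]
      refine (congrArg _ (sum_warpedSymbol _ _ _ _ _ _ _ _)).trans ?_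
      simp [hX2, hX3]

/-- For horizontal X the ∂_t-component of the derivative is -q (X₂² + X₃²), the same q in both
directions, and -q ∂_t is minus the gradient of ln g. The θ^♯-component cancels: the twist s enters
it skew-symmetrically. -/
theorem isUmbilical_orthDistribution :
    IsUmbilical (warpedMetric h p θ f g) conn 2
      (orthDistribution (warpedMetric h p θ f g) (vertDistribution p θ))
      (fun x ↦ -gradient (warpedMetric h p θ f g)
        (fun x' : Cyl a b P ↦ Real.log (g (tCoord x'))) x) := by
  have hξ : ∀ {V e α κ} {x : Cyl a b P}, IsAdaptedFrame h j p θ f g c K V e α κ → x ∈ V →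
      ∀ k, α k x (-gradient (warpedMetric h p θ f g)
        (fun x' : Cyl a b P ↦ Real.log (g (tCoord x'))) x) =
        if 0 = k then -(deriv g (tCoord x) / g (tCoord x)) else 0 := by
    intro V e α κ x hA hx k
    have hlog : ContDiffOn ℝ ∞ (fun t ↦ Real.log (g t)) (Ioo a b) :=
      hA.warp.smooth_g.log fun t ht ↦ (hA.warp.pos_g t ht).ne'
    have ht := tCoord_mem x
    have hder : deriv (fun t ↦ Real.log (g t)) (tCoord x) = deriv g (tCoord x) / g (tCoord x) :=
      ((hasDerivAt_of_contDiffOn hA.warp.smooth_g ht).log (hA.warp.pos_g _ ht).ne').deriv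
    rw [map_neg, hA.gradient_eq hx, hA.form_sum hx, dfun_comp_tCoord hlog, hder, hA.dt_frame hx]
    split_ifs <;> simp
  refine ⟨?_, fun x v hv ↦ ?_, fun U X hU hX x hx ↦ ?_⟩
  · refine isDistribution_of_frame (n := 4) ![2, 3] (by decide) fun x₀ ↦ ?_
    obtain ⟨V, e, α, κ, hx₀, hA⟩ := hcov x₀
    refine ⟨V, hx₀, e, α, hA.toIsFrame, fun x hx v ↦ (hA.mem_orthDistribution hx v).trans ?_⟩
    constructor
    · rintro ⟨h0, h1⟩ i hi
      have hi' : i = 0 ∨ i = 1 ∨ i = 2 ∨ i = 3 := by fin_cases i <;> simp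
      rcases hi' with rfl | rfl | rfl | rfl
      exacts [h0, h1, (hi ⟨0, rfl⟩).elim, (hi ⟨1, rfl⟩).elim]
    · intro hi
      exact ⟨hi 0 (by decide), hi 1 (by decide)⟩
  · obtain ⟨V, e, α, κ, hxV, hA⟩ := hcov x
    obtain ⟨h0, h1⟩ := (hA.mem_orthDistribution hxV v).1 hv
    rw [hA.metric x hxV, Fin.sum_univ_four, h0, h1, hξ hA hxV, hξ hA hxV, hξ hA hxV, hξ hA hxV]
    simp
  · obtain ⟨V, e, α, κ, hxV, hA⟩ := hcov x
    have hX' := fun y (hy : y ∈ U ∩ V) ↦ (hA.mem_orthDistribution hy.2 _).1 (hX.2 y hy.1)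
    obtain ⟨hX0, hX1⟩ := hX' x ⟨hx, hxV⟩
    have hm := hA.metric x hxV (X x) (X x)
    rw [Fin.sum_univ_four, hX0, hX1] at hm
    refine (hA.mem_orthDistribution hxV _).2 ⟨?_, ?_⟩
    · rw [map_sub, map_smul, hξ hA hxV, hA.conn_eq hconn hU hX.1 hx hxV,
        dfun_eq_zero_of_inter hA.isOpen hU (fun y hy ↦ (hX' y hy).1) hx hxV, hm]
      refine (congrArg (fun r ↦ 0 + r - _) (sum_warpedSymbol _ _ _ _ _ _ _ _)).trans ?_
      simp [hX0, hX1]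
      ring
    · rw [map_sub, map_smul, hξ hA hxV, hA.conn_eq hconn hU hX.1 hx hxV,
        dfun_eq_zero_of_inter hA.isOpen hU (fun y hy ↦ (hX' y hy).2) hx hxV]
      refine (congrArg (fun r ↦ 0 + r - _) (sum_warpedSymbol _ _ _ _ _ _ _ _)).trans ?_
      simp [hX0, hX1]
      ring

omit hconn in
theorem smoothField_warpedJ (ε : ℝ) {X : Π x : Cyl a b P, TangentSpace cylModel x}
    {U : Set (Cyl a b P)} (hU : IsOpen U) (hX : SmoothField X U) :
    SmoothField (fun x ↦ warpedJ j p θ f ε x (X x)) U := by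
  refine smoothField_of_locally fun x hx ↦ ?_
  obtain ⟨V, e, α, κ, hxV, hA⟩ := hcov x
  refine ⟨U ∩ V, hU.inter hA.isOpen, ⟨hx, hxV⟩, hA.smoothField inter_subset_right fun k ↦ ?_⟩
  have h1 := hA.coeff_smooth hU hX
  have h2 : SmoothFn cylModel (fun x ↦
      (![-(ε * α 1 x (X x)), ε * α 0 x (X x), -α 3 x (X x), α 2 x (X x)] : Fin 4 → ℝ) k) (U ∩ V) := by
    fin_cases k
    exacts [(contMDiffOn_const.mul (h1 1)).neg, contMDiffOn_const.mul (h1 0), (h1 3).neg, h1 2]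
  exact h2.congr fun y hy ↦ hA.warpedJ_apply y hy.2 ε (X y) k

-- In an adapted frame the complex structure has constant coefficients, so it commutes with
-- differentiating components.
omit hcov hconn in
theorem IsAdaptedFrame.dfun_warpedJ {V : Set (Cyl a b P)}
    {e : Fin 4 → Π x : Cyl a b P, TangentSpace cylModel x}
    {α : Fin 4 → Π x : Cyl a b P, TangentSpace cylModel x →L[ℝ] ℝ} {κ : Fin 2 → Cyl a b P → ℝ}
    (hA : IsAdaptedFrame h j p θ f g c K V e α κ) (ε : ℝ)
    {X : Π x : Cyl a b P, TangentSpace cylModel x} {U : Set (Cyl a b P)} (hU : IsOpen U)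
    (hX : SmoothField X U) {x : Cyl a b P} (hxU : x ∈ U) (hx : x ∈ V) (v : TangentSpace cylModel x)
    (k : Fin 4) :
    dfun (fun y ↦ α k y (warpedJ j p θ f ε y (X y))) x v =
      (![-(ε * dfun (fun y ↦ α 1 y (X y)) x v), ε * dfun (fun y ↦ α 0 y (X y)) x v,
        -dfun (fun y ↦ α 3 y (X y)) x v, dfun (fun y ↦ α 2 y (X y)) x v] : Fin 4 → ℝ) k := by
  have hm := hA.coeff_mdiffAt hU hX hxU hx
  have h1 : ∀ i, dfun (fun y ↦ ε * α i y (X y)) x v = ε * dfun (fun y ↦ α i y (X y)) x v := fun i ↦ by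
    rw [dfun_mul (u := fun _ ↦ ε) mdifferentiableAt_const (hm i), dfun_const, mul_zero, add_zero]
  rw [dfun_congr (v := fun y ↦
    (![-(ε * α 1 y (X y)), ε * α 0 y (X y), -α 3 y (X y), α 2 y (X y)] : Fin 4 → ℝ) k)
    (Filter.eventually_of_mem (hA.isOpen.mem_nhds hx) fun y hy ↦ hA.warpedJ_apply y hy ε (X y) k)]
  fin_cases k
  · exact (dfun_neg v).trans (congrArg _ (h1 1))
  · exact h1 0
  · exact dfun_neg v
  · rfl

/-- The Nijenhuis tensor vanishes for either sign because ∂_t rescales e2 and e3 at the same rate q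
and e1 commutes with both, while pairs exchanged by the structure contribute nothing. The derivative
terms of X and Y cancel, the coefficients being constant. -/
theorem isHermitianStructure_warpedJ {ε : ℝ} (hε : ε = 1 ∨ ε = -1) :
    IsHermitianStructure (warpedMetric h p θ f g) (warpedJ (a := a) (b := b) j p θ f ε) where
  smooth U X hU hX := smoothField_warpedJ hcov ε hU hX
  square x v := by
    obtain ⟨V, e, α, κ, hx, hA⟩ := hcov x
    refine hA.ext hx fun k ↦ ?_
    have hJ := hA.warpedJ_apply x hx ε
    have hk : k = 0 ∨ k = 1 ∨ k = 2 ∨ k = 3 := by fin_cases k <;> simp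
    rcases hk with rfl | rfl | rfl | rfl <;> rcases hε with rfl | rfl <;> simp [hJ]
  orthogonal x v w := by
    obtain ⟨V, e, α, κ, hx, hA⟩ := hcov x
    have hJ := hA.warpedJ_apply x hx ε
    rw [hA.metric x hx, hA.metric x hx, Fin.sum_univ_four, Fin.sum_univ_four]
    rcases hε with rfl | rfl <;> simp [hJ] <;> ring
  integrable U X Y hU hX hY x hx := by
    obtain ⟨V, e, α, κ, hxV, hA⟩ := hcov x
    have hJ := hA.warpedJ_apply x hxV ε
    have hJX := smoothField_warpedJ hcov ε hU hX
    have hJY := smoothField_warpedJ hcov ε hU hY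
    have hdX := hA.dfun_warpedJ ε hU hX hx hxV
    have hdY := hA.dfun_warpedJ ε hU hY hx hxV
    have hS : ∀ (v w : TangentSpace cylModel x) k, _ := fun v w k ↦ sum_warpedSymbol_sub
      (deriv f (tCoord x) / f (tCoord x)) (deriv g (tCoord x) / g (tCoord x))
      (c * f (tCoord x) / (2 * g (tCoord x) ^ 2)) (κ 0 x) (κ 1 x) (fun i ↦ α i x v)
      (fun i ↦ α i x w) k
    have e1 := hA.mlieBracket_eq hconn hU hX hY hx hxV
    have e2 := hA.mlieBracket_eq hconn hU hJX hY hx hxV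
    have e3 := hA.mlieBracket_eq hconn hU hX hJY hx hxV
    have e4 := hA.mlieBracket_eq hconn hU hJX hJY hx hxV
    unfold cylSymbol at e1 e2 e3 e4
    simp only [hS] at e1 e2 e3 e4
    simp only [hdX, hdY, hJ] at e1 e2 e3 e4
    refine hA.ext hxV fun k ↦ ?_
    rw [map_zero, map_sub, map_sub, map_sub, hJ, hJ]
    have hk : k = 0 ∨ k = 1 ∨ k = 2 ∨ k = 3 := by fin_cases k <;> simp
    rcases hk with rfl | rfl | rfl | rfl <;> rcases hε with rfl | rfl <;>
      simp [e1, e2, e3, e4] <;> ring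

/-- The connection matrix in a vertical direction only rotates the planes 01 and 23: it vanishes on
e0, and on e1 it is p times the first rotation plus s times the second. Such rotations commute with
the structure for every ε. -/
theorem vertDistribution_subset_nullity (ε : ℝ) (x : Cyl a b P) (v : TangentSpace cylModel x)
    (hv : v ∈ vertDistribution p θ x) : v ∈ nullity conn (warpedJ j p θ f ε) x := by
  intro U Y hU hx hY
  obtain ⟨V, e, α, κ, hxV, hA⟩ := hcov x
  obtain ⟨h2, h3⟩ := (hA.mem_vertDistribution hxV v).1 hv
  have hJ := hA.warpedJ_apply x hxV ε
  have hdY := hA.dfun_warpedJ ε hU hY hx hxV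
  have hS : ∀ (w : TangentSpace cylModel x) k, _ := fun w k ↦ sum_warpedSymbol
    (deriv f (tCoord x) / f (tCoord x)) (deriv g (tCoord x) / g (tCoord x))
    (c * f (tCoord x) / (2 * g (tCoord x) ^ 2)) (κ 0 x) (κ 1 x) (fun i ↦ α i x v)
    (fun i ↦ α i x w) k
  have e1 := hA.conn_eq hconn hU hY hx hxV v
  have e2 := hA.conn_eq hconn hU (smoothField_warpedJ hcov ε hU hY) hx hxV v
  unfold cylSymbol at e1 e2
  simp only [hS] at e1 e2
  simp only [hdY, hJ] at e2
  refine hA.ext hxV fun k ↦ ?_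
  rw [hJ]
  have hk : k = 0 ∨ k = 1 ∨ k = 2 ∨ k = 3 := by fin_cases k <;> simp
  rcases hk with rfl | rfl | rfl | rfl <;> simp [e1, e2, h2, h3] <;> ring

end FirstConclusions

/-! ### Differential equations for f, g and the Ricci eigenvalues. -/

section RealAnalysis

variable {a b : ℝ} {f g : ℝ → ℝ}

theorem eq_of_hasDerivAt_zero {u : ℝ → ℝ} (hu : ∀ t ∈ Ioo a b, HasDerivAt u 0 t) {s t : ℝ}
    (hs : s ∈ Ioo a b) (ht : t ∈ Ioo a b) : u s = u t :=
  isOpen_Ioo.is_const_of_deriv_eq_zero isPreconnected_Ioo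
    (fun x hx ↦ (hu x hx).differentiableAt.differentiableWithinAt) (fun x hx ↦ (hu x hx).deriv) hs ht

theorem contDiffOn_etaFn (hf : ContDiffOn ℝ ∞ f (Ioo a b)) (h0 : ∀ t ∈ Ioo a b, 0 < f t) :
    ContDiffOn ℝ ∞ (etaFn f) (Ioo a b) :=
  (contDiffOn_deriv (contDiffOn_deriv hf)).div hf fun t ht ↦ (h0 t ht).ne'

/-- The eigenvalue of the Ricci tensor on `∂_t`. -/
noncomputable def vertRicci (f g : ℝ → ℝ) (t : ℝ) : ℝ := -etaFn f t - 2 * etaFn g t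

/-- The eigenvalue of the Ricci tensor on horizontal lifts. -/
noncomputable def horRicci (f g : ℝ → ℝ) (c K t : ℝ) : ℝ :=
  -etaFn g t - deltaFn f g c t + gammaFn f g c K t

namespace IsWarpPair

theorem hasDerivAt_logDeriv_f (hfg : IsWarpPair a b f g) {t : ℝ} (ht : t ∈ Ioo a b) :
    HasDerivAt (fun t ↦ deriv f t / f t) (etaFn f t - (deriv f t / f t) ^ 2) t := by
  rw [← deriv_logDeriv hfg.smooth_f hfg.pos_f ht]
  exact hasDerivAt_of_contDiffOn (contDiffOn_logDeriv hfg.smooth_f hfg.pos_f) ht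

theorem hasDerivAt_logDeriv_g (hfg : IsWarpPair a b f g) {t : ℝ} (ht : t ∈ Ioo a b) :
    HasDerivAt (fun t ↦ deriv g t / g t) (etaFn g t - (deriv g t / g t) ^ 2) t := by
  rw [← deriv_logDeriv hfg.smooth_g hfg.pos_g ht]
  exact hasDerivAt_of_contDiffOn (contDiffOn_logDeriv hfg.smooth_g hfg.pos_g) ht

theorem hasDerivAt_twist (hfg : IsWarpPair a b f g) (c : ℝ) {t : ℝ} (ht : t ∈ Ioo a b) :
    HasDerivAt (twist f g c) (twist f g c t * (deriv f t / f t - 2 * (deriv g t / g t))) t := by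
  rw [← hfg.deriv_twist c ht]
  exact hasDerivAt_of_contDiffOn (hfg.contDiffOn_twist c) ht

theorem hasDerivAt_sq (hfg : IsWarpPair a b f g) {t : ℝ} (ht : t ∈ Ioo a b) :
    HasDerivAt (fun t ↦ g t ^ 2) (2 * g t * deriv g t) t :=
  ((hasDerivAt_of_contDiffOn hfg.smooth_g ht).fun_pow 2).congr_deriv (by simp)

theorem contDiffOn_vertRicci (hfg : IsWarpPair a b f g) : ContDiffOn ℝ ∞ (vertRicci f g) (Ioo a b) :=
  (contDiffOn_etaFn hfg.smooth_f hfg.pos_f).neg.sub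
    (contDiffOn_const.mul (contDiffOn_etaFn hfg.smooth_g hfg.pos_g))

theorem contDiffOn_deltaFn (hfg : IsWarpPair a b f g) (c : ℝ) :
    ContDiffOn ℝ ∞ (deltaFn f g c) (Ioo a b) :=
  ((contDiffOn_logDeriv hfg.smooth_f hfg.pos_f).mul (contDiffOn_logDeriv hfg.smooth_g hfg.pos_g)).sub
    ((hfg.contDiffOn_twist c).pow 2)

theorem contDiffOn_gammaFn (hfg : IsWarpPair a b f g) (c K : ℝ) :
    ContDiffOn ℝ ∞ (gammaFn f g c K) (Ioo a b) :=
  ((contDiffOn_const.div (hfg.smooth_g.pow 2) fun t ht ↦ pow_ne_zero 2 (hfg.pos_g t ht).ne').sub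
    (contDiffOn_const.mul ((hfg.contDiffOn_twist c).pow 2))).sub
    ((contDiffOn_logDeriv hfg.smooth_g hfg.pos_g).pow 2)

theorem contDiffOn_horRicci (hfg : IsWarpPair a b f g) (c K : ℝ) :
    ContDiffOn ℝ ∞ (horRicci f g c K) (Ioo a b) :=
  ((contDiffOn_etaFn hfg.smooth_g hfg.pos_g).neg.sub (hfg.contDiffOn_deltaFn c)).add
    (hfg.contDiffOn_gammaFn c K)

variable {c : ℝ}

/-- The differential Bianchi identity for the horizontal eigenvalue of the Ricci tensor. -/
theorem hasDerivAt_horRicci (hfg : IsWarpPair a b f g)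
    (hδ : ∀ t ∈ Ioo a b, etaFn g t = deltaFn f g c t) (K : ℝ) {t : ℝ} (ht : t ∈ Ioo a b) :
    HasDerivAt (horRicci f g c K)
      (2 * (vertRicci f g t - horRicci f g c K t) * (deriv g t / g t)) t := by
  have hg := (hfg.pos_g t ht).ne'
  have hK := (hasDerivAt_const t K).div (hfg.hasDerivAt_sq ht) (pow_ne_zero 2 hg)
  have hp := hfg.hasDerivAt_logDeriv_f ht
  have hq := hfg.hasDerivAt_logDeriv_g ht
  -- Once η is replaced by δ = p q - s², the eigenvalue μ is K/g² - s² - q² - 2 p q, whose terms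
  -- have known derivatives.
  have h1 := ((hK.sub ((hfg.hasDerivAt_twist c ht).pow 2)).sub (hq.pow 2)).sub
    ((hp.mul hq).const_mul 2)
  refine (h1.congr_of_eventuallyEq ?_).congr_deriv ?_
  · filter_upwards [isOpen_Ioo.mem_nhds ht] with y hy
    simp only [horRicci, gammaFn, hδ y hy, deltaFn, Pi.sub_apply, Pi.pow_apply, Pi.mul_apply,
      Pi.div_apply]
    ring
  · have hK' : (0 * g t ^ 2 - K * (2 * g t * deriv g t)) / (g t ^ 2) ^ 2 =
        -2 * (deriv g t / g t) * (K / g t ^ 2) := by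
      field_simp
      ring
    rw [hK']
    have h2 := hδ t ht
    simp only [vertRicci, horRicci, gammaFn, h2, deltaFn]
    norm_num
    ring

/-- If `g` is not constant, the zeros of its derivative are isolated. -/
theorem deriv_ne_zero_of_ne (hfg : IsWarpPair a b f g)
    (hδ : ∀ t ∈ Ioo a b, etaFn g t = deltaFn f g c t) (hg : ¬ ∃ r : ℝ, ∀ t ∈ Ioo a b, g t = r)
    {s t : ℝ} (hs : s ∈ Ioo a b) (ht : t ∈ Ioo a b) (hst : s < t) (h0 : deriv g s = 0) :
    deriv g t ≠ 0 := by
  intro h1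
  -- The relation η = δ says g'' = (p q - s²) g, so W' = -s² g / f ≤ 0. Being monotone, W vanishes
  -- between two zeros of g'.
  let W : ℝ → ℝ := fun t ↦ deriv g t / f t
  have hW : ∀ t ∈ Ioo a b, HasDerivAt W (-(twist f g c t ^ 2 * (g t / f t))) t := by
    intro t ht
    have hf0 := (hfg.pos_f t ht).ne'
    have hg0 := (hfg.pos_g t ht).ne'
    refine ((hasDerivAt_of_contDiffOn (contDiffOn_deriv hfg.smooth_g) ht).div
      (hasDerivAt_of_contDiffOn hfg.smooth_f ht) hf0).congr_deriv ?_
    have h2 := hδ t ht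
    unfold etaFn deltaFn at h2
    have h3 : deriv (deriv g) t = (deriv f t / f t * (deriv g t / g t) - twist f g c t ^ 2) * g t := by
      rw [← h2, div_mul_cancel₀ _ hg0]
    rw [h3]
    field_simp
    ring
  have hW0 : ∀ y ∈ Ioo s t, W y = 0 := by
    have hanti : AntitoneOn W (Ioo a b) := by
      refine antitoneOn_of_deriv_nonpos (convex_Ioo a b)
        (fun y hy ↦ (hW y hy).continuousAt.continuousWithinAt)
        (fun y hy ↦ (hW y (interior_subset hy)).differentiableAt.differentiableWithinAt) fun y hy ↦ ?_
      have hy := interior_subset hy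
      rw [(hW y hy).deriv]
      have := hfg.pos_f y hy
      have := hfg.pos_g y hy
      have : 0 ≤ twist f g c y ^ 2 * (g y / f y) := by positivity
      linarith
    intro y hy
    have hyI : y ∈ Ioo a b := ⟨hs.1.trans hy.1, hy.2.trans ht.2⟩
    have e1 : W s = 0 := by simp only [W, h0, zero_div]
    have e2 : W t = 0 := by simp only [W, h1, zero_div]
    have := hanti hs hyI hy.1.le
    have := hanti hyI ht hy.2.le
    linarith
  -- Where W vanishes on an interval, so does s, which forces c = 0. Then W is constant on all of
  -- (a, b), hence zero, and g is constant.
  have hc : c = 0 := by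
    obtain ⟨y, hy⟩ := exists_between hst
    have hyI : y ∈ Ioo a b := ⟨hs.1.trans hy.1, hy.2.trans ht.2⟩
    have e1 : HasDerivAt W 0 y := (hasDerivAt_const y (0 : ℝ)).congr_of_eventuallyEq
      (Filter.eventually_of_mem (isOpen_Ioo.mem_nhds hy) hW0)
    have e2 := (hW y hyI).unique e1
    have hf0 := hfg.pos_f y hyI
    have hg0 := hfg.pos_g y hyI
    have e3 : g y / f y ≠ 0 := (div_pos hg0 hf0).ne'
    have e4 : twist f g c y = 0 := by
      have := (mul_eq_zero.1 (neg_eq_zero.1 e2)).resolve_right e3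
      exact pow_eq_zero_iff (two_ne_zero) |>.1 this
    unfold twist at e4
    have e5 : (2 * g y ^ 2) ≠ 0 := by positivity
    exact (mul_eq_zero.1 ((div_eq_zero_iff.1 e4).resolve_right e5)).resolve_right hf0.ne'
  have hW' : ∀ t ∈ Ioo a b, HasDerivAt W 0 t := by
    intro y hy
    refine (hW y hy).congr_deriv ?_
    simp [twist, hc]
  have hg' : ∀ y ∈ Ioo a b, HasDerivAt g 0 y := by
    intro y hy
    refine (hasDerivAt_of_contDiffOn hfg.smooth_g hy).congr_deriv ?_
    have e1 : W y = W s := eq_of_hasDerivAt_zero hW' hy hs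
    have e2 : W s = 0 := by simp only [W, h0, zero_div]
    exact (div_eq_zero_iff.1 (e1.trans e2)).resolve_right (hfg.pos_f y hy).ne'
  exact hg ⟨g s, fun y hy ↦ eq_of_hasDerivAt_zero hg' hy hs⟩

/-- The three conditions on the eigenvalues of the Ricci tensor are equivalent. -/
theorem tfae_ricci (hfg : IsWarpPair a b f g)
    (hδ : ∀ t ∈ Ioo a b, etaFn g t = deltaFn f g c t) (hg : ¬ ∃ r : ℝ, ∀ t ∈ Ioo a b, g t = r)
    (K : ℝ) (hab : a < b) :
    List.TFAE [
      ∃ e : ℝ, ∀ t ∈ Ioo a b, vertRicci f g t - horRicci f g c K t = e * g t ^ 2,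
      ∃ C D : ℝ, ∀ t ∈ Ioo a b, horRicci f g c K t = C * g t ^ 2 + D,
      ∃ r : ℝ, ∀ t ∈ Ioo a b, vertRicci f g t - 2 * horRicci f g c K t = r] := by
  obtain ⟨t₀, ht₀⟩ := exists_between hab
  have hM : ∀ t ∈ Ioo a b, _ := fun t ht ↦ hfg.hasDerivAt_horRicci hδ K ht
  have hsq : ∀ t ∈ Ioo a b, _ := fun t ht ↦ hfg.hasDerivAt_sq ht
  -- By the Bianchi equation μ' = 2 e g² g'/g = (e g²)', so the constant C of the second condition
  -- is the e of the first.
  have hab' : (∃ e : ℝ, ∀ t ∈ Ioo a b, vertRicci f g t - horRicci f g c K t = e * g t ^ 2) →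
      ∃ C D : ℝ, (∀ t ∈ Ioo a b, horRicci f g c K t = C * g t ^ 2 + D) ∧
        ∀ t ∈ Ioo a b, vertRicci f g t - horRicci f g c K t = C * g t ^ 2 := by
    rintro ⟨e, he⟩
    have h1 : ∀ t ∈ Ioo a b, HasDerivAt (fun t ↦ horRicci f g c K t - e * g t ^ 2) 0 t := by
      intro t ht
      refine ((hM t ht).sub ((hsq t ht).const_mul e)).congr_deriv ?_
      have hg0 := (hfg.pos_g t ht).ne'
      rw [he t ht]
      field_simp
      ring
    refine ⟨e, horRicci f g c K t₀ - e * g t₀ ^ 2, fun t ht ↦ ?_, he⟩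
    have := eq_of_hasDerivAt_zero h1 ht ht₀
    linarith
  tfae_have 1 → 2 := fun h ↦ by
    obtain ⟨C, D, h1, -⟩ := hab' h
    exact ⟨C, D, h1⟩
  tfae_have 1 → 3 := fun h ↦ by
    obtain ⟨C, D, h1, h2⟩ := hab' h
    refine ⟨-D, fun t ht ↦ ?_⟩
    have := h1 t ht
    have := h2 t ht
    linarith
  tfae_have 3 → 1 := by
    rintro ⟨r, hr⟩
    -- Now λ - μ = r + μ, so r + μ has logarithmic growth rate 2 g'/g where it is nonzero: it is a
    -- constant multiple of g².
    have h1 : ∀ t ∈ Ioo a b, HasDerivAt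
        (fun t ↦ (r + horRicci f g c K t) / g t ^ 2) 0 t := by
      intro t ht
      have hg0 := (hfg.pos_g t ht).ne'
      refine (((hM t ht).const_add r).div (hsq t ht) (pow_ne_zero 2 hg0)).congr_deriv ?_
      have := hr t ht
      have h2 : vertRicci f g t - horRicci f g c K t = r + horRicci f g c K t := by linarith
      rw [h2]
      field_simp
      ring
    refine ⟨(r + horRicci f g c K t₀) / g t₀ ^ 2, fun t ht ↦ ?_⟩
    have hg0 := (hfg.pos_g t ht).ne'
    have := hr t ht
    have h2 := eq_of_hasDerivAt_zero h1 ht ht₀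
    rw [← h2, div_mul_cancel₀ _ (pow_ne_zero 2 hg0)]
    linarith
  tfae_have 2 → 1 := by
    rintro ⟨C, D, h⟩
    have h1 : ∀ t ∈ Ioo a b, deriv g t ≠ 0 →
        vertRicci f g t - horRicci f g c K t - C * g t ^ 2 = 0 := by
      intro t ht hg'
      have hg0 := (hfg.pos_g t ht).ne'
      have e1 : HasDerivAt (horRicci f g c K) (C * (2 * g t * deriv g t)) t :=
        (((hsq t ht).const_mul C).add_const D).congr_of_eventuallyEq
          (Filter.eventually_of_mem (isOpen_Ioo.mem_nhds ht) h)
      have e2 := (hM t ht).unique e1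
      have e3 : 2 * (deriv g t / g t) *
          (vertRicci f g t - horRicci f g c K t - C * g t ^ 2) = 0 := by
        have : C * (2 * g t * deriv g t) = 2 * (deriv g t / g t) * (C * g t ^ 2) := by field_simp
        rw [this] at e2
        linarith
      exact (mul_eq_zero.1 e3).resolve_left (mul_ne_zero two_ne_zero (div_ne_zero hg' hg0))
    refine ⟨C, fun t ht ↦ ?_⟩
    -- A critical point of g has no other critical point to its right, so the identity holds on a
    -- right neighbourhood and passes to the limit.
    by_cases hg' : deriv g t = 0
    · let u : ℝ → ℝ := fun t ↦ vertRicci f g t - horRicci f g c K t - C * g t ^ 2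
      have hu : ContinuousAt u t :=
        (((hfg.contDiffOn_vertRicci.sub (hfg.contDiffOn_horRicci c K)).sub
          (contDiffOn_const.mul (hfg.smooth_g.pow 2))).continuousOn).continuousAt
          (isOpen_Ioo.mem_nhds ht)
      have hu0 : ∀ᶠ s in 𝓝[>] t, u s = 0 := by
        filter_upwards [Ioo_mem_nhdsGT ht.2] with s hs
        have hsI : s ∈ Ioo a b := ⟨ht.1.trans hs.1, hs.2⟩
        exact h1 s hsI (hfg.deriv_ne_zero_of_ne hδ hg ht hsI hs.1 hg')
      have e1 : Filter.Tendsto u (𝓝[>] t) (𝓝 (u t)) := hu.tendsto.mono_left nhdsWithin_le_nhds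
      have e2 : Filter.Tendsto u (𝓝[>] t) (𝓝 0) :=
        tendsto_const_nhds.congr' (hu0.mono fun s hs ↦ hs.symm)
      have e3 : u t = 0 := tendsto_nhds_unique e1 e2
      exact sub_eq_zero.1 e3
    · exact sub_eq_zero.1 (h1 t ht hg')
  tfae_finish

/-- If the curvature functions `δ` and `m` vanish, all the others do. -/
theorem curvature_functions_eq_zero (hfg : IsWarpPair a b f g)
    (hδ : ∀ t ∈ Ioo a b, etaFn g t = deltaFn f g c t) (hg : ¬ ∃ r : ℝ, ∀ t ∈ Ioo a b, g t = r)
    {K e : ℝ} (he : ∀ t ∈ Ioo a b, vertRicci f g t - horRicci f g c K t = e * g t ^ 2)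
    (hδ0 : ∀ t ∈ Ioo a b, deltaFn f g c t = 0) (hm : ∀ t ∈ Ioo a b, mixedFn f g c t = 0)
    {t : ℝ} (ht : t ∈ Ioo a b) : etaFn f t = 0 ∧ gammaFn f g c K t = 0 := by
  have hη : ∀ t ∈ Ioo a b, etaFn g t = 0 := fun t ht ↦ (hδ t ht).trans (hδ0 t ht)
  have hg'' : ∀ t ∈ Ioo a b, HasDerivAt (deriv g) 0 t := fun t ht ↦
    (hasDerivAt_of_contDiffOn (contDiffOn_deriv hfg.smooth_g) ht).congr_deriv
      ((div_eq_zero_iff.1 (hη t ht)).resolve_right (hfg.pos_g t ht).ne')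
  have hg' : ∀ t ∈ Ioo a b, deriv g t ≠ 0 := by
    intro t ht h0
    have h1 : ∀ y ∈ Ioo a b, HasDerivAt g 0 y := fun y hy ↦
      (hasDerivAt_of_contDiffOn hfg.smooth_g hy).congr_deriv
        ((eq_of_hasDerivAt_zero hg'' hy ht).trans h0)
    exact hg ⟨g t, fun y hy ↦ eq_of_hasDerivAt_zero h1 hy ht⟩
  have hq : ∀ t ∈ Ioo a b, deriv g t / g t ≠ 0 := fun t ht ↦ div_ne_zero (hg' t ht) (hfg.pos_g t ht).ne'
  have hφ : ∀ t ∈ Ioo a b, etaFn f t = 0 := by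
    intro t ht
    -- If c = 0, then δ = 0 reads p q = 0 with q ≠ 0, so p = 0. Otherwise s has no zero and m = 0
    -- gives p = q. In both cases the equation p' = f''/f - p² yields f'' = 0.
    by_cases hc : c = 0
    · have hp : ∀ t ∈ Ioo a b, deriv f t / f t = 0 := by
        intro t ht
        have h1 := hδ0 t ht
        have h2 : twist f g c t = 0 := by simp [twist, hc]
        unfold deltaFn at h1
        rw [h2] at h1
        have h3 : deriv f t / f t * (deriv g t / g t) = 0 := by linarith
        exact (mul_eq_zero.1 h3).resolve_right (hq t ht)
      have h1 : HasDerivAt (fun t ↦ deriv f t / f t) 0 t :=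
        (hasDerivAt_const t (0 : ℝ)).congr_of_eventuallyEq
          (Filter.eventually_of_mem (isOpen_Ioo.mem_nhds ht) hp)
      have h2 := (hfg.hasDerivAt_logDeriv_f ht).unique h1
      rw [hp t ht] at h2
      linarith
    · have hp : ∀ t ∈ Ioo a b, deriv f t / f t = deriv g t / g t := by
        intro t ht
        have hf0 := (hfg.pos_f t ht).ne'
        have hg0 := (hfg.pos_g t ht).ne'
        have h1 : twist f g c t ≠ 0 :=
          div_ne_zero (mul_ne_zero hc hf0) (mul_ne_zero two_ne_zero (pow_ne_zero 2 hg0))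
        exact sub_eq_zero.1 ((mul_eq_zero.1 (hm t ht)).resolve_left h1)
      have h1 := (hfg.hasDerivAt_logDeriv_g ht).congr_of_eventuallyEq
        (Filter.eventually_of_mem (isOpen_Ioo.mem_nhds ht) hp)
      have h2 := (hfg.hasDerivAt_logDeriv_f ht).unique h1
      rw [hp t ht, hη t ht] at h2
      linarith
  refine ⟨hφ t ht, ?_⟩
  have hL : ∀ t ∈ Ioo a b, vertRicci f g t = 0 := fun t ht ↦ by
    rw [vertRicci, hφ t ht, hη t ht, mul_zero, neg_zero, sub_zero]
  have hM : horRicci f g c K t = gammaFn f g c K t := by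
    rw [horRicci, hη t ht, hδ0 t ht, neg_zero, sub_zero, zero_add]
  have h1 := hfg.hasDerivAt_horRicci hδ K ht
  -- With λ = 0 the hypothesis gives μ = -e g², while the Bianchi equation gives μ' = +(e g²)'. Both
  -- hold only if e g² g'/g = 0, so μ = γ = 0.
  have h2 : HasDerivAt (horRicci f g c K) (-e * (2 * g t * deriv g t)) t := by
    refine ((hfg.hasDerivAt_sq ht).const_mul (-e)).congr_of_eventuallyEq
      (Filter.eventually_of_mem (isOpen_Ioo.mem_nhds ht) fun y hy ↦ ?_)
    have := he y hy
    rw [hL y hy] at this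
    linarith
  have h3 := h1.unique h2
  have h4 : -e * (2 * g t * deriv g t) = -2 * (e * g t ^ 2) * (deriv g t / g t) := by
    have := (hfg.pos_g t ht).ne'
    field_simp
  have h5 := he t ht
  rw [h4, h5] at h3
  have h6 : e * g t ^ 2 * (deriv g t / g t) = 0 := by linarith
  have h7 := (mul_eq_zero.1 h6).resolve_right (hq t ht)
  rw [hL t ht, hM, h7] at h5
  linarith

end IsWarpPair

end RealAnalysis

/-! ### The Gray identity in terms of the Ricci eigenvalues. -/

section GrayCondition

variable {B : Type*} [TopologicalSpace B] [ChartedSpace (EuclideanSpace ℝ (Fin 2)) B]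
  [IsManifold (𝓡 2) ∞ B]
  {P : Type*} [TopologicalSpace P] [ChartedSpace (EuclideanSpace ℝ (Fin 3)) P]
  [IsManifold (𝓡 3) ∞ P] {a b : ℝ}
  {h : Π y : B, TangentSpace (𝓡 2) y →L[ℝ] TangentSpace (𝓡 2) y →L[ℝ] ℝ}
  {j : Π y : B, TangentSpace (𝓡 2) y →L[ℝ] TangentSpace (𝓡 2) y}
  {p : P → B} {θ : Π q : P, TangentSpace (𝓡 3) q →L[ℝ] ℝ} {f g : ℝ → ℝ} {c K : ℝ}
  {conn : CovariantDerivative cylModel (ℝ × EuclideanSpace ℝ (Fin 3))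
    (TangentSpace cylModel : Cyl a b P → Type _)}

/-- The eigenvalues of the Ricci tensor, when they coincide on the vertical distribution. -/
noncomputable def ricciValues (f g : ℝ → ℝ) (c K : ℝ) : Fin 4 → ℝ → ℝ :=
  ![vertRicci f g, vertRicci f g, horRicci f g c K, horRicci f g c K]

theorem cylRicci_eq_ricciValues {t : ℝ} (hδ : etaFn g t = deltaFn f g c t) (k : Fin 4) :
    cylRicci f g c K t k = ricciValues f g c K k t := by
  fin_cases k
  · rfl
  · change -etaFn f t - 2 * deltaFn f g c t = -etaFn f t - 2 * etaFn g t
    rw [hδ]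
  · rfl
  · rfl

theorem contDiffOn_ricciValues (hfg : IsWarpPair a b f g) (c K : ℝ) (k : Fin 4) :
    ContDiffOn ℝ ∞ (ricciValues f g c K k) (Ioo a b) := by
  fin_cases k
  exacts [hfg.contDiffOn_vertRicci, hfg.contDiffOn_vertRicci, hfg.contDiffOn_horRicci c K,
    hfg.contDiffOn_horRicci c K]

namespace IsAdaptedFrame

variable {V : Set (Cyl a b P)} {e : Fin 4 → Π x : Cyl a b P, TangentSpace cylModel x}
  {α : Fin 4 → Π x : Cyl a b P, TangentSpace cylModel x →L[ℝ] ℝ} {κ : Fin 2 → Cyl a b P → ℝ}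

theorem ricci_eq_diag (hA : IsAdaptedFrame h j p θ f g c K V e α κ)
    (hconn : IsLeviCivita (warpedMetric h p θ f g) conn)
    (hδ : ∀ t ∈ Ioo a b, etaFn g t = deltaFn f g c t) {x : Cyl a b P} (hx : x ∈ V)
    (v w : TangentSpace cylModel x) :
    ricci conn x v w = ∑ k, ricciValues f g c K k (tCoord x) * (α k x v * α k x w) := by
  rw [hA.ricci_eq hconn hx]
  simp only [cylRicci_eq_ricciValues (hδ _ (tCoord_mem x)), mul_ite, mul_zero, Finset.sum_ite_eq,
    Finset.mem_univ, if_true]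
  exact Finset.sum_congr rfl fun k _ ↦ mul_comm _ _

/-- The derivatives of the components of Y and Z cancel against those in their covariant
derivatives; what is left is algebraic in the fields at x. -/
theorem nablaRicci_eq (hA : IsAdaptedFrame h j p θ f g c K V e α κ)
    (hconn : IsLeviCivita (warpedMetric h p θ f g) conn)
    (hδ : ∀ t ∈ Ioo a b, etaFn g t = deltaFn f g c t)
    {X Y Z : Π x : Cyl a b P, TangentSpace cylModel x} {U : Set (Cyl a b P)} (hU : IsOpen U)
    (hY : SmoothField Y U) (hZ : SmoothField Z U) {x : Cyl a b P} (hxU : x ∈ U) (hx : x ∈ V) :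
    nablaRicci conn X Y Z x = ∑ k, (deriv (ricciValues f g c K k) (tCoord x) * α 0 x (X x) *
      (α k x (Y x) * α k x (Z x)) - ricciValues f g c K k (tCoord x) *
        ((∑ i, ∑ j, α i x (X x) * α j x (Y x) * cylSymbol f g c κ x i j k) * α k x (Z x) +
        α k x (Y x) * ∑ i, ∑ j, α i x (X x) * α j x (Z x) * cylSymbol f g c κ x i j k)) := by
  have hy := hA.coeff_mdiffAt hU hY hxU hx
  have hz := hA.coeff_mdiffAt hU hZ hxU hx
  have hr := contDiffOn_ricciValues hA.warp c K
  have hr' : ∀ k, MDifferentiableAt cylModel 𝓘(ℝ, ℝ)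
      (fun y : Cyl a b P ↦ ricciValues f g c K k (tCoord y)) x := fun k ↦
    (smoothFn_comp_tCoord (hr k)).mdiffAt isOpen_univ (mem_univ x)
  have hyz : ∀ k, MDifferentiableAt cylModel 𝓘(ℝ, ℝ) (fun y ↦ α k y (Y y) * α k y (Z y)) x :=
    fun k ↦ (hy k).mul (hz k)
  have hryz : ∀ k, MDifferentiableAt cylModel 𝓘(ℝ, ℝ) (fun y ↦
      ricciValues f g c K k (tCoord y) * (α k y (Y y) * α k y (Z y))) x := fun k ↦
    (hr' k).mul (hyz k)
  have h1 : dfun (fun y ↦ ricci conn y (Y y) (Z y)) x (X x) =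
      ∑ k, (ricciValues f g c K k (tCoord x) * (α k x (Y x) * dfun (fun y ↦ α k y (Z y)) x (X x) +
        α k x (Z x) * dfun (fun y ↦ α k y (Y y)) x (X x)) + α k x (Y x) * α k x (Z x) *
        (deriv (ricciValues f g c K k) (tCoord x) * α 0 x (X x))) := by
    rw [dfun_congr (Filter.eventually_of_mem (hA.isOpen.mem_nhds hx) fun y hy ↦
      hA.ricci_eq_diag hconn hδ hy (Y y) (Z y)),
      dfun_sum fun k _ ↦ hryz k]
    refine Finset.sum_congr rfl fun k _ ↦ ?_
    rw [dfun_mul (u := fun y : Cyl a b P ↦ ricciValues f g c K k (tCoord y)) (hr' k) (hyz k), dfun_mul (hy k) (hz k), dfun_comp_tCoord (hr k), hA.form_zero x hx]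
  rw [nablaRicci, h1, hA.ricci_eq_diag hconn hδ hx, hA.ricci_eq_diag hconn hδ hx,
    ← Finset.sum_sub_distrib, ← Finset.sum_sub_distrib]
  refine Finset.sum_congr rfl fun k _ ↦ ?_
  rw [hA.conn_eq hconn hU hY hxU hx, hA.conn_eq hconn hU hZ hxU hx]
  ring

theorem scalarCurvature_eq_ricci (hA : IsAdaptedFrame h j p θ f g c K V e α κ)
    (hconn : IsLeviCivita (warpedMetric h p θ f g) conn)
    (hδ : ∀ t ∈ Ioo a b, etaFn g t = deltaFn f g c t) {x : Cyl a b P} (hx : x ∈ V) :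
    scalarCurvature (warpedMetric h p θ f g) conn x =
      2 * vertRicci f g (tCoord x) + 2 * horRicci f g c K (tCoord x) := by
  rw [hA.scalarCurvature_eq_sum hconn hx]
  simp only [cylRicci_eq_ricciValues (hδ _ (tCoord_mem x)), Fin.sum_univ_four]
  change vertRicci f g _ + vertRicci f g _ + horRicci f g c K _ + horRicci f g c K _ = _
  ring

theorem dfun_scalarCurvature (hA : IsAdaptedFrame h j p θ f g c K V e α κ)
    (hconn : IsLeviCivita (warpedMetric h p θ f g) conn)
    (hδ : ∀ t ∈ Ioo a b, etaFn g t = deltaFn f g c t) {x : Cyl a b P} (hx : x ∈ V)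
    (v : TangentSpace cylModel x) :
    dfun (scalarCurvature (warpedMetric h p θ f g) conn) x v =
      (2 * deriv (vertRicci f g) (tCoord x) + 2 * deriv (horRicci f g c K) (tCoord x)) * α 0 x v := by
  have hL := hA.warp.contDiffOn_vertRicci
  have hM := hA.warp.contDiffOn_horRicci c K
  have h1 : dfun (scalarCurvature (warpedMetric h p θ f g) conn) x = dfun (I := cylModel)
      (fun y : Cyl a b P ↦ (fun t ↦ 2 * vertRicci f g t + 2 * horRicci f g c K t) (tCoord y)) x :=
    dfun_congr (Filter.eventually_of_mem (hA.isOpen.mem_nhds hx) fun y hy ↦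
      hA.scalarCurvature_eq_ricci hconn hδ hy)
  rw [h1, dfun_comp_tCoord ((contDiffOn_const.mul hL).add (contDiffOn_const.mul hM)),
    hA.form_zero x hx]
  congr 1
  have ht := tCoord_mem x
  exact (((hasDerivAt_of_contDiffOn hL ht).const_mul 2).add
    ((hasDerivAt_of_contDiffOn hM ht).const_mul 2)).deriv

end IsAdaptedFrame

variable (hcov : ∀ x₀ : Cyl a b P, ∃ V e α κ, x₀ ∈ V ∧ IsAdaptedFrame h j p θ f g c K V e α κ)
  (hconn : IsLeviCivita (warpedMetric h p θ f g) conn)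
  (hδ : ∀ t ∈ Ioo a b, etaFn g t = deltaFn f g c t)

include hcov hconn hδ

/-- With λ' = 2 μ' one third of dτ is 2 μ' dt. Inserting μ' = 2 (λ - μ) q turns both sides into the
same polynomial in the components; the terms in s and in the surface coefficients cancel. -/
theorem isACPerp_of_const {r : ℝ}
    (hr : ∀ t ∈ Ioo a b, vertRicci f g t - 2 * horRicci f g c K t = r) :
    IsACPerp (warpedMetric h p θ f g) conn := by
  intro U X Y Z hU hX hY hZ x hxU
  obtain ⟨V, e, α, κ, hx, hA⟩ := hcov x
  have ht := tCoord_mem x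
  have hM := (hA.warp.hasDerivAt_horRicci hδ K ht)
  have hL : deriv (vertRicci f g) (tCoord x) = 2 * deriv (horRicci f g c K) (tCoord x) := by
    have h1 := hasDerivAt_of_contDiffOn (hA.warp.contDiffOn_horRicci c K) ht
    have h2 : HasDerivAt (vertRicci f g) (2 * deriv (horRicci f g c K) (tCoord x)) (tCoord x) := by
      refine ((h1.const_mul 2).add_const r).congr_of_eventuallyEq
        (Filter.eventually_of_mem (isOpen_Ioo.mem_nhds ht) fun t ht ↦ ?_)
      have := hr t ht
      linarith
    exact h2.deriv
  have hS : ∀ (v w : TangentSpace cylModel x) k, _ := fun v w k ↦ sum_warpedSymbol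
    (deriv f (tCoord x) / f (tCoord x)) (deriv g (tCoord x) / g (tCoord x))
    (c * f (tCoord x) / (2 * g (tCoord x) ^ 2)) (κ 0 x) (κ 1 x) (fun i ↦ α i x v)
    (fun i ↦ α i x w) k
  have h1 := hA.nablaRicci_eq hconn hδ (X := X) hU hY hZ hxU hx
  have h2 := hA.nablaRicci_eq hconn hδ (X := Y) hU hZ hX hxU hx
  have h3 := hA.nablaRicci_eq hconn hδ (X := Z) hU hX hY hxU hx
  unfold cylSymbol at h1 h2 h3
  simp only [hS] at h1 h2 h3
  have hn : Module.finrank ℝ (ℝ × EuclideanSpace ℝ (Fin 3)) = 4 := by simp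
  rw [h1, h2, h3, hn, hA.dfun_scalarCurvature hconn hδ hx, hA.dfun_scalarCurvature hconn hδ hx,
    hA.dfun_scalarCurvature hconn hδ hx, hA.metric x hx, hA.metric x hx, hA.metric x hx, hL]
  simp only [Fin.sum_univ_four, ricciValues, Matrix.cons_val]
  rw [hL, hM.deriv]
  generalize deriv g (tCoord x) / g (tCoord x) = q
  generalize deriv f (tCoord x) / f (tCoord x) = p
  push_cast
  ring

/-- Only ∂_t is inserted, three times: as ∂_t is geodesic, the identity reads 3 λ' = τ' = 2 λ' + 2
μ'. -/
theorem const_of_isACPerp (hab : a < b) [Nonempty P]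
    (hG : IsACPerp (warpedMetric h p θ f g) conn) :
    ∃ r : ℝ, ∀ t ∈ Ioo a b, vertRicci f g t - 2 * horRicci f g c K t = r := by
  obtain ⟨q₀⟩ := ‹Nonempty P›
  obtain ⟨t₀, ht₀⟩ := exists_between hab
  have key : ∀ t ∈ Ioo a b, HasDerivAt (fun t ↦ vertRicci f g t - 2 * horRicci f g c K t) 0 t := by
    intro t ht
    let x : Cyl a b P := (⟨t, ht⟩, q₀)
    obtain ⟨V, e, α, κ, hx, hA⟩ := hcov x
    have h0 := hG V (e 0) (e 0) (e 0) hA.isOpen (hA.smooth 0) (hA.smooth 0) (hA.smooth 0) x hx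
    have hS := fun k ↦ sum_warpedSymbol
      (deriv f (tCoord x) / f (tCoord x)) (deriv g (tCoord x) / g (tCoord x))
      (c * f (tCoord x) / (2 * g (tCoord x) ^ 2)) (κ 0 x) (κ 1 x) (fun i ↦ α i x (e 0 x))
      (fun i ↦ α i x (e 0 x)) k
    have h1 := hA.nablaRicci_eq hconn hδ (X := e 0) hA.isOpen (hA.smooth 0) (hA.smooth 0) hx hx
    unfold cylSymbol at h1
    have hd := hA.dual x hx
    simp only [hS] at h1
    have hn : Module.finrank ℝ (ℝ × EuclideanSpace ℝ (Fin 3)) = 4 := by simp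
    rw [h1, hn, hA.dfun_scalarCurvature hconn hδ hx, hA.metric_left hx, hd] at h0
    simp [Fin.sum_univ_four, hd, ricciValues] at h0
    change _ = _ * ((2 * deriv (vertRicci f g) t + 2 * deriv (horRicci f g c K) t) +
      (2 * deriv (vertRicci f g) t + 2 * deriv (horRicci f g c K) t) +
      (2 * deriv (vertRicci f g) t + 2 * deriv (horRicci f g c K) t)) at h0
    change deriv (vertRicci f g) t + deriv (vertRicci f g) t + deriv (vertRicci f g) t = _ at h0
    refine ((hasDerivAt_of_contDiffOn hA.warp.contDiffOn_vertRicci ht).sub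
      ((hasDerivAt_of_contDiffOn (hA.warp.contDiffOn_horRicci c K) ht).const_mul 2)).congr_deriv ?_
    norm_num at h0
    linarith
  exact ⟨_, fun t ht ↦ eq_of_hasDerivAt_zero key ht ht₀⟩

end GrayCondition

/-! ### Linear algebra of orientations and invariant subspaces in dimension four. -/

section LinearAlgebra

/-- The columns are v, J v, w, J w in an adapted frame. Up to ε the determinant is the squared
modulus of a complex 2 × 2 determinant, so ε is the orientation of J. -/
theorem det_complex_pair {ε : ℝ} (hε : ε = 1 ∨ ε = -1) (v w : Fin 4 → ℝ) :
    Matrix.det !![v 0, -(ε * v 1), w 0, -(ε * w 1); v 1, ε * v 0, w 1, ε * w 0;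
      v 2, -v 3, w 2, -w 3; v 3, v 2, w 3, w 2] =
    ε * ((v 0 * w 2 - ε * v 1 * w 3 - (v 2 * w 0 - ε * v 3 * w 1)) ^ 2 +
      (v 0 * w 3 + ε * v 1 * w 2 - ε * v 2 * w 1 - v 3 * w 0) ^ 2) := by
  rcases hε with rfl | rfl <;>
    simp [Matrix.det_succ_row_zero, Fin.sum_univ_succ, Fin.succAbove] <;> ring

theorem eq_top_of_single_mem {S : Submodule ℝ (Fin 4 → ℝ)} (h0 : ![1, 0, 0, 0] ∈ S)
    (h1 : ![0, 1, 0, 0] ∈ S) (h2 : ![0, 0, 1, 0] ∈ S) (h3 : ![0, 0, 0, 1] ∈ S) : S = ⊤ := by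
  refine (Submodule.eq_top_iff').2 fun v ↦ ?_
  have h := S.add_mem (S.add_mem (S.smul_mem (v 0) h0) (S.smul_mem (v 1) h1))
    (S.add_mem (S.smul_mem (v 2) h2) (S.smul_mem (v 3) h3))
  convert h using 1
  ext i
  fin_cases i <;> simp

/-- A subspace invariant under the rotations in the planes `02`, `03` and `12` is trivial. -/
theorem eq_bot_or_eq_top_of_rotations {S : Submodule ℝ (Fin 4 → ℝ)}
    (h02 : ∀ z ∈ S, ![-z 2, 0, z 0, 0] ∈ S)
    (h03 : ∀ z ∈ S, ![-z 3, 0, 0, z 0] ∈ S) (h12 : ∀ z ∈ S, ![0, -z 2, z 1, 0] ∈ S) :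
    S = ⊥ ∨ S = ⊤ := by
  refine or_iff_not_imp_left.2 fun hS ↦ ?_
  obtain ⟨z, hz, hz0⟩ := (Submodule.ne_bot_iff S).1 hS
  have e0 : ![1, 0, 0, 0] ∈ S → S = ⊤ := fun h0 ↦ by
    have a2 : ![0, 0, 1, 0] ∈ S := by simpa using h02 _ h0
    have a3 : ![0, 0, 0, 1] ∈ S := by simpa using h03 _ h0
    have a1 : ![0, 1, 0, 0] ∈ S := by simpa using S.neg_mem (h12 _ a2)
    exact eq_top_of_single_mem h0 a1 a2 a3
  have e2 : ![0, 0, 1, 0] ∈ S → S = ⊤ := fun h ↦ e0 (by simpa using S.neg_mem (h02 _ h))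
  have e1 : ![0, 1, 0, 0] ∈ S → S = ⊤ := fun h ↦ e2 (by simpa using h12 _ h)
  have e3 : ![0, 0, 0, 1] ∈ S → S = ⊤ := fun h ↦ e0 (by simpa using S.neg_mem (h03 _ h))
  -- The composite of two infinitesimal rotations whose planes share one axis has rank one, so it
  -- isolates a single coordinate of z and puts a basis vector in S.
  by_cases z0 : z 0 = 0
  · by_cases z1 : z 1 = 0
    · by_cases z2 : z 2 = 0
      · by_cases z3 : z 3 = 0
        · exact (hz0 (by ext i; fin_cases i <;> assumption)).elim
        · refine e2 ?_
          simpa [z3] using S.smul_mem (-(z 3)⁻¹) (h02 _ (h03 z hz))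
      · refine e3 ?_
        simpa [z2] using S.smul_mem (-(z 2)⁻¹) (h03 _ (h02 z hz))
    · refine e0 ?_
      simpa [z1] using S.smul_mem (-(z 1)⁻¹) (h02 _ (h12 z hz))
  · refine e1 ?_
    simpa [z0] using S.smul_mem (-(z 0)⁻¹) (h12 _ (h02 z hz))

/-- A subspace invariant under two anticommuting complex structures is trivial. -/
theorem eq_bot_or_eq_top_of_quaternions {S : Submodule ℝ (Fin 4 → ℝ)} {σ : ℝ} (hσ : σ ^ 2 = 1)
    (hI : ∀ z ∈ S, ![-(σ * z 2), -z 3, σ * z 0, z 1] ∈ S)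
    (hJ : ∀ z ∈ S, ![-(σ * z 3), z 2, -z 1, σ * z 0] ∈ S) : S = ⊥ ∨ S = ⊤ := by
  refine or_iff_not_imp_left.2 fun hS ↦ ?_
  obtain ⟨z, hz, hz0⟩ := (Submodule.ne_bot_iff S).1 hS
  have hN : z 0 ^ 2 + z 1 ^ 2 + z 2 ^ 2 + z 3 ^ 2 ≠ 0 := by
    intro h
    have a0 : z 0 = 0 := by nlinarith [sq_nonneg (z 0), sq_nonneg (z 1), sq_nonneg (z 2), sq_nonneg (z 3)]
    have a1 : z 1 = 0 := by nlinarith [sq_nonneg (z 0), sq_nonneg (z 1), sq_nonneg (z 2), sq_nonneg (z 3)]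
    have a2 : z 2 = 0 := by nlinarith [sq_nonneg (z 0), sq_nonneg (z 1), sq_nonneg (z 2), sq_nonneg (z 3)]
    have a3 : z 3 = 0 := by nlinarith [sq_nonneg (z 0), sq_nonneg (z 1), sq_nonneg (z 2), sq_nonneg (z 3)]
    exact hz0 (by ext i; fin_cases i <;> assumption)
  refine (Submodule.eq_top_iff').2 fun w ↦ ?_
  -- The vectors z, I z, J z, I J z are orthogonal and of equal length, so this is the orthogonal
  -- expansion of w.
  have h := S.smul_mem (z 0 ^ 2 + z 1 ^ 2 + z 2 ^ 2 + z 3 ^ 2)⁻¹ (S.add_mem (S.add_mem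
    (S.smul_mem (w 0 * z 0 + w 1 * z 1 + w 2 * z 2 + w 3 * z 3) hz)
    (S.smul_mem (-(w 0 * σ * z 2) - w 1 * z 3 + w 2 * σ * z 0 + w 3 * z 1) (hI z hz))) (S.add_mem
    (S.smul_mem (-(w 0 * σ * z 3) + w 1 * z 2 - w 2 * z 1 + w 3 * σ * z 0) (hJ z hz))
    (S.smul_mem (w 0 * σ * z 1 - w 1 * σ * z 0 - w 2 * z 3 + w 3 * z 2) (hI _ (hJ z hz)))))
  convert h using 1
  ext i
  rw [Pi.smul_apply, smul_eq_mul, eq_inv_mul_iff_mul_eq₀ hN]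
  simp only [Pi.add_apply, Pi.smul_apply, smul_eq_mul]
  have hi : i = 0 ∨ i = 1 ∨ i = 2 ∨ i = 3 := by fin_cases i <;> simp
  rcases sq_eq_one_iff.1 hσ with rfl | rfl <;>
    rcases hi with rfl | rfl | rfl | rfl <;> simp only [Matrix.cons_val] <;> ring

/-- A subspace invariant under the curvature operators is trivial. -/
theorem eq_bot_or_eq_top_of_invariant {S : Submodule ℝ (Fin 4 → ℝ)} {δ m : ℝ}
    (h0 : ¬ (δ = 0 ∧ m = 0))
    (h02 : ∀ z ∈ S, ![-(δ * z 2), -(m * z 3), δ * z 0, m * z 1] ∈ S)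
    (h13 : ∀ z ∈ S, ![-(m * z 2), -(δ * z 3), m * z 0, δ * z 1] ∈ S)
    (h03 : ∀ z ∈ S, ![-(δ * z 3), m * z 2, -(m * z 1), δ * z 0] ∈ S)
    (h12 : ∀ z ∈ S, ![m * z 3, -(δ * z 2), δ * z 1, -(m * z 0)] ∈ S) : S = ⊥ ∨ S = ⊤ := by
  -- If δ = ±m, division by m turns the operators 02 and 03 into anticommuting complex structures.
  -- Otherwise the 2 × 2 system with determinant δ² - m² can be solved for rotations in single
  -- planes.
  by_cases hd : δ ^ 2 = m ^ 2
  · have hm : m ≠ 0 := fun hm ↦ h0 ⟨by simpa [hm] using hd, hm⟩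
    have hσ : (δ / m) ^ 2 = 1 := by rw [div_pow, hd, div_self (pow_ne_zero 2 hm)]
    refine eq_bot_or_eq_top_of_quaternions hσ (fun z hz ↦ ?_) fun z hz ↦ ?_
    · convert S.smul_mem m⁻¹ (h02 z hz) using 1
      ext i
      fin_cases i <;> simp <;> field_simp
    · convert S.smul_mem m⁻¹ (h03 z hz) using 1
      ext i
      fin_cases i <;> simp <;> field_simp
  · have hd' : δ ^ 2 - m ^ 2 ≠ 0 := sub_ne_zero.2 hd
    refine eq_bot_or_eq_top_of_rotations (fun z hz ↦ ?_) (fun z hz ↦ ?_) fun z hz ↦ ?_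
    · convert S.smul_mem (δ ^ 2 - m ^ 2)⁻¹
        (S.sub_mem (S.smul_mem δ (h02 z hz)) (S.smul_mem m (h13 z hz))) using 1
      ext i
      rw [Pi.smul_apply, smul_eq_mul, eq_inv_mul_iff_mul_eq₀ hd']
      fin_cases i <;> simp <;> ring
    · convert S.smul_mem (δ ^ 2 - m ^ 2)⁻¹
        (S.add_mem (S.smul_mem δ (h03 z hz)) (S.smul_mem m (h12 z hz))) using 1
      ext i
      rw [Pi.smul_apply, smul_eq_mul, eq_inv_mul_iff_mul_eq₀ hd']
      fin_cases i <;> simp <;> ring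
    · convert S.smul_mem (δ ^ 2 - m ^ 2)⁻¹
        (S.add_mem (S.smul_mem m (h03 z hz)) (S.smul_mem δ (h12 z hz))) using 1
      ext i
      rw [Pi.smul_apply, smul_eq_mul, eq_inv_mul_iff_mul_eq₀ hd']
      fin_cases i <;> simp <;> ring

end LinearAlgebra

/-! ### Parallel distributions, orientations and irreducibility. -/

section FrameAlgebra

variable {E : Type*} [NormedAddCommGroup E] [NormedSpace ℝ E] [FiniteDimensional ℝ E]
  {H : Type*} [TopologicalSpace H] {I : ModelWithCorners ℝ E H}
  {M : Type*} [TopologicalSpace M] [ChartedSpace H M] [IsManifold I ∞ M] {n : ℕ}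
  {V : Set M} {e : Fin n → Π x : M, TangentSpace I x}
  {α : Fin n → Π x : M, TangentSpace I x →L[ℝ] ℝ}

namespace IsFrame

/-- The components of tangent vectors in a frame. -/
noncomputable def components (hF : IsFrame V e α) {x : M} (hx : x ∈ V) :
    TangentSpace I x ≃ₗ[ℝ] (Fin n → ℝ) where
  toFun v i := α i x v
  map_add' v w := funext fun i ↦ map_add (α i x) v w
  map_smul' r v := funext fun i ↦ map_smul (α i x) r v
  invFun r := ∑ i, r i • e i x
  left_inv v := (hF.sum x hx v).symm
  right_inv r := funext fun i ↦ hF.form_sum hx r i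

theorem alternating_apply (hF : IsFrame V e α) {x : M} (hx : x ∈ V)
    (Φ : (TangentSpace I x) [⋀^Fin n]→ₗ[ℝ] ℝ) (v : Fin n → TangentSpace I x) :
    Φ v = Φ (fun i ↦ e i x) * Matrix.det (Matrix.of fun i k ↦ α i x (v k)) := by
  let bs : Module.Basis (Fin n) ℝ (TangentSpace I x) := Module.Basis.ofEquivFun (hF.components hx)
  have hb : ∀ i, bs i = e i x := by
    intro i
    rw [Module.Basis.coe_ofEquivFun]
    refine hF.ext hx fun k ↦ ?_
    refine (hF.form_sum hx _ k).trans ?_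
    rw [hF.dual x hx, Pi.single_apply]
  have h1 := Φ.eq_smul_basis_det bs
  have h2 : (fun i ↦ bs i) = fun i ↦ e i x := funext hb
  have h3 : Φ v = Φ bs * bs.det v := by
    conv_lhs => rw [h1]
    rfl
  rw [h3, Module.Basis.det_apply]
  exact congrArg (fun w ↦ Φ w * _) h2

/-- A parallel distribution is invariant under the curvature operators. -/
theorem curvature_mem (hF : IsFrame V e α)
    {conn : CovariantDerivative I E (TangentSpace I : M → Type _)}
    {G : Π x : M, TangentSpace I x →L[ℝ] TangentSpace I x →L[ℝ] ℝ} (hconn : IsLeviCivita G conn)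
    (hΓ : ∀ i j k, SmoothFn I (christoffel conn e α i j k) V) {k : ℕ}
    {Δ : Π x : M, Submodule ℝ (TangentSpace I x)} (hΔ : IsDistribution k Δ)
    (hpar : ∀ (U : Set M) (X : Π x : M, TangentSpace I x), IsOpen U → IsSectionOn Δ X U →
      ∀ x ∈ U, ∀ v : TangentSpace I x, conn X x v ∈ Δ x) {x : M} (hx : x ∈ V)
    (u v : TangentSpace I x) {w : TangentSpace I x} (hw : w ∈ Δ x) : curvature conn x u v w ∈ Δ x := by
  obtain ⟨U, hU, hxU, X, hX, hspan⟩ := hΔ x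
  rw [(hspan x hxU).2] at hw
  obtain ⟨r, hr⟩ := (Submodule.mem_span_range_iff_exists_fun ℝ).1 hw
  -- The vector w is extended by a section of Δ; then every term of the curvature formula is a
  -- covariant derivative of a section of Δ.
  let Z : Π y : M, TangentSpace I y := fun y ↦ ∑ i, r i • X i y
  have hO : IsOpen (U ∩ V) := hU.inter hF.isOpen
  have hxO : x ∈ U ∩ V := ⟨hxU, hx⟩
  have hZ : SmoothField Z (U ∩ V) := SmoothField.sum fun i _ ↦
    SmoothField.smul contMDiffOn_const ((hX i).mono inter_subset_left)
  have hZs : IsSectionOn Δ Z (U ∩ V) := by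
    refine ⟨hZ, fun y hy ↦ ?_⟩
    rw [(hspan y hy.1).2]
    exact Submodule.sum_mem _ fun i _ ↦ Submodule.smul_mem _ _ (Submodule.subset_span ⟨i, rfl⟩)
  have hext : ∀ u : TangentSpace I x, ∃ A : Π y : M, TangentSpace I y,
      SmoothField A (U ∩ V) ∧ A x = u := fun u ↦
    ⟨fun y ↦ ∑ i, α i x u • e i y, SmoothField.sum fun i _ ↦
      SmoothField.smul contMDiffOn_const ((hF.smooth i).mono inter_subset_right),
      (hF.sum x hx u).symm⟩
  obtain ⟨A, hA, rfl⟩ := hext u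
  obtain ⟨A', hA', rfl⟩ := hext v
  have hcs : ∀ {A : Π y : M, TangentSpace I y}, SmoothField A (U ∩ V) →
      IsSectionOn Δ (fun y ↦ conn Z y (A y)) (U ∩ V) := fun hA ↦
    ⟨hF.smoothField_conn hΓ hO inter_subset_right hZ hA, fun y hy ↦ hpar _ Z hO hZs y hy _⟩
  have hZx : Z x = w := hr
  rw [← hZx, hF.curvature_eq_fields hconn hΓ hO inter_subset_right hA hA' hZ hxO]
  exact Submodule.sub_mem _ (Submodule.sub_mem _ (hpar _ _ hO (hcs hA') x hxO _)
    (hpar _ _ hO (hcs hA) x hxO _)) (hpar _ _ hO hZs x hxO _)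

end IsFrame

end FrameAlgebra

section BiHermitian

variable {B : Type*} [TopologicalSpace B] [ChartedSpace (EuclideanSpace ℝ (Fin 2)) B]
  [IsManifold (𝓡 2) ∞ B]
  {P : Type*} [TopologicalSpace P] [ChartedSpace (EuclideanSpace ℝ (Fin 3)) P]
  [IsManifold (𝓡 3) ∞ P] {a b : ℝ}
  {h : Π y : B, TangentSpace (𝓡 2) y →L[ℝ] TangentSpace (𝓡 2) y →L[ℝ] ℝ}
  {j : Π y : B, TangentSpace (𝓡 2) y →L[ℝ] TangentSpace (𝓡 2) y}
  {p : P → B} {θ : Π q : P, TangentSpace (𝓡 3) q →L[ℝ] ℝ} {f g : ℝ → ℝ} {c K : ℝ}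
  {conn : CovariantDerivative cylModel (ℝ × EuclideanSpace ℝ (Fin 3))
    (TangentSpace cylModel : Cyl a b P → Type _)}
  (hcov : ∀ x₀ : Cyl a b P, ∃ V e α κ, x₀ ∈ V ∧ IsAdaptedFrame h j p θ f g c K V e α κ)
  (hconn : IsLeviCivita (warpedMetric h p θ f g) conn)
  (hδ : ∀ t ∈ Ioo a b, etaFn g t = deltaFn f g c t)

include hcov

theorem oppositeOrientations_warpedJ :
    OppositeOrientations (warpedJ (a := a) (b := b) j p θ f 1) (warpedJ j p θ f (-1)) := by
  intro x Φ v w v' w'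
  obtain ⟨V, e, α, κ, hx, hA⟩ := hcov x
  have key : ∀ ε : ℝ, (ε = 1 ∨ ε = -1) → ∀ v w : TangentSpace cylModel x, ∃ r : ℝ, 0 ≤ r ∧
      Φ ![v, warpedJ j p θ f ε x v, w, warpedJ j p θ f ε x w] = Φ (fun i ↦ e i x) * (ε * r) := by
    intro ε hε v w
    have hm : (Matrix.of fun i k ↦ α i x ((![v, warpedJ j p θ f ε x v, w, warpedJ j p θ f ε x w] :
        Fin 4 → TangentSpace cylModel x) k)) =
        !![α 0 x v, -(ε * α 1 x v), α 0 x w, -(ε * α 1 x w);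
          α 1 x v, ε * α 0 x v, α 1 x w, ε * α 0 x w;
          α 2 x v, -α 3 x v, α 2 x w, -α 3 x w; α 3 x v, α 2 x v, α 3 x w, α 2 x w] := by
      have hJ := hA.warpedJ_apply x hx ε
      ext i k
      fin_cases k
      · fin_cases i <;> rfl
      · exact (hJ v i).trans (by fin_cases i <;> rfl)
      · fin_cases i <;> rfl
      · exact (hJ w i).trans (by fin_cases i <;> rfl)
    have h1 := hA.alternating_apply hx Φ ![v, warpedJ j p θ f ε x v, w, warpedJ j p θ f ε x w]
    rw [hm] at h1
    have h2 := det_complex_pair hε (fun i ↦ α i x v) fun i ↦ α i x w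
    rw [h2] at h1
    exact ⟨_, by positivity, h1⟩
  obtain ⟨r, hr, h1⟩ := key 1 (Or.inl rfl) v w
  obtain ⟨r', hr', h2⟩ := key (-1) (Or.inr rfl) v' w'
  rw [h1, h2]
  have := mul_nonneg (sq_nonneg (Φ (fun i ↦ e i x))) (mul_nonneg hr hr')
  nlinarith

include hconn hδ

theorem ricciEnd_warpedJ (ε : ℝ) (x : Cyl a b P) (v : TangentSpace cylModel x) :
    ricciEnd (warpedMetric h p θ f g) conn x (warpedJ j p θ f ε x v) =
      warpedJ j p θ f ε x (ricciEnd (warpedMetric h p θ f g) conn x v) := by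
  obtain ⟨V, e, α, κ, hx, hA⟩ := hcov x
  have hJ := hA.warpedJ_apply x hx ε
  have hS := hA.ricciEnd_eq hconn hx
  refine hA.ext hx fun k ↦ ?_
  rw [hS, hJ, hJ]
  simp only [hS, cylRicci_eq_ricciValues (hδ _ (tCoord_mem x))]
  have hk : k = 0 ∨ k = 1 ∨ k = 2 ∨ k = 3 := by fin_cases k <;> simp
  rcases hk with rfl | rfl | rfl | rfl <;> simp [ricciValues] <;> ring

/-- One point is enough, because the rank of a distribution is constant. There the subspace is
invariant under the curvature operators of the planes 02, 13, 03, 12, which involve only δ and m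
once η = δ. -/
theorem isIrreducible_of_ne_zero [Nonempty P] {t : ℝ} (ht : t ∈ Ioo a b)
    (h0 : ¬ (deltaFn f g c t = 0 ∧ mixedFn f g c t = 0)) : IsIrreducible conn := by
  intro k Δ hΔ hpar
  obtain ⟨q₀⟩ := ‹Nonempty P›
  let x : Cyl a b P := (⟨t, ht⟩, q₀)
  obtain ⟨V, e, α, κ, hx, hA⟩ := hcov x
  let L := hA.components hx
  have hinv : ∀ (i k : Fin 4) (z : Fin 4 → ℝ), z ∈ (Δ x).map L.toLinearMap →
      (fun l ↦ ∑ m, z m * cylCurvature f g c K t i k m l) ∈ (Δ x).map L.toLinearMap := by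
    rintro i k _ ⟨w, hw, rfl⟩
    refine ⟨_, hA.curvature_mem hconn (hA.smoothFn_christoffel hconn) hΔ hpar hx (e i x) (e k x) hw, ?_⟩
    funext l
    refine (hA.curvature_eq hconn hx (e i x) (e k x) w l).trans ?_
    simp only [hA.dual x hx, ite_mul, one_mul, zero_mul, Finset.sum_ite_eq', Finset.mem_univ, if_true,
      Finset.sum_ite_irrel, Finset.sum_const_zero]
    rfl
  have hd : deltaFn f g c t = etaFn g t := (hδ t ht).symm
  have hbt := eq_bot_or_eq_top_of_invariant (S := (Δ x).map L.toLinearMap) h0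
    (fun z hz ↦ by
      convert hinv 0 2 z hz using 1
      rw [hd]
      ext l
      fin_cases l <;> simp [cylCurvature, warpedCurvature, skew, hd] <;> ring)
    (fun z hz ↦ by
      convert hinv 1 3 z hz using 1
      ext l
      fin_cases l <;> simp [cylCurvature, warpedCurvature, skew, hd] <;> ring)
    (fun z hz ↦ by
      convert hinv 0 3 z hz using 1
      ext l
      fin_cases l <;> simp [cylCurvature, warpedCurvature, skew, hd] <;> ring)
    (fun z hz ↦ by
      convert hinv 1 2 z hz using 1
      ext l
      fin_cases l <;> simp [cylCurvature, warpedCurvature, skew, hd] <;> ring)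
  have hk : Module.finrank ℝ (Δ x) = k := by
    obtain ⟨U, hU, hxU, X, hX, hspan⟩ := hΔ x
    rw [(hspan x hxU).2, finrank_span_eq_card (hspan x hxU).1, Fintype.card_fin]
  rcases hbt with hb | hb
  · left
    have h1 : Δ x = ⊥ := Submodule.map_injective_of_injective L.injective
      (hb.trans (Submodule.map_bot _).symm)
    rw [← hk, h1, finrank_bot]
  · right
    have h1 : Δ x = ⊤ := Submodule.map_injective_of_injective L.injective
      (hb.trans (by rw [Submodule.map_top, LinearEquiv.range]))
    rw [← hk, h1, finrank_top]
    rfl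

omit hδ in
theorem isFlat_of_eq_zero (h1 : ∀ t ∈ Ioo a b, etaFn g t = 0) (h2 : ∀ t ∈ Ioo a b, etaFn f t = 0)
    (h3 : ∀ t ∈ Ioo a b, deltaFn f g c t = 0) (h4 : ∀ t ∈ Ioo a b, mixedFn f g c t = 0)
    (h5 : ∀ t ∈ Ioo a b, gammaFn f g c K t = 0) : IsFlat conn := by
  intro x u v w
  obtain ⟨V, e, α, κ, hx, hA⟩ := hcov x
  have ht := tCoord_mem x
  refine hA.ext hx fun l ↦ ?_
  rw [hA.curvature_eq hconn hx, map_zero]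
  refine Finset.sum_eq_zero fun i _ ↦ Finset.sum_eq_zero fun j _ ↦ Finset.sum_eq_zero fun k _ ↦ ?_
  rw [cylCurvature, h1 _ ht, h2 _ ht, h3 _ ht, h4 _ ht, h5 _ ht]
  simp [warpedCurvature]

/-- The condition on the Ricci tensor characterizing bi-Hermitian Gray surfaces. -/
theorem isBiHermitianGray_iff [Nonempty P] (hab : a < b) (hfg : IsWarpPair a b f g)
    (hg : ¬ ∃ r : ℝ, ∀ t ∈ Ioo a b, g t = r) (hflat : ¬ IsFlat conn) :
    (∃ r : ℝ, ∀ t ∈ Ioo a b, vertRicci f g t - 2 * horRicci f g c K t = r) ↔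
      IsBiHermitianGray (warpedMetric h p θ f g) conn := by
  constructor
  · intro hr
    obtain ⟨e, he⟩ := ((hfg.tfae_ricci hδ hg K hab).out 2 0).1 hr
    obtain ⟨r, hr⟩ := hr
    refine ⟨by simp, ?_, isACPerp_of_const hcov hconn hδ hr, warpedJ j p θ f 1, warpedJ j p θ f (-1),
      isHermitianStructure_warpedJ hcov hconn (Or.inl rfl),
      isHermitianStructure_warpedJ hcov hconn (Or.inr rfl), oppositeOrientations_warpedJ hcov,
      ricciEnd_warpedJ hcov hconn hδ 1, ricciEnd_warpedJ hcov hconn hδ (-1)⟩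
    -- Failure of irreducibility makes δ and m vanish identically, and then the remaining curvature
    -- functions vanish too, against non-flatness.
    by_contra hirr
    have h0 : ∀ t ∈ Ioo a b, deltaFn f g c t = 0 ∧ mixedFn f g c t = 0 := fun t ht ↦ by
      by_contra h0
      exact hirr (isIrreducible_of_ne_zero hcov hconn hδ ht h0)
    have h1 := fun t (ht : t ∈ Ioo a b) ↦ hfg.curvature_functions_eq_zero hδ hg he
      (fun t ht ↦ (h0 t ht).1) (fun t ht ↦ (h0 t ht).2) ht
    exact hflat (isFlat_of_eq_zero hcov hconn (fun t ht ↦ (hδ t ht).trans (h0 t ht).1)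
      (fun t ht ↦ (h1 t ht).1) (fun t ht ↦ (h0 t ht).1) (fun t ht ↦ (h0 t ht).2)
      fun t ht ↦ (h1 t ht).2)
  · exact fun hG ↦ const_of_isACPerp hcov hconn hδ hab hG.acPerp

end BiHermitian

/-! ### Identification of the Ricci eigenvalues and conclusion. -/

section RicciEigenvalues

variable {B : Type*} [TopologicalSpace B] [ChartedSpace (EuclideanSpace ℝ (Fin 2)) B]
  [IsManifold (𝓡 2) ∞ B]
  {P : Type*} [TopologicalSpace P] [ChartedSpace (EuclideanSpace ℝ (Fin 3)) P]
  [IsManifold (𝓡 3) ∞ P] {a b : ℝ}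
  {h : Π y : B, TangentSpace (𝓡 2) y →L[ℝ] TangentSpace (𝓡 2) y →L[ℝ] ℝ}
  {j : Π y : B, TangentSpace (𝓡 2) y →L[ℝ] TangentSpace (𝓡 2) y}
  {p : P → B} {θ : Π q : P, TangentSpace (𝓡 3) q →L[ℝ] ℝ} {f g : ℝ → ℝ} {c K : ℝ}
  {conn : CovariantDerivative cylModel (ℝ × EuclideanSpace ℝ (Fin 3))
    (TangentSpace cylModel : Cyl a b P → Type _)}

/-- If the Ricci endomorphism has eigenvalues `lam` and `mu` on the vertical distribution and on its
orthogonal complement, then they are the values of the corresponding curvature functions. -/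
theorem ricci_eigenvalues
    (hcov : ∀ x₀ : Cyl a b P, ∃ V e α κ, x₀ ∈ V ∧ IsAdaptedFrame h j p θ f g c K V e α κ)
    (hconn : IsLeviCivita (warpedMetric h p θ f g) conn) {lam mu : Cyl a b P → ℝ}
    (hlam : ∀ x, ∀ v ∈ vertDistribution p θ x, ricciEnd (warpedMetric h p θ f g) conn x v = lam x • v)
    (hmu : ∀ x, ∀ v ∈ orthDistribution (warpedMetric h p θ f g) (vertDistribution p θ) x,
      ricciEnd (warpedMetric h p θ f g) conn x v = mu x • v) (x : Cyl a b P) :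
    lam x = vertRicci f g (tCoord x) ∧ mu x = horRicci f g c K (tCoord x) ∧
      etaFn g (tCoord x) = deltaFn f g c (tCoord x) := by
  obtain ⟨V, e, α, κ, hx, hA⟩ := hcov x
  have hd := hA.dual x hx
  have hS := hA.ricciEnd_eq hconn hx
  have key : ∀ (i : Fin 4) (r : ℝ), ricciEnd (warpedMetric h p θ f g) conn x (e i x) = r • e i x →
      r = cylRicci f g c K (tCoord x) i := by
    intro i r hr
    have h1 := hS (e i x) i
    rw [hr, map_smul, hd, if_pos rfl, mul_one, smul_eq_mul, mul_one] at h1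
    exact h1
  have h0 := key 0 _ (hlam x _ ((hA.mem_vertDistribution hx _).2 (by simp [hd])))
  have h1 := key 1 _ (hlam x _ ((hA.mem_vertDistribution hx _).2 (by simp [hd])))
  have h2 := key 2 _ (hmu x _ ((hA.mem_orthDistribution hx _).2 (by simp [hd])))
  refine ⟨h0, h2, ?_⟩
  have h3 : -etaFn f (tCoord x) - 2 * etaFn g (tCoord x) =
      -etaFn f (tCoord x) - 2 * deltaFn f g c (tCoord x) := h0.symm.trans h1
  linarith

end RicciEigenvalues

end GraySurface

open GraySurface
theorem proposition6
    {B : Type*} [TopologicalSpace B] [ChartedSpace (EuclideanSpace ℝ (Fin 2)) B]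
    [IsManifold (𝓡 2) ∞ B] [T2Space B] [CompactSpace B] [ConnectedSpace B]
    {P : Type*} [TopologicalSpace P] [ChartedSpace (EuclideanSpace ℝ (Fin 3)) P]
    [IsManifold (𝓡 3) ∞ P] [T2Space P] [MulAction Circle P]
    (h : ContMDiffRiemannianMetric (𝓡 2) ∞ (EuclideanSpace ℝ (Fin 2))
      (TangentSpace (𝓡 2) : B → Type _))
    (j : Π y : B, TangentSpace (𝓡 2) y →L[ℝ] TangentSpace (𝓡 2) y)
    (hj : IsHermitianStructure h.inner j)
    (K : ℝ) (hK : HasConstantCurvature h.inner K)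
    (p : P → B) (hp : IsCircleBundle p)
    (θ : Π q : P, TangentSpace (𝓡 3) q →L[ℝ] ℝ) (hθ : IsConnectionForm θ)
    (c : ℝ) (hc : HasCurvatureForm h.inner j p θ c)
    (a b : ℝ) (hab : a < b) (f g : ℝ → ℝ)
    (hf : ContDiffOn ℝ ∞ f (Ioo a b)) (hg : ContDiffOn ℝ ∞ g (Ioo a b))
    (hf_pos : ∀ t ∈ Ioo a b, 0 < f t) (hg_pos : ∀ t ∈ Ioo a b, 0 < g t)
    (conn : CovariantDerivative cylModel (ℝ × EuclideanSpace ℝ (Fin 3))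
      (TangentSpace cylModel : Cyl a b P → Type _))
    (hconn : IsLeviCivita (warpedMetric h.inner p θ f g) conn) :
    IsTotallyGeodesicFoliation conn 2 (vertDistribution p θ) ∧
    IsHermitianStructure (warpedMetric h.inner p θ f g) (warpedJ (a := a) (b := b) j p θ f 1) ∧
    IsHermitianStructure (warpedMetric h.inner p θ f g) (warpedJ (a := a) (b := b) j p θ f (-1)) ∧
    (∀ x : Cyl a b P, ∀ v ∈ vertDistribution p θ x, v ∈ nullity conn (warpedJ j p θ f 1) x) ∧
    (∀ x : Cyl a b P, ∀ v ∈ vertDistribution p θ x, v ∈ nullity conn (warpedJ j p θ f (-1)) x) ∧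
    IsUmbilical (warpedMetric h.inner p θ f g) conn 2
      (orthDistribution (warpedMetric h.inner p θ f g) (vertDistribution p θ))
      (fun x ↦ -gradient (warpedMetric h.inner p θ f g)
        (fun x' : Cyl a b P ↦ Real.log (g (tCoord x'))) x) ∧
    ∀ lam mu : Cyl a b P → ℝ,
      (∀ x, ∀ v ∈ vertDistribution p θ x,
        ricciEnd (warpedMetric h.inner p θ f g) conn x v = lam x • v) →
      (∀ x, ∀ v ∈ orthDistribution (warpedMetric h.inner p θ f g) (vertDistribution p θ) x,
        ricciEnd (warpedMetric h.inner p θ f g) conn x v = mu x • v) →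
      (¬ ∃ r : ℝ, ∀ t ∈ Ioo a b, g t = r) →
      List.TFAE [
        ∃ e : ℝ, ∀ x, lam x - mu x = e * g (tCoord x) ^ 2,
        ∃ C D : ℝ, ∀ x, mu x = C * g (tCoord x) ^ 2 + D,
        ∃ r : ℝ, ∀ x, lam x - 2 * mu x = r] ∧
      (¬ IsFlat conn →
        ((∃ r : ℝ, ∀ x, lam x - 2 * mu x = r) ↔
          IsBiHermitianGray (warpedMetric h.inner p θ f g) conn)) := by
  have hfg : IsWarpPair a b f g := ⟨hf, hg, hf_pos, hg_pos⟩
  have hcov : ∀ x₀ : Cyl a b P, ∃ V e α κ, x₀ ∈ V ∧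
      IsAdaptedFrame h.inner j p θ f g c K V e α κ :=
    exists_adapted_frame h hj hK hp hθ hc hfg
  refine ⟨isTotallyGeodesicFoliation_vertDistribution hcov hconn,
    isHermitianStructure_warpedJ hcov hconn (Or.inl rfl),
    isHermitianStructure_warpedJ hcov hconn (Or.inr rfl),
    vertDistribution_subset_nullity hcov hconn 1, vertDistribution_subset_nullity hcov hconn (-1),
    isUmbilical_orthDistribution hcov hconn, fun lam mu hlam hmu hg' ↦ ?_⟩
  obtain ⟨y₀⟩ : Nonempty B := inferInstance
  obtain ⟨q₀, -⟩ := hp.surjective y₀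
  have : Nonempty P := ⟨q₀⟩
  have hr := ricci_eigenvalues hcov hconn hlam hmu
  have hδ : ∀ t ∈ Ioo a b, etaFn g t = deltaFn f g c t := fun t ht ↦
    (hr ((⟨t, ht⟩, q₀) : Cyl a b P)).2.2
  -- Both eigenvalues are functions of t, and every t in (a, b) is attained since P is nonempty; so
  -- pointwise conditions on the cylinder become conditions on the interval.
  have hall : ∀ q : ℝ → ℝ → ℝ → Prop, (∀ x, q (tCoord x) (lam x) (mu x)) ↔
      ∀ t ∈ Ioo a b, q t (vertRicci f g t) (horRicci f g c K t) := by
    refine fun q ↦ ⟨fun hq t ht ↦ ?_, fun hq x ↦ ?_⟩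
    · have h1 := hq ((⟨t, ht⟩, q₀) : Cyl a b P)
      rw [(hr _).1, (hr _).2.1] at h1
      exact h1
    · rw [(hr x).1, (hr x).2.1]
      exact hq _ (tCoord_mem x)
  have ha : ∀ e : ℝ, _ := fun e ↦ hall fun t l m ↦ l - m = e * g t ^ 2
  have hb : ∀ C D : ℝ, _ := fun C D ↦ hall fun t _ m ↦ m = C * g t ^ 2 + D
  have hc' : ∀ r : ℝ, _ := fun r ↦ hall fun _ l m ↦ l - 2 * m = r
  refine ⟨?_, fun hflat ↦ ?_⟩
  · simp only [ha, hb, hc']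
    exact hfg.tfae_ricci hδ hg' K hab
  · simp only [hc']
    exact isBiHermitianGray_iff hcov hconn hδ hab hfg hg' hflat
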